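/- Let $G$ be a countable unital inverse semigroup; subinverse semigroups of $G$ are understood to contain the unit of $G$, and projections are idempotents. For a subinverse semigroup $H\subseteq G$, an $H$-algebra is a (trivially graded) $C^*$-algebra $A$ with a unital semigroup homomorphism $\alpha:H\to\mathrm{End}(A)$ into its $*$-endomorphisms such that $\alpha_{gg^{-1}}(x)y=x\,\alpha_{gg^{-1}}(y)$ for all $g\in H$, $x,y\in A$, and such that the zero element $0\neq 1$ of $G$, if it exists and lies in $H$, acts as $0$. For $H$-algebras $A,B$ let $KK^H(A,B)$ be the abelian group of homotopy classes (homotopies being cycles over $B[0,1]$) of compatible $H$-equivariant Kasparov cycles $(\mathcal E,T)$. That is, $\mathcal E$ is a countably generated $\mathbb Z/2$-graded Hilbert $B$-module with a unital homomorphism $U$ of $H$ into the linear, grading-preserving maps of $\mathcal E$ (the zero of $G$, if in $H$, acting as $0$) such that $\langle U_g\xi,U_g\eta\rangle=g(\langle\xi,\eta\rangle)$, $U_g(\xi b)=U_g(\xi)\,g(b)$ and $U_{gg^{-1}}(\xi)b=\xi\, gg^{-1}(b)$. The algebra $A$ acts on $\mathcal E$ through a grading-preserving $*$-homomorphism $A\to\mathcal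 L(\mathcal E)$ with $g(a)=U_g\,a\,U_{g^{-1}}$ and $gg^{-1}(a)\xi=a\,U_{gg^{-1}}\xi$. The operator $T\in\mathcal L(\mathcal E)$ is odd, the operators $[T,a]$, $(T^2-1)a$, $(T-T^*)a$ are compact for all $a\in A$, and $aS,\,Sa$ are compact for all $a\in A$ and $S=U_gTU_{g^{-1}}-TU_{gg^{-1}}$, $g\in H$. Addition is given by direct sums of cycles. **Lemma.** Let $L\subseteq G$ be a finite subinverse semigroup, $P\subseteq G$ a set of projections, and $L'\subseteq G$ the subinverse semigroup generated by $L\cup P$. Assume that $L'$ is $E$-unitary, i.e. whenever $e,s\in L'$ and $e$, $es$ are projections, $s$ is a projection. Let $A$ be a finite-dimensional commutative $L'$-algebra, and let $\mathrm{Res}_{L'}^{L}A$ be $A$ with the action restricted to $L$. Then there are an $n\ge 1$ and an assignment which attaches to every $L$-algebra $B$ a $C^*$-subalgebra $B'\subseteq B^n$ together with an $L'$-action on $B'$, such that: 1. For every $L$-algebra $B$ there is an isomorphism of abelian groups $$KK^{L}(\mathrm{Res}_{L'}^{L}A,\,B)\;\cong\;KK^{L'}(A,\,B').$$ 2. The assignment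 is canonical (functorial): for every $L$-equivariant $*$-homomorphism $f:B\to C$, the map $f^n:B^n\to C^n$ restricts to an $L'$-equivariant $*$-homomorphism $f':B'\to C'$. 3. The assignment commutes canonically with arbitrary (infinite) direct sums: if $B$ is the $C^*$-direct sum ($c_0$-sum) of a family of $L$-algebras $(B_i)_{i\in I}$ with $L$-equivariant embeddings $\iota_i:B_i\to B$, then $B'$ is the $C^*$-direct sum of the $L'$-algebras $B_i'$ with embeddings $\iota_i':B_i'\to B'$. -/

import Mathlib

open scoped RightActions

set_option linter.unusedSectionVars false

universe t u v w

namespace InvKK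

/-- A unital inverse semigroup: a monoid in which every `x` has a unique generalized inverse. -/
class InverseMonoid (G : Type w) extends Monoid G, Inv G where
  mul_inv_mul_self (x : G) : x * x⁻¹ * x = x
  inv_mul_self_inv (x : G) : x⁻¹ * x * x⁻¹ = x⁻¹
  eq_inv_of (x y : G) : x * y * x = x → y * x * y = y → y = x⁻¹

/-- A subinverse semigroup of `G`; it contains the unit of `G` by convention. -/
structure SubInverse (G : Type w) [InverseMonoid G] extends Submonoid G where
  inv_mem' {x : G} : x ∈ carrier → x⁻¹ ∈ carrier

section SubInverse

variable {G : Type w} [InverseMonoid G]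

instance : SetLike (SubInverse G) G where
  coe H := H.carrier
  coe_injective := by
    rintro ⟨H, hH⟩ ⟨K, hK⟩ h
    have : H = K := SetLike.coe_injective h
    subst this
    rfl

instance : SubmonoidClass (SubInverse G) G where
  mul_mem {H} _ _ ha hb := H.mul_mem' ha hb
  one_mem H := H.one_mem'

instance (H : SubInverse G) : Inv H where
  inv x := ⟨(x : G)⁻¹, H.inv_mem' x.2⟩

/-- The subinverse semigroup of `G` generated by a subset. -/
def SubInverse.generate (S : Set G) : SubInverse G where
  carrier := {x | ∀ H : SubInverse G, S ⊆ (H : Set G) → x ∈ H}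
  one_mem' H _ := one_mem H
  mul_mem' ha hb H hH := mul_mem (ha H hH) (hb H hH)
  inv_mem' ha H hH := H.inv_mem' (ha H hH)

/-- The subinverse semigroup generated by `L` and the elements of `P`. -/
def SubInverse.adjoin (L : SubInverse G) (P : Set G) : SubInverse G :=
  SubInverse.generate ((L : Set G) ∪ P)

theorem SubInverse.subset_adjoin (L : SubInverse G) (P : Set G) {x : G} (hx : x ∈ L) :
    x ∈ L.adjoin P := fun _ hH => hH (Or.inl hx)

/-- `H` is `E`-unitary: an element above a projection (idempotent) is itself a projection. -/
def SubInverse.IsEUnitary (H : SubInverse G) : Prop :=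
  ∀ e ∈ H, ∀ s ∈ H, IsIdempotentElem e → IsIdempotentElem (e * s) → IsIdempotentElem s

/-- `z` is a zero element of `G` (in the one-element semigroup, `1` does not count as one). -/
def IsZeroElement (z : G) : Prop := z ≠ 1 ∧ ∀ g : G, z * g = z ∧ g * z = z

end SubInverse

/-- The structure of an (ungraded) `H`-algebra on the `C⋆`-algebra `A`. -/
structure InvAction {G : Type w} [InverseMonoid G] (H : SubInverse G)
    (A : Type v) [NonUnitalCStarAlgebra A] where
  /-- the action, a unital semigroup homomorphism into the `⋆`-endomorphisms of `A` -/
  act : H →* (A →⋆ₙₐ[ℂ] A)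
  act_zero (z : H) : IsZeroElement (z : G) → act z = 0
  central (g : H) (x y : A) : act (g * g⁻¹) x * y = x * act (g * g⁻¹) y

namespace InvAction

variable {G : Type w} [InverseMonoid G]

/-- Restriction of an action to a smaller subinverse semigroup. -/
def restrict {H K : SubInverse G} (hHK : ∀ {x : G}, x ∈ H → x ∈ K)
    {A : Type v} [NonUnitalCStarAlgebra A] (α : InvAction K A) : InvAction H A where
  act :=
    { toFun := fun h => α.act ⟨h, hHK h.2⟩
      map_one' := α.act.map_one
      map_mul' := fun g h => α.act.map_mul ⟨g, hHK g.2⟩ ⟨h, hHK h.2⟩ }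
  act_zero z hz := α.act_zero ⟨z, hHK z.2⟩ hz
  central g := α.central ⟨g, hHK g.2⟩

open scoped CStarAlgebra in
/-- The `H`-algebra `B[0,1] = C([0,1], B)`, with `H` acting pointwise. -/
noncomputable def path {H : SubInverse G} {B : Type u} [NonUnitalCStarAlgebra B]
    (β : InvAction H B) : InvAction H C(unitInterval, B) where
  act :=
    { toFun := fun h =>
        { toFun := fun f => ⟨fun t => β.act h (f t), (map_continuous (β.act h)).comp f.continuous⟩
          map_smul' := fun c f => by ext t; simp
          map_zero' := by ext t; simp
          map_add' := fun f g => by ext t; simp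
          map_mul' := fun f g => by ext t; simp
          map_star' := fun f => by ext t; simp [map_star] }
      map_one' := by ext f t; simp
      map_mul' := fun g h => by
        ext f t
        change β.act (g * h) (f t) = β.act g (β.act h (f t))
        rw [map_mul]
        rfl }
  act_zero z hz := by ext f t; simp [β.act_zero z hz]
  central g x y := by ext t; exact β.central g (x t) (y t)

/-- `f` is `H`-equivariant. -/
def Equivariant {H : SubInverse G} {B C : Type*} [NonUnitalCStarAlgebra B]
    [NonUnitalCStarAlgebra C] (β : InvAction H B) (γ : InvAction H C) (f : B →⋆ₙₐ[ℂ] C) : Prop :=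
  ∀ (h : H) (b : B), f (β.act h b) = γ.act h (f b)

end InvAction

/-! ### Hilbert modules

Mathlib's `CStarModule A E` satisfies `⟪x, a • y⟫ = a * ⟪x, y⟫`. Hence a right Hilbert `B`-module
in the usual sense is a complete `CStarModule Bᵐᵒᵖ E`: one writes `ξ <• b` for `op b • ξ`, and the
`B`-valued inner product is `unop ⟪x, y⟫`. The order that Mathlib asks for is the canonical one. -/

noncomputable instance opSpectralOrder (B : Type u) [NonUnitalCStarAlgebra B] :
    PartialOrder Bᵐᵒᵖ := CStarAlgebra.spectralOrder Bᵐᵒᵖ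

instance opSpectralOrderedRing (B : Type u) [NonUnitalCStarAlgebra B] :
    StarOrderedRing Bᵐᵒᵖ := CStarAlgebra.spectralOrderedRing Bᵐᵒᵖ

/-- A `ℤ/2`-graded, countably generated `H`-Hilbert `B`-module over the (trivially graded)
`H`-algebra `(B, β)`. -/
structure HilbertMod {G : Type w} [InverseMonoid G] {H : SubInverse G}
    {B : Type u} [NonUnitalCStarAlgebra B] (β : InvAction H B) where
  /-- the underlying space -/
  E : Type u
  [normedAddCommGroup : NormedAddCommGroup E]
  [normedSpace : NormedSpace ℂ E]
  [completeSpace : CompleteSpace E]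
  [smul : SMul Bᵐᵒᵖ E]
  [cstarModule : CStarModule Bᵐᵒᵖ E]
  countably_generated : ∃ S : Set E, S.Countable ∧
    (Submodule.span ℂ {x : E | ∃ ξ ∈ S, ∃ b : B, x = ξ <• b}).topologicalClosure = ⊤
  /-- the grading operator: `+1` on the even part, `-1` on the odd part -/
  grading : E →L[ℂ] E
  grading_sq (ξ : E) : grading (grading ξ) = ξ
  inner_grading (ξ η : E) : inner Bᵐᵒᵖ (grading ξ) (grading η) = inner Bᵐᵒᵖ ξ η
  /-- the action of `H` (which consists of linear contractions, so that continuity is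
  automatic) -/
  U : H →* (E →L[ℂ] E)
  U_zero (z : H) : IsZeroElement (z : G) → U z = 0
  U_grading (g : H) (ξ : E) : U g (grading ξ) = grading (U g ξ)
  inner_U (g : H) (ξ η : E) :
    (inner Bᵐᵒᵖ (U g ξ) (U g η)).unop = β.act g (inner Bᵐᵒᵖ ξ η).unop
  U_smul (g : H) (ξ : E) (b : B) : U g (ξ <• b) = U g ξ <• β.act g b
  U_compatible (g : H) (ξ : E) (b : B) : U (g * g⁻¹) ξ <• b = ξ <• β.act (g * g⁻¹) b

attribute [instance] HilbertMod.normedAddCommGroup HilbertMod.normedSpace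
  HilbertMod.completeSpace HilbertMod.smul HilbertMod.cstarModule

/-- The compact operators `𝒦(E)` on the Hilbert `B`-module `E`: the closed linear span, in operator
norm, of the operators `ζ ↦ ξ ⟨η, ζ⟩`. -/
noncomputable def compactOperators (B : Type u) [NonUnitalCStarAlgebra B] (E : Type u) [NormedAddCommGroup E]
    [NormedSpace ℂ E] [SMul Bᵐᵒᵖ E] [CStarModule Bᵐᵒᵖ E] : Submodule ℂ (E →L[ℂ] E) :=
  (Submodule.span ℂ
    {S : E →L[ℂ] E | ∃ ξ η : E, ∀ ζ : E, S ζ = inner Bᵐᵒᵖ η ζ • ξ}).topologicalClosure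

/-- `H`-equivariant Kasparov cycles `(E, T)` for the `H`-algebras `(A, α)` and `(B, β)`. -/
structure Cycle {G : Type w} [InverseMonoid G] {H : SubInverse G}
    {A : Type v} [NonUnitalCStarAlgebra A] {B : Type u} [NonUnitalCStarAlgebra B]
    (α : InvAction H A) (β : InvAction H B) extends HilbertMod β where
  /-- the left action of `A` by adjointable operators of degree zero -/
  π : A →ₙₐ[ℂ] (E →L[ℂ] E)
  π_adjoint (a : A) (ξ η : E) : inner Bᵐᵒᵖ (π a ξ) η = inner Bᵐᵒᵖ ξ (π (star a) η)
  π_grading (a : A) (ξ : E) : π a (grading ξ) = grading (π a ξ)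
  π_equivariant (g : H) (a : A) : π (α.act g a) = U g * π a * U g⁻¹
  π_compatible (g : H) (a : A) (ξ : E) : π (α.act (g * g⁻¹) a) ξ = π a (U (g * g⁻¹) ξ)
  /-- the operator of the cycle -/
  T : E →L[ℂ] E
  /-- its adjoint -/
  Tadj : E →L[ℂ] E
  T_adjoint (ξ η : E) : inner Bᵐᵒᵖ (T ξ) η = inner Bᵐᵒᵖ ξ (Tadj η)
  T_odd (ξ : E) : T (grading ξ) = -grading (T ξ)
  commutator_compact (a : A) : T * π a - π a * T ∈ compactOperators B E
  sq_compact (a : A) : (T * T - 1) * π a ∈ compactOperators B E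
  selfAdjoint_compact (a : A) : (T - Tadj) * π a ∈ compactOperators B E
  invariant_compact (g : H) (a : A) :
    π a * (U g * T * U g⁻¹ - T * U (g * g⁻¹)) ∈ compactOperators B E ∧
      (U g * T * U g⁻¹ - T * U (g * g⁻¹)) * π a ∈ compactOperators B E


section Sum

open WithCStarModule

variable {B : Type u} [NonUnitalCStarAlgebra B]

section diag

variable {E F : Type u} [NormedAddCommGroup E] [NormedSpace ℂ E] [SMul Bᵐᵒᵖ E]
  [CStarModule Bᵐᵒᵖ E] [NormedAddCommGroup F] [NormedSpace ℂ F] [SMul Bᵐᵒᵖ F] [CStarModule Bᵐᵒᵖ F]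

/-- The operator `S ⊕ T` on `E ⊕ F`. -/
noncomputable def diagOp (S : E →L[ℂ] E) (T : F →L[ℂ] F) :
    C⋆ᵐᵒᵈ(Bᵐᵒᵖ, E × F) →L[ℂ] C⋆ᵐᵒᵈ(Bᵐᵒᵖ, E × F) :=
  (equivL ℂ (A := Bᵐᵒᵖ) (E := E × F)).symm.toContinuousLinearMap ∘L (S.prodMap T) ∘L
    (equivL ℂ (A := Bᵐᵒᵖ) (E := E × F)).toContinuousLinearMap

theorem diagOp_apply (S : E →L[ℂ] E) (T : F →L[ℂ] F) (x : C⋆ᵐᵒᵈ(Bᵐᵒᵖ, E × F)) :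
    diagOp S T x = (equiv Bᵐᵒᵖ (E × F)).symm (S x.1, T x.2) := rfl

theorem diagOp_mul (S S' : E →L[ℂ] E) (T T' : F →L[ℂ] F) :
    (diagOp S T * diagOp S' T' : C⋆ᵐᵒᵈ(Bᵐᵒᵖ, E × F) →L[ℂ] _) = diagOp (S * S') (T * T') := rfl

theorem diagOp_mul₃ (S S' S'' : E →L[ℂ] E) (T T' T'' : F →L[ℂ] F) :
    (diagOp (S * S' * S'') (T * T' * T'') : C⋆ᵐᵒᵈ(Bᵐᵒᵖ, E × F) →L[ℂ] _) =
      diagOp S T * diagOp S' T' * diagOp S'' T'' := rfl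

theorem diagOp_sub (S S' : E →L[ℂ] E) (T T' : F →L[ℂ] F) :
    (diagOp S T - diagOp S' T' : C⋆ᵐᵒᵈ(Bᵐᵒᵖ, E × F) →L[ℂ] _) = diagOp (S - S') (T - T') := rfl

theorem diagOp_add (S S' : E →L[ℂ] E) (T T' : F →L[ℂ] F) :
    (diagOp S T + diagOp S' T' : C⋆ᵐᵒᵈ(Bᵐᵒᵖ, E × F) →L[ℂ] _) = diagOp (S + S') (T + T') := rfl

theorem diagOp_one : (diagOp 1 1 : C⋆ᵐᵒᵈ(Bᵐᵒᵖ, E × F) →L[ℂ] _) = 1 := rfl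

theorem diagOp_zero : (diagOp 0 0 : C⋆ᵐᵒᵈ(Bᵐᵒᵖ, E × F) →L[ℂ] _) = 0 := rfl

/-- A continuous linear map carrying the elementary compact operators to compact operators
carries compact operators to compact operators. -/
theorem map_mem_compactOperators {B' : Type u} [NonUnitalCStarAlgebra B']
    {E' : Type u} [NormedAddCommGroup E'] [NormedSpace ℂ E'] [SMul B'ᵐᵒᵖ E'] [CStarModule B'ᵐᵒᵖ E']
    (f : (E →L[ℂ] E) →L[ℂ] (E' →L[ℂ] E'))
    (hf : ∀ S : E →L[ℂ] E, (∃ ξ η : E, ∀ ζ : E, S ζ = inner Bᵐᵒᵖ η ζ • ξ) →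
      f S ∈ compactOperators B' E')
    {S : E →L[ℂ] E} (hS : S ∈ compactOperators B E) : f S ∈ compactOperators B' E' := by
  have h1 : Submodule.span ℂ {S : E →L[ℂ] E | ∃ ξ η : E, ∀ ζ : E, S ζ = inner Bᵐᵒᵖ η ζ • ξ} ≤
      (compactOperators B' E').comap f.toLinearMap :=
    Submodule.span_le.2 hf
  have h2 : IsClosed ((compactOperators B' E').comap f.toLinearMap : Set (E →L[ℂ] E)) :=
    (Submodule.isClosed_topologicalClosure _).preimage f.continuous
  exact Submodule.topologicalClosure_minimal _ h1 h2 hS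

theorem zero_smul_mod (x : E) : (0 : Bᵐᵒᵖ) • x = 0 := by
  rw [← CStarModule.inner_self (A := Bᵐᵒᵖ)]
  simp

theorem smul_zero_mod (b : Bᵐᵒᵖ) : b • (0 : E) = 0 := by
  rw [← CStarModule.inner_self (A := Bᵐᵒᵖ)]
  simp

theorem diagOp_mem_compactOperators {S : E →L[ℂ] E} {T : F →L[ℂ] F}
    (hS : S ∈ compactOperators B E) (hT : T ∈ compactOperators B F) :
    diagOp S T ∈ compactOperators B C⋆ᵐᵒᵈ(Bᵐᵒᵖ, E × F) := by
  let e := (equivL ℂ (A := Bᵐᵒᵖ) (E := E × F))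
  let i₁ : E →L[ℂ] C⋆ᵐᵒᵈ(Bᵐᵒᵖ, E × F) := e.symm.toContinuousLinearMap ∘L .inl ℂ E F
  let i₂ : F →L[ℂ] C⋆ᵐᵒᵈ(Bᵐᵒᵖ, E × F) := e.symm.toContinuousLinearMap ∘L .inr ℂ E F
  let p₁ : C⋆ᵐᵒᵈ(Bᵐᵒᵖ, E × F) →L[ℂ] E := .fst ℂ E F ∘L e.toContinuousLinearMap
  let p₂ : C⋆ᵐᵒᵈ(Bᵐᵒᵖ, E × F) →L[ℂ] F := .snd ℂ E F ∘L e.toContinuousLinearMap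
  let f₁ : (E →L[ℂ] E) →L[ℂ] (C⋆ᵐᵒᵈ(Bᵐᵒᵖ, E × F) →L[ℂ] C⋆ᵐᵒᵈ(Bᵐᵒᵖ, E × F)) :=
    (ContinuousLinearMap.compL ℂ C⋆ᵐᵒᵈ(Bᵐᵒᵖ, E × F) E C⋆ᵐᵒᵈ(Bᵐᵒᵖ, E × F) i₁) ∘L
      ((ContinuousLinearMap.compL ℂ C⋆ᵐᵒᵈ(Bᵐᵒᵖ, E × F) E E).flip p₁)
  let f₂ : (F →L[ℂ] F) →L[ℂ] (C⋆ᵐᵒᵈ(Bᵐᵒᵖ, E × F) →L[ℂ] C⋆ᵐᵒᵈ(Bᵐᵒᵖ, E × F)) :=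
    (ContinuousLinearMap.compL ℂ C⋆ᵐᵒᵈ(Bᵐᵒᵖ, E × F) F C⋆ᵐᵒᵈ(Bᵐᵒᵖ, E × F) i₂) ∘L
      ((ContinuousLinearMap.compL ℂ C⋆ᵐᵒᵈ(Bᵐᵒᵖ, E × F) F F).flip p₂)
  have h1 : f₁ S ∈ compactOperators B C⋆ᵐᵒᵈ(Bᵐᵒᵖ, E × F) := by
    refine map_mem_compactOperators f₁ ?_ hS
    rintro S ⟨ξ, η, h⟩
    refine Submodule.le_topologicalClosure _ (Submodule.subset_span
      ⟨e.symm (ξ, 0), e.symm (η, 0), fun ζ => ?_⟩)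
    refine (equiv Bᵐᵒᵖ (E × F)).injective (Prod.ext ?_ ?_)
    · change S ζ.1 = (inner Bᵐᵒᵖ η ζ.1 + inner Bᵐᵒᵖ (0 : F) ζ.2) • ξ
      simp [h]
    · change (0 : F) = (inner Bᵐᵒᵖ η ζ.1 + inner Bᵐᵒᵖ (0 : F) ζ.2) • (0 : F)
      rw [smul_zero_mod]
  have h2 : f₂ T ∈ compactOperators B C⋆ᵐᵒᵈ(Bᵐᵒᵖ, E × F) := by
    refine map_mem_compactOperators f₂ ?_ hT
    rintro S ⟨ξ, η, h⟩
    refine Submodule.le_topologicalClosure _ (Submodule.subset_span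
      ⟨e.symm (0, ξ), e.symm (0, η), fun ζ => ?_⟩)
    refine (equiv Bᵐᵒᵖ (E × F)).injective (Prod.ext ?_ ?_)
    · change (0 : E) = (inner Bᵐᵒᵖ (0 : E) ζ.1 + inner Bᵐᵒᵖ η ζ.2) • (0 : E)
      rw [smul_zero_mod]
    · change S ζ.2 = (inner Bᵐᵒᵖ (0 : E) ζ.1 + inner Bᵐᵒᵖ η ζ.2) • ξ
      simp [h]
  have h3 : diagOp S T = f₁ S + f₂ T := by
    ext x
    refine (equiv Bᵐᵒᵖ (E × F)).injective (Prod.ext ?_ ?_)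
    · change S x.1 = S x.1 + 0
      simp
    · change T x.2 = 0 + T x.2
      simp
  rw [h3]
  exact add_mem h1 h2

theorem diagOp_invariant_left {p u t v q : E →L[ℂ] E} {p' u' t' v' q' : F →L[ℂ] F}
    (h : p * (u * t * v - t * q) ∈ compactOperators B E)
    (h' : p' * (u' * t' * v' - t' * q') ∈ compactOperators B F) :
    diagOp p p' * (diagOp u u' * diagOp t t' * diagOp v v' - diagOp t t' * diagOp q q') ∈
      compactOperators B C⋆ᵐᵒᵈ(Bᵐᵒᵖ, E × F) :=
  diagOp_mem_compactOperators h h'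

theorem diagOp_invariant_right {p u t v q : E →L[ℂ] E} {p' u' t' v' q' : F →L[ℂ] F}
    (h : (u * t * v - t * q) * p ∈ compactOperators B E)
    (h' : (u' * t' * v' - t' * q') * p' ∈ compactOperators B F) :
    (diagOp u u' * diagOp t t' * diagOp v v' - diagOp t t' * diagOp q q') * diagOp p p' ∈
      compactOperators B C⋆ᵐᵒᵈ(Bᵐᵒᵖ, E × F) :=
  diagOp_mem_compactOperators h h'

end diag

variable {G : Type w} [InverseMonoid G] {H : SubInverse G} {β : InvAction H B}

/-- The direct sum of two graded `H`-Hilbert modules. -/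
noncomputable def HilbertMod.sum (M N : HilbertMod β) : HilbertMod β where
  E := C⋆ᵐᵒᵈ(Bᵐᵒᵖ, M.E × N.E)
  countably_generated := by
    obtain ⟨S, hS, hS'⟩ := M.countably_generated
    obtain ⟨T, hT, hT'⟩ := N.countably_generated
    let e := (equivL ℂ (A := Bᵐᵒᵖ) (E := M.E × N.E))
    let i₁ : M.E →L[ℂ] C⋆ᵐᵒᵈ(Bᵐᵒᵖ, M.E × N.E) :=
      e.symm.toContinuousLinearMap ∘L ContinuousLinearMap.inl ℂ M.E N.E
    let i₂ : N.E →L[ℂ] C⋆ᵐᵒᵈ(Bᵐᵒᵖ, M.E × N.E) :=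
      e.symm.toContinuousLinearMap ∘L ContinuousLinearMap.inr ℂ M.E N.E
    refine ⟨i₁ '' S ∪ i₂ '' T, (hS.image _).union (hT.image _), ?_⟩
    set K := (Submodule.span ℂ {x : C⋆ᵐᵒᵈ(Bᵐᵒᵖ, M.E × N.E) |
      ∃ ξ ∈ i₁ '' S ∪ i₂ '' T, ∃ b : B, x = ξ <• b}) with hK
    have h1 : (⊤ : Submodule ℂ M.E) ≤ K.topologicalClosure.comap i₁.toLinearMap := by
      rw [← hS']
      refine Submodule.topologicalClosure_minimal _ (Submodule.span_le.2 ?_)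
        ((Submodule.isClosed_topologicalClosure _).preimage i₁.continuous)
      rintro _ ⟨ξ, hξ, b, rfl⟩
      refine K.le_topologicalClosure (Submodule.subset_span ⟨i₁ ξ, Or.inl ⟨ξ, hξ, rfl⟩, b, ?_⟩)
      refine (equiv Bᵐᵒᵖ (M.E × N.E)).injective (Prod.ext rfl ?_)
      change (0 : N.E) = (0 : N.E) <• b
      rw [smul_zero_mod]
    have h2 : (⊤ : Submodule ℂ N.E) ≤ K.topologicalClosure.comap i₂.toLinearMap := by
      rw [← hT']
      refine Submodule.topologicalClosure_minimal _ (Submodule.span_le.2 ?_)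
        ((Submodule.isClosed_topologicalClosure _).preimage i₂.continuous)
      rintro _ ⟨ξ, hξ, b, rfl⟩
      refine K.le_topologicalClosure (Submodule.subset_span ⟨i₂ ξ, Or.inr ⟨ξ, hξ, rfl⟩, b, ?_⟩)
      refine (equiv Bᵐᵒᵖ (M.E × N.E)).injective (Prod.ext ?_ rfl)
      change (0 : M.E) = (0 : M.E) <• b
      rw [smul_zero_mod]
    refine eq_top_iff.2 fun x _ => ?_
    have hx : x = i₁ x.1 + i₂ x.2 := by
      refine (equiv Bᵐᵒᵖ (M.E × N.E)).injective (Prod.ext ?_ ?_)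
      · change x.1 = x.1 + 0
        simp
      · change x.2 = 0 + x.2
        simp
    rw [hx]
    exact add_mem (h1 (Submodule.mem_top (x := x.1))) (h2 (Submodule.mem_top (x := x.2)))
  grading := diagOp M.grading N.grading
  grading_sq ξ := Prod.ext (M.grading_sq ξ.1) (N.grading_sq ξ.2)
  inner_grading ξ η := congrArg₂ (· + ·) (M.inner_grading ξ.1 η.1) (N.inner_grading ξ.2 η.2)
  U :=
    { toFun := fun g => diagOp (M.U g) (N.U g)
      map_one' := by rw [map_one, map_one, diagOp_one]
      map_mul' := fun g h => by rw [map_mul, map_mul, diagOp_mul] }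
  U_zero z hz := by
    change diagOp (M.U z) (N.U z) = 0
    rw [M.U_zero z hz, N.U_zero z hz, diagOp_zero]
  U_grading g ξ := Prod.ext (M.U_grading g ξ.1) (N.U_grading g ξ.2)
  inner_U g ξ η := by
    change (inner Bᵐᵒᵖ (M.U g ξ.1) (M.U g η.1)).unop + (inner Bᵐᵒᵖ (N.U g ξ.2) (N.U g η.2)).unop =
      β.act g ((inner Bᵐᵒᵖ ξ.1 η.1).unop + (inner Bᵐᵒᵖ ξ.2 η.2).unop)
    rw [M.inner_U, N.inner_U, map_add]
  U_smul g ξ b := Prod.ext (M.U_smul g ξ.1 b) (N.U_smul g ξ.2 b)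
  U_compatible g ξ b := Prod.ext (M.U_compatible g ξ.1 b) (N.U_compatible g ξ.2 b)

variable {A : Type v} [NonUnitalCStarAlgebra A] {α : InvAction H A}

/-- The direct sum of two Kasparov cycles. -/
noncomputable def Cycle.sum (c d : Cycle α β) : Cycle α β where
  toHilbertMod := c.toHilbertMod.sum d.toHilbertMod
  π :=
    { toFun := fun a => diagOp (c.π a) (d.π a)
      map_smul' := fun z a => by rw [map_smul, map_smul]; rfl
      map_zero' := by rw [map_zero, map_zero, diagOp_zero]; rfl
      map_add' := fun a b => by rw [map_add, map_add, ← diagOp_add]; rfl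
      map_mul' := fun a b => by rw [map_mul, map_mul, ← diagOp_mul]; rfl }
  π_adjoint a ξ η := congrArg₂ (· + ·) (c.π_adjoint a ξ.1 η.1) (d.π_adjoint a ξ.2 η.2)
  π_grading a ξ := Prod.ext (c.π_grading a ξ.1) (d.π_grading a ξ.2)
  π_equivariant g a :=
    (congrArg₂ diagOp (c.π_equivariant g a) (d.π_equivariant g a)).trans (diagOp_mul₃ ..)
  π_compatible g a ξ := Prod.ext (c.π_compatible g a ξ.1) (d.π_compatible g a ξ.2)
  T := diagOp c.T d.T
  Tadj := diagOp c.Tadj d.Tadj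
  T_adjoint ξ η := congrArg₂ (· + ·) (c.T_adjoint ξ.1 η.1) (d.T_adjoint ξ.2 η.2)
  T_odd ξ := Prod.ext (c.T_odd ξ.1) (d.T_odd ξ.2)
  commutator_compact a :=
    diagOp_mem_compactOperators (c.commutator_compact a) (d.commutator_compact a)
  sq_compact a := diagOp_mem_compactOperators (c.sq_compact a) (d.sq_compact a)
  selfAdjoint_compact a :=
    diagOp_mem_compactOperators (c.selfAdjoint_compact a) (d.selfAdjoint_compact a)
  invariant_compact g a :=
    ⟨diagOp_invariant_left (c.invariant_compact g a).1 (d.invariant_compact g a).1,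
      diagOp_invariant_right (c.invariant_compact g a).2 (d.invariant_compact g a).2⟩

end Sum

/-! ### The constant path of a Kasparov cycle -/

section Const

open MulOpposite

variable {B : Type u} [NonUnitalCStarAlgebra B]
variable {E : Type u} [NormedAddCommGroup E] [NormedSpace ℂ E] [SMul Bᵐᵒᵖ E] [CStarModule Bᵐᵒᵖ E]

theorem mod_ext {x y : E} (h : ∀ z : E, inner Bᵐᵒᵖ z x = inner Bᵐᵒᵖ z y) : x = y := by
  rw [← sub_eq_zero, ← CStarModule.inner_self (A := Bᵐᵒᵖ), CStarModule.inner_sub_right, h, sub_self]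

theorem norm_smul_mod_le (b : Bᵐᵒᵖ) (x : E) : ‖b • x‖ ≤ ‖b‖ * ‖x‖ := by
  refine abs_le_of_sq_le_sq' ?_ (by positivity) |>.2
  rw [CStarModule.norm_sq_eq Bᵐᵒᵖ, CStarModule.inner_op_smul_right, CStarModule.inner_op_smul_left]
  calc ‖b * (inner Bᵐᵒᵖ x x * star b)‖ ≤ ‖b‖ * (‖inner Bᵐᵒᵖ x x‖ * ‖star b‖) :=
        (norm_mul_le _ _).trans (by gcongr; exact norm_mul_le _ _)
    _ = (‖b‖ * ‖x‖) ^ 2 := by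
        rw [norm_star, ← CStarModule.norm_sq_eq Bᵐᵒᵖ]
        ring

variable (B E) in
/-- The action of `B` on a Hilbert `B`-module, as a continuous bilinear map. -/
noncomputable def smulL : Bᵐᵒᵖ →L[ℂ] E →L[ℂ] E :=
  LinearMap.mkContinuous₂
    (LinearMap.mk₂ ℂ (fun (b : Bᵐᵒᵖ) (x : E) => b • x)
      (fun b c x => mod_ext (B := B) fun z => by simp [add_mul])
      (fun t b x => mod_ext (B := B) fun z => by
        rw [CStarModule.inner_smul_right_complex, CStarModule.inner_op_smul_right,
          CStarModule.inner_op_smul_right, smul_mul_assoc])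
      (fun b x y => mod_ext (B := B) fun z => by simp [mul_add])
      (fun t b x => mod_ext (B := B) fun z => by
        rw [CStarModule.inner_smul_right_complex, CStarModule.inner_op_smul_right,
          CStarModule.inner_op_smul_right, CStarModule.inner_smul_right_complex,
          mul_smul_comm])) 1
    (fun b x => by simpa using norm_smul_mod_le b x)

theorem smulL_apply (b : Bᵐᵒᵖ) (x : E) : smulL B E b x = b • x := rfl

/-- The pointwise right action of `C([0,1], B)` on `C([0,1], E)`. -/
@[reducible] noncomputable def pathSMul : SMul C(unitInterval, B)ᵐᵒᵖ C(unitInterval, E) where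
  smul b f := ⟨fun t => smulL B E (op (b.unop t)) (f t), by fun_prop⟩

attribute [local instance] pathSMul

theorem pathSMul_apply (b : C(unitInterval, B)ᵐᵒᵖ) (f : C(unitInterval, E)) (t : unitInterval) :
    (b • f) t = op (b.unop t) • f t := rfl

/-- The pointwise inner product on `C([0,1], E)`. -/
noncomputable def pathInner (f g : C(unitInterval, E)) : C(unitInterval, B) :=
  ⟨fun t => (inner Bᵐᵒᵖ (f t) (g t)).unop, by
    have := CStarModule.continuous_inner (A := Bᵐᵒᵖ) (E := E)
    exact continuous_unop.comp (this.comp (f.continuous.prodMk g.continuous))⟩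

theorem op_nonneg_of_pointwise (f : C(unitInterval, B)) (hf : ∀ t, 0 ≤ op (f t)) : 0 ≤ op f := by
  have hc : Continuous fun t => CFC.sqrt (op (f t)) :=
    CFC.continuousOn_sqrt.comp_continuous (continuous_op.comp f.continuous) hf
  let g : C(unitInterval, B) := ⟨fun t => unop (CFC.sqrt (op (f t))), continuous_unop.comp hc⟩
  have : op f = star (op g) * op g := by
    refine unop_injective (ContinuousMap.ext fun t => op_injective ?_)
    change op (f t) = star (CFC.sqrt (op (f t))) * CFC.sqrt (op (f t)) 
    rw [(CFC.sqrt_nonneg (op (f t))).isSelfAdjoint.star_eq, CFC.sqrt_mul_sqrt_self _ (hf t)]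
  rw [this]
  exact star_mul_self_nonneg _

/-- `C([0,1], E)` as a Hilbert `C([0,1], B)`-module. -/
@[reducible] noncomputable def pathModule :
    CStarModule C(unitInterval, B)ᵐᵒᵖ C(unitInterval, E) where
  inner f g := op (pathInner f g)
  inner_add_right {x y z} := by
    refine unop_injective (ContinuousMap.ext fun t => ?_)
    simp [pathInner]
  inner_self_nonneg {x} := op_nonneg_of_pointwise _ fun t => CStarModule.inner_self_nonneg
  inner_self {x} := by
    rw [op_eq_zero_iff]
    refine ⟨fun h => ContinuousMap.ext fun t => ?_, fun h => ContinuousMap.ext fun t => ?_⟩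
    · rw [ContinuousMap.zero_apply, ← CStarModule.inner_self (A := Bᵐᵒᵖ)]
      exact unop_injective (congrArg (fun g : C(unitInterval, B) => g t) h)
    · simp [pathInner, h]
  inner_op_smul_right {a x y} := by
    refine unop_injective (ContinuousMap.ext fun t => ?_)
    change (inner Bᵐᵒᵖ (x t) (op (a.unop t) • y t)).unop = _
    rw [CStarModule.inner_op_smul_right]
    rfl
  inner_smul_right_complex {z x y} := by
    refine unop_injective (ContinuousMap.ext fun t => ?_)
    simp [pathInner]
  star_inner x y := by
    refine unop_injective (ContinuousMap.ext fun t => ?_)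
    change star (inner Bᵐᵒᵖ (x t) (y t)).unop = (inner Bᵐᵒᵖ (y t) (x t)).unop
    rw [← CStarModule.star_inner (x t)]
    rfl
  norm_eq_sqrt_norm_inner_self x := by
    have key (t : unitInterval) : ‖x t‖ ^ 2 = ‖pathInner (B := B) x x t‖ :=
      CStarModule.norm_sq_eq Bᵐᵒᵖ
    refine le_antisymm ?_ ?_
    · refine (ContinuousMap.norm_le _ (Real.sqrt_nonneg _)).2 fun t => ?_
      refine Real.le_sqrt_of_sq_le ?_
      rw [key]
      exact (pathInner (B := B) x x).norm_coe_le_norm t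
    · refine Real.sqrt_le_iff.2 ⟨norm_nonneg _, ?_⟩
      refine (ContinuousMap.norm_le _ (by positivity)).2 fun t => ?_
      rw [unop_op, ← key]
      gcongr
      exact x.norm_coe_le_norm t

attribute [local instance] pathModule

variable (E) in
/-- The operator on `C([0,1], E)` that applies an operator on `E` pointwise. -/
noncomputable def constOp : (E →L[ℂ] E) →L[ℂ] (C(unitInterval, E) →L[ℂ] C(unitInterval, E)) :=
  LinearMap.mkContinuous₂
    (LinearMap.mk₂ ℂ (fun (S : E →L[ℂ] E) (f : C(unitInterval, E)) =>
        (⟨fun t => S (f t), by fun_prop⟩ : C(unitInterval, E)))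
      (fun S T f => by ext t; simp) (fun c S f => by ext t; simp)
      (fun S f g => by ext t; simp) (fun c S f => by ext t; simp)) 1
    (fun S f => by
      refine (ContinuousMap.norm_le _ (by positivity)).2 fun t => ?_
      rw [one_mul]
      exact (S.le_opNorm _).trans (by gcongr; exact f.norm_coe_le_norm t))

theorem constOp_apply (S : E →L[ℂ] E) (f : C(unitInterval, E)) (t : unitInterval) :
    constOp E S f t = S (f t) := rfl

theorem constOp_mul (S T : E →L[ℂ] E) : constOp E (S * T) = constOp E S * constOp E T := rfl

theorem constOp_one : constOp E 1 = 1 := rfl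

theorem constOp_mem_compactOperators {S : E →L[ℂ] E} (hS : S ∈ compactOperators B E) :
    constOp E S ∈ compactOperators C(unitInterval, B) C(unitInterval, E) := by
  refine map_mem_compactOperators (constOp E) ?_ hS
  rintro S ⟨ξ, η, h⟩
  refine Submodule.le_topologicalClosure _ (Submodule.subset_span
    ⟨ContinuousMap.const _ ξ, ContinuousMap.const _ η, fun ζ => ContinuousMap.ext fun t => ?_⟩)
  exact h (ζ t)

variable {G : Type w} [InverseMonoid G] {H : SubInverse G} {β : InvAction H B}

theorem path_countably_generated (h : ∃ S : Set E, S.Countable ∧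
    (Submodule.span ℂ {x : E | ∃ ξ ∈ S, ∃ b : B, x = ξ <• b}).topologicalClosure = ⊤) :
    ∃ S : Set C(unitInterval, E), S.Countable ∧
    (Submodule.span ℂ {x : C(unitInterval, E) |
      ∃ ξ ∈ S, ∃ b : C(unitInterval, B), x = ξ <• b}).topologicalClosure = ⊤ := by
  obtain ⟨S, hS, hS'⟩ := h
  refine ⟨ContinuousMap.const _ '' S, hS.image _, ?_⟩
  set K := Submodule.span ℂ {x : C(unitInterval, E) |
      ∃ ξ ∈ ContinuousMap.const _ '' S, ∃ b : C(unitInterval, B), x = ξ <• b} with hK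
  have step (φ : C(unitInterval, ℝ)) (ξ : E) :
      φ • ContinuousMap.const unitInterval ξ ∈ K.topologicalClosure := by
    let m : E →L[ℂ] C(unitInterval, E) :=
      LinearMap.mkContinuous
        { toFun := fun ξ => φ • ContinuousMap.const unitInterval ξ
          map_add' := fun x y => by ext t; simp
          map_smul' := fun c x => by
            ext t
            exact smul_comm (φ t) c x } ‖φ‖
        (fun x => by
          refine (ContinuousMap.norm_le _ (by positivity)).2 fun t => ?_
          simp only [LinearMap.coe_mk, AddHom.coe_mk, ContinuousMap.smul_apply',
            ContinuousMap.const_apply, norm_smul]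
          gcongr
          exact φ.norm_coe_le_norm t)
    have h1 : (⊤ : Submodule ℂ E) ≤ K.topologicalClosure.comap m.toLinearMap := by
      rw [← hS']
      refine Submodule.topologicalClosure_minimal _ (Submodule.span_le.2 ?_)
        ((Submodule.isClosed_topologicalClosure _).preimage m.continuous)
      rintro _ ⟨s, hs, b, rfl⟩
      refine K.le_topologicalClosure (Submodule.subset_span ⟨_, ⟨s, hs, rfl⟩,
        φ • ContinuousMap.const unitInterval b, ContinuousMap.ext fun t => ?_⟩)
      change φ t • smulL B E (op b) s = smulL B E (op (φ t • b)) s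
      rw [op_smul, ← Complex.coe_smul, ← Complex.coe_smul, map_smul]
      rfl
    exact h1 (Submodule.mem_top (x := ξ))
  refine eq_top_iff.2 fun f _ => ?_
  refine (Submodule.isClosed_topologicalClosure K).mem_of_tendsto
    (bernsteinApproximation_uniform f) (Filter.Eventually.of_forall fun n => ?_)
  exact sum_mem fun k _ => step _ _

/-- The Hilbert `B[0,1]`-module of a constant path of Hilbert `B`-modules. -/
noncomputable def HilbertMod.constPath (M : HilbertMod β) : HilbertMod β.path where
  E := C(unitInterval, M.E)
  countably_generated := path_countably_generated M.countably_generated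
  grading := constOp M.E M.grading
  grading_sq ξ := ContinuousMap.ext fun t => M.grading_sq (ξ t)
  inner_grading ξ η := unop_injective <| ContinuousMap.ext fun t =>
    congrArg unop (M.inner_grading (ξ t) (η t))
  U :=
    { toFun := fun g => constOp M.E (M.U g)
      map_one' := by rw [map_one, constOp_one]
      map_mul' := fun g h => by rw [map_mul, constOp_mul] }
  U_zero z hz := by
    change constOp M.E (M.U z) = 0
    rw [M.U_zero z hz, map_zero]
  U_grading g ξ := ContinuousMap.ext fun t => M.U_grading g (ξ t)
  inner_U g ξ η := ContinuousMap.ext fun t => M.inner_U g (ξ t) (η t)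
  U_smul g ξ b := ContinuousMap.ext fun t => M.U_smul g (ξ t) (b t)
  U_compatible g ξ b := ContinuousMap.ext fun t => M.U_compatible g (ξ t) (b t)

theorem constOp_invariant_left {p u t v q : E →L[ℂ] E}
    (h : p * (u * t * v - t * q) ∈ compactOperators B E) :
    constOp E p * (constOp E u * constOp E t * constOp E v - constOp E t * constOp E q) ∈
      compactOperators C(unitInterval, B) C(unitInterval, E) := by
  have := constOp_mem_compactOperators h
  simpa only [constOp_mul, map_sub] using this

theorem constOp_invariant_right {p u t v q : E →L[ℂ] E}
    (h : (u * t * v - t * q) * p ∈ compactOperators B E) :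
    (constOp E u * constOp E t * constOp E v - constOp E t * constOp E q) * constOp E p ∈
      compactOperators C(unitInterval, B) C(unitInterval, E) := by
  have := constOp_mem_compactOperators h
  simpa only [constOp_mul, map_sub] using this

variable {A : Type v} [NonUnitalCStarAlgebra A] {α : InvAction H A}

/-- The constant path of Kasparov cycles. -/
noncomputable def Cycle.constPath (c : Cycle α β) : Cycle α β.path where
  toHilbertMod := c.toHilbertMod.constPath
  π :=
    { toFun := fun a => constOp c.E (c.π a)
      map_smul' := fun z a => by rw [map_smul, map_smul]; rfl
      map_zero' := by rw [map_zero, map_zero]; rfl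
      map_add' := fun a b => by rw [map_add, map_add]; rfl
      map_mul' := fun a b => by rw [map_mul, constOp_mul]; rfl }
  π_adjoint a ξ η := unop_injective <| ContinuousMap.ext fun t =>
    congrArg unop (c.π_adjoint a ((show C(unitInterval, c.E) from ξ) t) ((show C(unitInterval, c.E) from η) t))
  π_grading a ξ := ContinuousMap.ext fun t => c.π_grading a ((show C(unitInterval, c.E) from ξ) t)
  π_equivariant g a := congrArg (constOp c.E) (c.π_equivariant g a)
  π_compatible g a ξ := ContinuousMap.ext fun t => c.π_compatible g a ((show C(unitInterval, c.E) from ξ) t)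
  T := constOp c.E c.T
  Tadj := constOp c.E c.Tadj
  T_adjoint ξ η := unop_injective <| ContinuousMap.ext fun t =>
    congrArg unop (c.T_adjoint ((show C(unitInterval, c.E) from ξ) t) ((show C(unitInterval, c.E) from η) t))
  T_odd ξ := ContinuousMap.ext fun t => c.T_odd ((show C(unitInterval, c.E) from ξ) t)
  commutator_compact a := constOp_mem_compactOperators (c.commutator_compact a)
  sq_compact a := constOp_mem_compactOperators (c.sq_compact a)
  selfAdjoint_compact a := constOp_mem_compactOperators (c.selfAdjoint_compact a)
  invariant_compact g a := ⟨constOp_invariant_left (c.invariant_compact g a).1,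
    constOp_invariant_right (c.invariant_compact g a).2⟩

end Const

/-! ### Homotopy and the group `KK` -/

section KK

variable {G : Type w} [InverseMonoid G] {H : SubInverse G} {A : Type v} [NonUnitalCStarAlgebra A]
  {B : Type u} [NonUnitalCStarAlgebra B] {α : InvAction H A} {β : InvAction H B}

/-- The cycle `c` is (isomorphic to) the evaluation at `t ∈ [0,1]` of the cycle `p` over `B[0,1]`.
The pushforward of the Hilbert `B[0,1]`-module `F` along the evaluation `B[0,1] → B` is the quotient
of `F` by the vectors `ξ` with `⟨ξ, ξ⟩(t) = 0`; hence it is given by a surjection from `F` that is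
compatible with the inner products. -/
def Cycle.IsEvaluation (t : unitInterval) (p : Cycle α β.path) (c : Cycle α β) : Prop :=
  ∃ r : p.E →ₗ[ℂ] c.E, Function.Surjective r ∧
    (∀ ξ η, (inner Bᵐᵒᵖ (r ξ) (r η)).unop = (inner C(unitInterval, B)ᵐᵒᵖ ξ η).unop t) ∧
    (∀ ξ (f : C(unitInterval, B)), r (ξ <• f) = r ξ <• f t) ∧
    (∀ ξ, r (p.grading ξ) = c.grading (r ξ)) ∧
    (∀ (g : H) ξ, r (p.U g ξ) = c.U g (r ξ)) ∧
    (∀ (a : A) ξ, r (p.π a ξ) = c.π a (r ξ)) ∧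
    ∀ ξ, r (p.T ξ) = c.T (r ξ)

/-- Homotopy of Kasparov cycles, given by a cycle over `B[0,1]`. -/
def Cycle.Homotopic (c d : Cycle α β) : Prop :=
  ∃ p : Cycle α β.path, p.IsEvaluation 0 c ∧ p.IsEvaluation 1 d

theorem Cycle.Homotopic.refl (c : Cycle α β) : c.Homotopic c := by
  have (t : unitInterval) : c.constPath.IsEvaluation t c := by
    refine ⟨{ toFun := fun f : C(unitInterval, c.E) => f t
              map_add' := fun _ _ => rfl
              map_smul' := fun _ _ => rfl }, fun x => ⟨ContinuousMap.const _ x, rfl⟩,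
      fun _ _ => rfl, fun _ _ => rfl, fun _ => rfl, fun _ _ => rfl, fun _ _ => rfl, fun _ => rfl⟩
  exact ⟨c.constPath, this 0, this 1⟩

theorem Cycle.IsEvaluation.sum {t : unitInterval} {p q : Cycle α β.path} {c d : Cycle α β}
    (hp : p.IsEvaluation t c) (hq : q.IsEvaluation t d) : (p.sum q).IsEvaluation t (c.sum d) := by
  obtain ⟨r, h1, h2, h3, h4, h5, h6, h7⟩ := hp
  obtain ⟨s, k1, k2, k3, k4, k5, k6, k7⟩ := hq
  refine ⟨r.prodMap s, ?_, fun ξ η => ?_, fun ξ f => ?_, fun ξ => ?_, fun g ξ => ?_,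
    fun a ξ => ?_, fun ξ => ?_⟩
  · rintro ⟨x, y⟩
    obtain ⟨x, rfl⟩ := h1 x
    obtain ⟨y, rfl⟩ := k1 y
    exact ⟨(x, y), rfl⟩
  · exact congrArg₂ (· + ·) (h2 ξ.1 η.1) (k2 ξ.2 η.2)
  · exact Prod.ext (h3 _ _) (k3 _ _)
  · exact Prod.ext (h4 _) (k4 _)
  · exact Prod.ext (h5 _ _) (k5 _ _)
  · exact Prod.ext (h6 _ _) (k6 _ _)
  · exact Prod.ext (h7 _) (k7 _)

theorem Cycle.Homotopic.sum {c c' d d' : Cycle α β} (h : c.Homotopic c') (k : d.Homotopic d') :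
    (c.sum d).Homotopic (c'.sum d') := by
  obtain ⟨p, hp, hp'⟩ := h
  obtain ⟨q, hq, hq'⟩ := k
  exact ⟨p.sum q, hp.sum hq, hp'.sum hq'⟩

variable (α β) in
/-- The group `KK^H(A, B)` of homotopy classes of Kasparov cycles. -/
def KK : Type _ := Quot (Cycle.Homotopic (α := α) (β := β))

/-- Addition in `KK^H(A, B)` is induced by the direct sum of cycles. -/
noncomputable instance : Add (KK α β) where
  add := Quot.map₂ Cycle.sum (fun c _ _ h => (Cycle.Homotopic.refl c).sum h)
    (fun _ _ c h => h.sum (Cycle.Homotopic.refl c))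

end KK

/-! ### Subalgebras of `B^n` and direct sums -/

/-- A `C⋆`-subalgebra of `B^n` together with an `H`-action on it. -/
structure PowerSubalgebra {G : Type w} [InverseMonoid G] (H : SubInverse G) (B : Type u)
    [NonUnitalCStarAlgebra B] (n : ℕ) where
  /-- the subalgebra -/
  carrier : NonUnitalStarSubalgebra ℂ (Fin n → B)
  [isClosed : IsClosed (carrier : Set (Fin n → B))]
  /-- the action -/
  action : InvAction H carrier

attribute [instance] PowerSubalgebra.isClosed

/-- `f'` is the `H`-equivariant restriction of `f^n : B^n → C^n` to the given subalgebras. -/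
def PowerSubalgebra.IsLift {G : Type w} [InverseMonoid G] {H : SubInverse G} {B C : Type u}
    [NonUnitalCStarAlgebra B] [NonUnitalCStarAlgebra C] {n : ℕ}
    (S : PowerSubalgebra H B n) (S' : PowerSubalgebra H C n)
    (f : B →⋆ₙₐ[ℂ] C) (f' : S.carrier →⋆ₙₐ[ℂ] S'.carrier) : Prop :=
  (∀ (x : S.carrier) (k : Fin n), (f' x : Fin n → C) k = f ((x : Fin n → B) k)) ∧
    S.action.Equivariant S'.action f'

/-- `B` is the (possibly infinite) `C⋆`-algebraic direct sum of the `D i`, with canonical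
embeddings `ι i`: these are injective (hence isometric), have mutually orthogonal ranges, and the
sum of their ranges is dense. Equivalently, they induce an isomorphism of `B` with the algebra of
all families `(x i)` such that `‖x i‖` tends to zero. -/
def IsDirectSum {I : Type t} {D : I → Type u} [∀ i, NonUnitalCStarAlgebra (D i)]
    {B : Type u} [NonUnitalCStarAlgebra B] (ι : ∀ i, D i →⋆ₙₐ[ℂ] B) : Prop :=
  (∀ i, Function.Injective (ι i)) ∧
    (∀ i j, i ≠ j → ∀ x y, ι i x * ι j y = 0) ∧
    (Submodule.span ℂ (⋃ i, Set.range (ι i))).topologicalClosure = ⊤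

end InvKK

/-! The spectrum of `A` is a finite set of points, and an idempotent of `L'` acts on `A` as
multiplication by the indicator function of a set of points. Each point therefore defines a
0/1-valued character of the idempotents of `L'`. Let `I` be the finite set of characters so
obtained, together with the one of the zero functional, which vanishes identically and serves as the
target of every move out of a domain. Pulling functionals back along the action gives a right action
of `L'` on `I`, namely `(i · g)(e) = i(g e g⁻¹)`, and `A` has orthogonal projections `p i`, the
indicators of the fibres over `I` (`InvAction.exists_spectralData`).

The algebra `B'` consists of the families `b` in `B^I` such that every idempotent `q` of `L` acts on
`b i` as the scalar `i(q)`. Every `g` in `L'` is a restriction `g = g g⁻¹ l` of some `l` in `L`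
(`SubInverse.exists_isRestriction`), and `g` acts on `B'` by `(g b) i = l (b (i · g))`. This does
not depend on `l`: if `l` and `k` both extend `g`, then `k l⁻¹` lies above the projection `g g⁻¹`,
so it is itself a projection because `L'` is `E`-unitary, and `l` and `k` agree on it
(`SubInverse.exists_idem_of_isRestriction`, `SpectralData.act_eq_act`). Functoriality is
coordinatewise. Direct sums are respected because `B'` is the image of an equivariantly natural
continuous projection of `B^I`.

For the comparison of `KK`-groups, every cycle is first deformed into a normal one, in which the
unit of `A` acts as the identity and the operator commutes with all `p i`. The operator is replaced
by its diagonal part along a straight line, and the complement of the essential part is contracted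
by a cone (`Cycle.homotopic_compress`, `Cycle.homotopic_essential`). Normalization is compatible
with evaluation, so it applies to homotopies too.

Normal cycles over `B` and over `B'` are the same objects with different inner products. Over `B'`,
the coordinates of the inner product are summed (`Link.down`). Over `B`, the inner product `⟨x, p i
y⟩` becomes the `i`-th coordinate, and `g` acts as the projection `g g⁻¹(1)` times `U l`
(`Link.up`); `E`-unitarity again gives independence of `l`. The two passages are inverse up to
isomorphism of cycles (`Link.iso_down_up`, `Link.iso_up_down`). To treat homotopies, one works with
any algebra `C` having the coordinates of a coinduced algebra (`Link`): the paths in `B'` are then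
linked to the paths in `B` without being literally the coinduced algebra of the latter. -/

namespace InvKK

/-! ### Inverse semigroups -/

namespace InverseMonoid

variable {G : Type w} [InverseMonoid G] {e f g h : G}

theorem inv_eq_of {x y : G} (h1 : x * y * x = x) (h2 : y * x * y = y) : x⁻¹ = y :=
  (eq_inv_of x y h1 h2).symm

theorem mul_inv_mul_cancel (x : G) : x * (x⁻¹ * x) = x := by
  rw [← mul_assoc, mul_inv_mul_self]

theorem inverse_inverse (x : G) : x⁻¹⁻¹ = x :=
  inv_eq_of (inv_mul_self_inv x) (mul_inv_mul_self x)

theorem idem_inv (he : IsIdempotentElem e) : e⁻¹ = e :=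
  inv_eq_of (by rw [he.eq, he.eq]) (by rw [he.eq, he.eq])

theorem idem_mul_inv (x : G) : IsIdempotentElem (x * x⁻¹) := by
  rw [IsIdempotentElem, ← mul_assoc, mul_inv_mul_self]

theorem idem_inv_mul (x : G) : IsIdempotentElem (x⁻¹ * x) := by
  rw [IsIdempotentElem, ← mul_assoc, inv_mul_self_inv]

theorem idem_one : IsIdempotentElem (1 : G) := mul_one 1

/-- For `x = (e f)⁻¹` the element `f x e` is a generalized inverse of `e f` as well, so it equals
`x` by uniqueness. This makes `x` idempotent, hence its own inverse, and `e f = x⁻¹ = x`. -/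
theorem idem_mul (he : IsIdempotentElem e) (hf : IsIdempotentElem f) :
    IsIdempotentElem (e * f) := by
  set x := (e * f)⁻¹ with hx
  have h1 : e * f * x * (e * f) = e * f := mul_inv_mul_self _
  have h2 : x * (e * f) * x = x := inv_mul_self_inv _
  have h3 : f * x * e = x := by
    refine eq_inv_of _ _ ?_ ?_
    · calc e * f * (f * x * e) * (e * f) = e * (f * f) * x * (e * e) * f := by
            simp only [mul_assoc]
        _ = e * f * x * (e * f) := by rw [he.eq, hf.eq]; simp only [mul_assoc]
        _ = e * f := h1
    · calc f * x * e * (e * f) * (f * x * e) = f * x * (e * e) * (f * f) * x * e := by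
            simp only [mul_assoc]
        _ = f * (x * (e * f) * x) * e := by rw [he.eq, hf.eq]; simp only [mul_assoc]
        _ = f * x * e := by rw [h2]
  have h4 : IsIdempotentElem x := by
    calc x * x = f * x * e * (f * x * e) := by rw [h3]
      _ = f * (x * (e * f) * x) * e := by simp only [mul_assoc]
      _ = x := by rw [h2, h3]
  have h5 : x⁻¹ = e * f := inverse_inverse _
  rw [← h5, idem_inv h4]
  exact h4

/-- The products `e f` and `f e` are idempotent and generalized inverses of each other, while an
idempotent is its own inverse. -/
theorem idem_comm (he : IsIdempotentElem e) (hf : IsIdempotentElem f) : e * f = f * e := by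
  have h1 := idem_mul he hf
  have h2 := idem_mul hf he
  rw [← idem_inv h1]
  refine inv_eq_of ?_ ?_
  · calc e * f * (f * e) * (e * f) = e * (f * f) * (e * e) * f := by simp only [mul_assoc]
      _ = e * f * (e * f) := by rw [he.eq, hf.eq]; simp only [mul_assoc]
      _ = e * f := h1
  · calc f * e * (e * f) * (f * e) = f * (e * e) * (f * f) * e := by simp only [mul_assoc]
      _ = f * e * (f * e) := by rw [he.eq, hf.eq]; simp only [mul_assoc]
      _ = f * e := h2

/-- The commuting idempotents `h h⁻¹` and `g⁻¹ g` can be exchanged in the middle of the products. -/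
theorem mul_inv_rev' (g h : G) : (g * h)⁻¹ = h⁻¹ * g⁻¹ := by
  have hc := idem_comm (idem_mul_inv h) (idem_inv_mul g)
  refine inv_eq_of ?_ ?_
  · calc g * h * (h⁻¹ * g⁻¹) * (g * h) = g * ((h * h⁻¹) * (g⁻¹ * g)) * h := by
          simp only [mul_assoc]
      _ = (g * g⁻¹ * g) * (h * h⁻¹ * h) := by rw [hc]; simp only [mul_assoc]
      _ = g * h := by rw [mul_inv_mul_self, mul_inv_mul_self]
  · calc h⁻¹ * g⁻¹ * (g * h) * (h⁻¹ * g⁻¹) = h⁻¹ * ((g⁻¹ * g) * (h * h⁻¹)) * g⁻¹ := by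
          simp only [mul_assoc]
      _ = (h⁻¹ * h * h⁻¹) * (g⁻¹ * g * g⁻¹) := by rw [← hc]; simp only [mul_assoc]
      _ = h⁻¹ * g⁻¹ := by rw [inv_mul_self_inv, inv_mul_self_inv]

/-- An idempotent passes from the right of `g` to the left at the price of conjugation; this is what
lets restrictions be multiplied. -/
theorem mul_idem_eq (g : G) (he : IsIdempotentElem e) : g * e = g * e * g⁻¹ * g := by
  calc g * e = g * ((g⁻¹ * g) * e) := by rw [← mul_assoc, mul_inv_mul_cancel]
    _ = g * e * g⁻¹ * g := by rw [idem_comm (idem_inv_mul g) he]; simp only [mul_assoc]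

theorem idem_conj (g : G) (he : IsIdempotentElem e) : IsIdempotentElem (g * e * g⁻¹) := by
  calc g * e * g⁻¹ * (g * e * g⁻¹) = (g * e * g⁻¹ * g) * e * g⁻¹ := by simp only [mul_assoc]
    _ = g * (e * e) * g⁻¹ := by rw [← mul_idem_eq g he]; simp only [mul_assoc]
    _ = g * e * g⁻¹ := by rw [he.eq]

theorem idem_mul_inv_self (he : IsIdempotentElem e) : e * e⁻¹ = e := by
  rw [idem_inv he, he.eq]

/-- `g` is a restriction of `l`, in the natural partial order of an inverse semigroup. -/
def IsRestriction (g l : G) : Prop := g = g * g⁻¹ * l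

/-! ### The natural partial order. -/

namespace IsRestriction

/-- Any idempotent may witness a restriction: if `g = e l`, then `g g⁻¹ = e (l l⁻¹)` acts on `l`
just as `e` does. -/
theorem of_eq (he : IsIdempotentElem e) {l : G} (hg : g = e * l) : IsRestriction g l := by
  subst hg
  rw [IsRestriction, mul_inv_rev', idem_inv he]
  calc e * l = e * (l * l⁻¹ * l) := by rw [mul_inv_mul_self]
    _ = (e * e) * (l * l⁻¹) * l := by rw [he.eq]; simp only [mul_assoc]
    _ = e * (e * (l * l⁻¹)) * l := by simp only [mul_assoc]
    _ = e * l * (l⁻¹ * e) * l := by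
      rw [idem_comm he (idem_mul_inv l)]; simp only [mul_assoc]

theorem refl (g : G) : IsRestriction g g := (mul_inv_mul_self g).symm

theorem idem (he : IsIdempotentElem e) : IsRestriction e 1 := of_eq he (mul_one e).symm

variable {l k : G}

theorem mul (h1 : IsRestriction g l) (h2 : IsRestriction h k) : IsRestriction (g * h) (l * k) := by
  refine of_eq (e := g * g⁻¹ * (l * (h * h⁻¹) * l⁻¹))
    (idem_mul (idem_mul_inv g) (idem_conj l (idem_mul_inv h))) ?_
  calc g * h = (g * g⁻¹ * l) * (h * h⁻¹ * k) := by rw [← h1, ← h2]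
    _ = g * g⁻¹ * (l * (h * h⁻¹)) * k := by simp only [mul_assoc]
    _ = g * g⁻¹ * (l * (h * h⁻¹) * l⁻¹ * l) * k := by rw [← mul_idem_eq l (idem_mul_inv h)]
    _ = g * g⁻¹ * (l * (h * h⁻¹) * l⁻¹) * (l * k) := by simp only [mul_assoc]

theorem inv (h1 : IsRestriction g l) : IsRestriction g⁻¹ l⁻¹ := by
  refine of_eq (idem_conj l⁻¹ (idem_mul_inv g)) ?_
  rw [← mul_idem_eq l⁻¹ (idem_mul_inv g)]
  conv_lhs => rw [h1, mul_inv_rev', idem_inv (idem_mul_inv g)]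

theorem mul_inv_mul (h1 : IsRestriction g l) : l * l⁻¹ * (g * g⁻¹) = g * g⁻¹ := by
  conv_lhs => rw [h1]
  calc l * l⁻¹ * (g * g⁻¹ * l * (g * g⁻¹ * l)⁻¹) 
      = (l * l⁻¹) * (g * g⁻¹) * (l * (g * g⁻¹ * l)⁻¹) := by simp only [mul_assoc]
    _ = (g * g⁻¹) * ((l * l⁻¹ * l) * (g * g⁻¹ * l)⁻¹) := by
      rw [idem_comm (idem_mul_inv l) (idem_mul_inv g)]; simp only [mul_assoc]
    _ = g * g⁻¹ := by rw [mul_inv_mul_self, ← mul_assoc, ← h1]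

/-- On the range of `g` the inverse of the extension undoes `g`. Together with its mirror image this
eliminates `l` from conjugates. -/
theorem mul_inv_eq (h1 : IsRestriction g l) : g * l⁻¹ = g * g⁻¹ := by
  calc g * l⁻¹ = g * g⁻¹ * l * l⁻¹ := by rw [← h1]
    _ = g * g⁻¹ * (l * l⁻¹) := by simp only [mul_assoc]
    _ = g * g⁻¹ := by rw [idem_comm (idem_mul_inv g) (idem_mul_inv l), h1.mul_inv_mul]

theorem mul_inv_eq' (h1 : IsRestriction g l) : l * g⁻¹ = g * g⁻¹ := by
  have := congrArg (·⁻¹) h1.mul_inv_eq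
  simpa only [mul_inv_rev', inverse_inverse] using this

end IsRestriction

end InverseMonoid

open InverseMonoid

variable {G : Type w} [InverseMonoid G]

instance (H : SubInverse G) : InverseMonoid H where
  mul_inv_mul_self x := Subtype.ext (mul_inv_mul_self (x : G))
  inv_mul_self_inv x := Subtype.ext (inv_mul_self_inv (x : G))
  eq_inv_of x y h1 h2 := Subtype.ext (eq_inv_of (x : G) y (congrArg Subtype.val h1)
    (congrArg Subtype.val h2))

/-! ### Extending elements of `L'` to elements of `L`. -/

namespace SubInverse

/-- The elements of `L`, inside of `L.adjoin P`. -/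
def toAdjoin (L : SubInverse G) (P : Set G) : L →* L.adjoin P where
  toFun l := ⟨l, L.subset_adjoin P l.2⟩
  map_one' := rfl
  map_mul' _ _ := rfl

variable {L : SubInverse G} {P : Set G}

theorem toAdjoin_inv (l : L) : L.toAdjoin P l⁻¹ = (L.toAdjoin P l)⁻¹ := rfl

/-- The elements with an extension in `L` form a subinverse semigroup. It contains `L` trivially and
`P` because projections are restrictions of `1`. -/
theorem exists_isRestriction (hP : ∀ p ∈ P, IsIdempotentElem p) (g : L.adjoin P) :
    ∃ l : L, IsRestriction g (L.toAdjoin P l) := by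
  let K : SubInverse G :=
    { carrier := {x | ∃ l : L, IsRestriction x (l : G)}
      one_mem' := ⟨1, IsRestriction.refl _⟩
      mul_mem' := by
        rintro a b ⟨l, hl⟩ ⟨k, hk⟩
        exact ⟨l * k, hl.mul hk⟩
      inv_mem' := by
        rintro a ⟨l, hl⟩
        exact ⟨l⁻¹, hl.inv⟩ }
  obtain ⟨l, hl⟩ : (g : G) ∈ K := by
    refine g.2 K ?_
    rintro x (hx | hx)
    · exact ⟨⟨x, hx⟩, IsRestriction.refl _⟩
    · exact ⟨1, IsRestriction.idem (hP x hx)⟩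
  exact ⟨l, Subtype.ext hl⟩

/-- An `E`-unitarity consequence: two elements of `L` with a common restriction `g` agree on an
idempotent of `L` that dominates the range of `g`. -/
theorem exists_idem_of_isRestriction (hE : (L.adjoin P).IsEUnitary) {g : L.adjoin P} {l k : L}
    (hl : IsRestriction g (L.toAdjoin P l)) (hk : IsRestriction g (L.toAdjoin P k)) :
    ∃ q : L, IsIdempotentElem q ∧ q * l = q * k ∧
      g * g⁻¹ * L.toAdjoin P q = g * g⁻¹ := by
  -- The witness is `k * l⁻¹`: it lies above the projection `g g⁻¹`, so it is a projection by
  -- `E`-unitarity.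
  have h1 : g * g⁻¹ * L.toAdjoin P (k * l⁻¹) = g * g⁻¹ := by
    rw [map_mul, toAdjoin_inv, ← mul_assoc, ← hk, hl.mul_inv_eq]
  have hq : IsIdempotentElem (k * l⁻¹) := by
    have h2 : IsIdempotentElem (((L.toAdjoin P (k * l⁻¹) : L.adjoin P) : G)) := by
      refine hE (g * g⁻¹ : L.adjoin P) (SetLike.coe_mem _) _ (SetLike.coe_mem _)
        (congrArg Subtype.val (idem_mul_inv g)) ?_
      have h3 := idem_mul_inv g
      rw [← h1] at h3
      exact congrArg Subtype.val h3
    exact Subtype.ext h2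
  refine ⟨_, hq, ?_, h1⟩
  have h4 : k * l⁻¹ * (k * l⁻¹)⁻¹ = k * l⁻¹ := idem_mul_inv_self hq
  -- The two sides are inverse to each other, and an idempotent is its own inverse.
  have h5 : l * k⁻¹ = k * l⁻¹ := by
    rw [← idem_inv hq, mul_inv_rev', inverse_inverse]
  calc k * l⁻¹ * l = k * (l⁻¹ * l) := mul_assoc _ _ _
    _ = k * (l⁻¹ * l) * k⁻¹ * k := mul_idem_eq _ (idem_inv_mul l)
    _ = k * l⁻¹ * (l * k⁻¹) * k := by simp only [mul_assoc]
    _ = k * l⁻¹ * k := by rw [h5, hq.eq]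

end SubInverse

end InvKK

namespace InvKK
open InverseMonoid

/-! ### Characters of finite-dimensional commutative algebras -/

section Characters

variable {A : Type v} [NonUnitalCommCStarAlgebra A]

/-- Characters of `A`, together with the zero functional, are the characters of the unitization. -/
noncomputable def charEquiv : (A →ₙₐ[ℂ] ℂ) ≃ WeakDual.characterSpace ℂ (Unitization ℂ A) :=
  Unitization.lift.trans WeakDual.CharacterSpace.equivAlgHom.symm

theorem charEquiv_inr (χ : A →ₙₐ[ℂ] ℂ) (a : A) : charEquiv χ (a : Unitization ℂ A) = χ a := by
  change Unitization.lift χ (a : Unitization ℂ A) = χ a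
  simp

theorem char_star (χ : A →ₙₐ[ℂ] ℂ) (a : A) : χ (star a) = star (χ a) := by
  rw [← charEquiv_inr, ← charEquiv_inr, Unitization.inr_star, map_star]

/-- The Gelfand transform of the unitization is injective, and its points are exactly the
functionals on `A`, zero included. -/
theorem char_ext {a b : A} (h : ∀ χ : A →ₙₐ[ℂ] ℂ, χ a = χ b) : a = b := by
  refine Unitization.inr_injective (R := ℂ) ((gelfandStarTransform (Unitization ℂ A)).injective
    (ContinuousMap.ext fun x => ?_))
  obtain ⟨χ, rfl⟩ := charEquiv.surjective x
  exact (charEquiv_inr χ a).trans ((h χ).trans (charEquiv_inr χ b).symm)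

variable [FiniteDimensional ℂ A]

/-- Distinct characters of the unitization are linearly independent in a finite-dimensional dual
space. -/
instance : Finite (A →ₙₐ[ℂ] ℂ) := by
  have : FiniteDimensional ℂ (Unitization ℂ A) := by
    refine Module.Finite.of_surjective
      ((LinearMap.toSpanSingleton ℂ (Unitization ℂ A) 1).coprod (Unitization.inrHom ℂ ℂ A)) fun x =>
        ⟨(x.fst, x.snd), Unitization.ext ?_ ?_⟩ <;> simp
  have h := (linearIndependent_toLinearMap ℂ (Unitization ℂ A) ℂ)
  have : Finite (Unitization ℂ A →ₐ[ℂ] ℂ) := h.finite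
  exact Finite.of_equiv _ Unitization.lift.symm

-- The spectrum of the unitization is finite, hence discrete, so its Gelfand transform hits every
-- function. A function vanishing at the zero functional comes from `A` itself.
open scoped Classical in
theorem exists_char_indicator (S : Set (A →ₙₐ[ℂ] ℂ)) (hS : 0 ∉ S) :
    ∃ p : A, ∀ χ : A →ₙₐ[ℂ] ℂ, χ p = if χ ∈ S then 1 else 0 := by
  have : Finite (WeakDual.characterSpace ℂ (Unitization ℂ A)) := Finite.of_equiv _ charEquiv
  let f : C(WeakDual.characterSpace ℂ (Unitization ℂ A), ℂ) :=
    ⟨fun x => if charEquiv.symm x ∈ S then 1 else 0, continuous_of_discreteTopology⟩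
  obtain ⟨a, ha⟩ := (gelfandStarTransform (Unitization ℂ A)).surjective f
  have key (χ : A →ₙₐ[ℂ] ℂ) : charEquiv χ a = if χ ∈ S then 1 else 0 := by
    have := congrArg (fun g => g (charEquiv χ)) ha
    refine Eq.trans this ?_
    simp [f]
  -- The extension of the zero functional to the unitization reads off the scalar part.
  have h0 : a.fst = 0 := by
    have := key 0
    rw [if_neg hS] at this
    rw [← this]
    change _ = Unitization.lift 0 a
    simp [Unitization.lift]
  refine ⟨a.snd, fun χ => ?_⟩
  rw [← key, ← charEquiv_inr]
  congr 1
  exact Unitization.ext (by simp [h0]) (by simp)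

end Characters

/-! ### The spectral decomposition of a finite-dimensional commutative algebra -/

/-- A decomposition of the unit of `A` into orthogonal projections. -/
structure Resolution (A : Type v) [NonUnitalCommCStarAlgebra A] (n : ℕ) where
  one : A
  one_mul (a : A) : one * a = a
  p : Fin n → A
  p_mul_self (i : Fin n) : p i * p i = p i
  p_mul_ne (i j : Fin n) : i ≠ j → p i * p j = 0
  p_star (i : Fin n) : star (p i) = p i
  sum_p : ∑ i, p i = one

open scoped Classical in
/-- The spectral decomposition of a finite-dimensional commutative `H`-algebra `A` along the
characters of the idempotents of `H`: the spectrum of `A` maps to the characters `val i`,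
equivariantly for the partial actions of `H`, and `p i` is the indicator function of a fibre.
The character which vanishes everywhere is used for all points outside of the domains. -/
structure SpectralData {G : Type w} [InverseMonoid G] {H : SubInverse G} {A : Type v}
    [NonUnitalCommCStarAlgebra A] (α : InvAction H A) (n : ℕ) extends Resolution A n where
  val : Fin n → H → Prop
  mv : Fin n → H → Fin n
  val_mul (i : Fin n) (e f : H) : IsIdempotentElem e → IsIdempotentElem f →
    (val i (e * f) ↔ val i e ∧ val i f)
  val_mv (i : Fin n) (g e : H) : IsIdempotentElem e → (val (mv i g) e ↔ val i (g * e * g⁻¹))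
  ext (i j : Fin n) : (∀ e, IsIdempotentElem e → (val i e ↔ val j e)) → i = j
  val_zero (i : Fin n) (z : H) : IsZeroElement (z : G) → ¬ val i z
  p_val (i : Fin n) (e : H) : IsIdempotentElem e →
    p i * α.act e one = if val i e then p i else 0
  p_eq_zero (i : Fin n) : ¬ val i 1 → p i = 0
  act_p (i : Fin n) (g : H) : val i (g * g⁻¹) → α.act g (p (mv i g)) = p i

/-! ### Idempotents as multipliers, and the existence of the spectral decomposition. -/

namespace InvAction

variable {G : Type w} [InverseMonoid G] {H : SubInverse G} {A : Type v}

section general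

variable [NonUnitalCStarAlgebra A] (α : InvAction H A)

theorem act_mul_apply (g h : H) (a : A) : α.act (g * h) a = α.act g (α.act h a) := by
  rw [map_mul]
  rfl

theorem act_one_apply (a : A) : α.act 1 a = a := by
  rw [map_one]
  rfl

theorem act_idem {e : H} (he : IsIdempotentElem e) (a : A) : α.act e (α.act e a) = α.act e a := by
  rw [← act_mul_apply, he.eq]

theorem central_idem {e : H} (he : IsIdempotentElem e) (x y : A) :
    α.act e x * y = x * α.act e y := by
  have := α.central e x y
  rwa [idem_mul_inv_self he] at this

theorem act_idem_mul {e : H} (he : IsIdempotentElem e) (x y : A) :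
    α.act e (x * y) = α.act e x * y := by
  conv_rhs => rw [← act_idem α he, central_idem α he]
  rw [map_mul]

end general

variable [NonUnitalCommCStarAlgebra A] (α : InvAction H A) {u : A}

theorem act_idem_unit (hu : ∀ a, u * a = a) {e : H} (he : IsIdempotentElem e) (a : A) :
    α.act e a = a * α.act e u := by
  rw [← central_idem α he, mul_comm, hu]

/-- The product of `g(1)` and `g g⁻¹(1)` equals each factor: `g g⁻¹` fixes `g(1)`, and `g g⁻¹(1) =
g(g⁻¹(1))` is absorbed inside `g`. -/
theorem act_unit (hu : ∀ a, u * a = a) (g : H) : α.act g u = α.act (g * g⁻¹) u := by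
  have h1 : α.act g u * α.act (g * g⁻¹) u = α.act g u := by
    rw [← act_idem_unit α hu (idem_mul_inv g), ← act_mul_apply, mul_inv_mul_self]
  have h2 : α.act g u * α.act (g * g⁻¹) u = α.act (g * g⁻¹) u := by
    rw [act_mul_apply, ← map_mul, hu]
  rw [← h1, h2]

variable [FiniteDimensional ℂ A]

-- The indices are the functions `V χ`, where `χ` runs over all multiplicative functionals including
-- zero, and `p i` is the indicator of the nonzero `χ` with `V χ` of index `i`. Elements of `H` move
-- indices by pulling back any representative functional; the result depends only on `V χ`.
open scoped Classical in
theorem exists_spectralData : ∃ n : ℕ, 1 ≤ n ∧ Nonempty (SpectralData α n) := by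
  obtain ⟨u, hu⟩ := exists_char_indicator {χ : A →ₙₐ[ℂ] ℂ | χ ≠ 0} (by simp)
  have u_mul (a : A) : u * a = a := by
    refine char_ext fun χ => ?_
    rw [map_mul, hu]
    by_cases h : χ = 0 <;> simp [h]
  have act_u (g : H) := α.act_unit u_mul g
  -- Defined on all of `H`, but determined by idempotents since `g(1) = g g⁻¹(1)`. Its negation
  -- means the value `0`, because `e(1)` is idempotent.
  let V : (A →ₙₐ[ℂ] ℂ) → H → Prop := fun χ e => χ (α.act e u) = 1
  have Vnot (χ : A →ₙₐ[ℂ] ℂ) (e : H) (h : ¬ V χ e) : χ (α.act e u) = 0 := by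
    have h1 : χ (α.act e u) * χ (α.act e u) = χ (α.act e u) := by
      rw [← map_mul, ← map_mul, u_mul]
    rcases IsIdempotentElem.iff_eq_zero_or_one.1 h1 with h2 | h2
    · exact h2
    · exact absurd h2 h
  have V_mul (χ : A →ₙₐ[ℂ] ℂ) (e f : H) (he : IsIdempotentElem e) :
      V χ (e * f) ↔ V χ e ∧ V χ f := by
    have h1 : χ (α.act (e * f) u) = χ (α.act f u) * χ (α.act e u) := by
      rw [act_mul_apply, act_idem_unit α u_mul he, map_mul]
    by_cases h2 : V χ e <;> by_cases h3 : V χ f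
    · simp only [h2, h3, and_self, iff_true, V]
      rw [h1, h2, h3, mul_one]
    · simp only [h3, and_false, iff_false, V]
      rw [h1, Vnot _ _ h3, zero_mul]
      exact zero_ne_one
    · simp only [h2, false_and, iff_false, V]
      rw [h1, Vnot _ _ h2, mul_zero]
      exact zero_ne_one
    · simp only [h2, false_and, iff_false, V]
      rw [h1, Vnot _ _ h2, mul_zero]
      exact zero_ne_one
  -- Outside of the domain of `g` this is the zero functional, which is why that functional has to
  -- count as a point.
  let pull : (A →ₙₐ[ℂ] ℂ) → H → (A →ₙₐ[ℂ] ℂ) := fun χ g => χ.comp (α.act g : A →ₙₐ[ℂ] A)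
  have V_pull (χ : A →ₙₐ[ℂ] ℂ) (g e : H) (he : IsIdempotentElem e) :
      V (pull χ g) e ↔ V χ (g * e * g⁻¹) := by
    have : α.act (g * e * g⁻¹) u = α.act g (α.act e u) := by
      rw [← act_mul_apply, act_u (g * e), mul_inv_rev', idem_inv he]
      congr 2
      rw [mul_assoc g e (e * g⁻¹), ← mul_assoc e e, he.eq, mul_assoc]
    change χ (α.act g (α.act e u)) = 1 ↔ χ (α.act (g * e * g⁻¹) u) = 1
    rw [this]
  have V_ext (χ ψ : A →ₙₐ[ℂ] ℂ) (h : ∀ e, IsIdempotentElem e → (V χ e ↔ V ψ e)) : V χ = V ψ := by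
    funext g
    have := h _ (idem_mul_inv g)
    simp only [V, ← act_u] at this
    exact propext this
  have : Finite (Set.range V) := inferInstance
  obtain ⟨n, ⟨ε⟩⟩ := Finite.exists_equiv_fin (Set.range V)
  let rep : Fin n → (A →ₙₐ[ℂ] ℂ) := fun i => (ε.symm i).2.choose
  have hrep (i : Fin n) : V (rep i) = (ε.symm i).1 := (ε.symm i).2.choose_spec
  let idx : (A →ₙₐ[ℂ] ℂ) → Fin n := fun χ => ε ⟨V χ, χ, rfl⟩
  have hidx (χ : A →ₙₐ[ℂ] ℂ) : V (rep (idx χ)) = V χ := by rw [hrep]; simp [idx]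
  have hidx' (χ : A →ₙₐ[ℂ] ℂ) (i : Fin n) : idx χ = i ↔ V χ = V (rep i) := by
    constructor
    · rintro rfl
      exact (hidx χ).symm
    · intro h
      refine ε.symm.injective (Subtype.ext ?_)
      rw [← hrep, ← hrep, hidx, h]
  have key (i : Fin n) := exists_char_indicator {χ : A →ₙₐ[ℂ] ℂ | χ ≠ 0 ∧ idx χ = i} (by simp)
  choose p hp using key
  refine ⟨n, ?_, ⟨{
    one := u
    one_mul := u_mul
    p := p
    val := fun i => V (rep i)
    mv := fun i g => idx (pull (rep i) g)
    p_mul_self := fun i => char_ext fun χ => ?_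
    p_mul_ne := fun i j hij => char_ext fun χ => ?_
    p_star := fun i => char_ext fun χ => ?_
    sum_p := char_ext fun χ => ?_
    val_mul := fun i e f he hf => V_mul _ e f he
    val_mv := fun i g e he => ?_
    ext := fun i j h => ?_
    val_zero := fun i z hz => ?_
    p_val := fun i e he => char_ext fun χ => ?_
    p_eq_zero := fun i hi => char_ext fun χ => ?_
    act_p := fun i g hg => char_ext fun χ => ?_ }⟩⟩
  -- The zero functional has an index even if `A = 0`.
  · exact Nat.one_le_iff_ne_zero.2 fun h => by
      subst h
      exact (idx 0).elim0
  · rw [map_mul, hp]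
    split_ifs <;> simp
  · rw [map_mul, hp, hp, map_zero]
    by_cases h : idx χ = i
    · simp [h, hij]
    · simp [h]
  · rw [char_star, hp]
    split_ifs <;> simp
  · rw [map_sum, hu]
    simp only [hp, Set.mem_ofPred_eq]
    by_cases h : χ = 0 <;> simp [h]
  · rw [hidx, V_pull _ _ _ he]
  · refine ε.symm.injective (Subtype.ext ?_)
    rw [← hrep, ← hrep]
    exact V_ext _ _ h
  · simp only [V, α.act_zero z hz]
    simp
  · rw [map_mul, hp]
    by_cases h : χ ∈ {χ : A →ₙₐ[ℂ] ℂ | χ ≠ 0 ∧ idx χ = i}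
    · have h1 : V χ = V (rep i) := (hidx' _ _).1 h.2
      rw [if_pos h, _root_.one_mul]
      by_cases h2 : V χ e
      · rw [← h1, if_pos h2, hp, if_pos h, h2]
      · rw [← h1, if_neg h2, map_zero, Vnot _ _ h2]
    · rw [if_neg h, zero_mul]
      split_ifs
      · rw [hp, if_neg h]
      · rw [map_zero]
  · rw [hp, map_zero, if_neg]
    rintro ⟨h1, h2⟩
    rw [← (hidx' _ _).1 h2] at hi
    refine hi ?_
    simp only [V]
    rw [act_one_apply, hu]
    simp [h1]
  · change pull χ g (p _) = _
    rw [hp, hp]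
    suffices h : pull χ g ∈ {χ : A →ₙₐ[ℂ] ℂ | χ ≠ 0 ∧ idx χ = idx (pull (rep i) g)} ↔
        χ ∈ {χ : A →ₙₐ[ℂ] ℂ | χ ≠ 0 ∧ idx χ = i} by
      by_cases h1 : χ ∈ {χ : A →ₙₐ[ℂ] ℂ | χ ≠ 0 ∧ idx χ = i}
      · rw [if_pos h1, if_pos (h.2 h1)]
      · rw [if_neg h1, if_neg (mt h.1 h1)]
    constructor
    · rintro ⟨h1, h2⟩
      -- If `χ` vanished on `g(1)`, it would vanish on all `g(a) = g(1) g(a)`, making the pullback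
      -- zero.
      have h3 : V χ (g * g⁻¹) := by
        by_contra h
        refine h1 (NonUnitalAlgHom.ext fun a => ?_)
        have h4 := Vnot _ _ h
        rw [← act_u] at h4
        change χ (α.act g a) = 0
        rw [← u_mul a, map_mul, map_mul, h4, zero_mul]
      refine ⟨fun h => h1 ?_, ?_⟩
      · rw [h]
        rfl
      · rw [hidx'] at h2 ⊢
        refine V_ext _ _ fun e he => ?_
        rw [hidx] at h2
        -- For points in the domain of `g`, pulling back loses nothing: the value at `e` is
        -- recovered at `g⁻¹ e g`.
        have h5 (ψ : A →ₙₐ[ℂ] ℂ) (hψ : V ψ (g * g⁻¹)) :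
            V (pull ψ g) (g⁻¹ * e * g) ↔ V ψ e := by
          have h6 : IsIdempotentElem (g⁻¹ * e * g) := by
            simpa only [inverse_inverse] using idem_conj g⁻¹ he
          rw [V_pull _ _ _ h6]
          have : g * (g⁻¹ * e * g) * g⁻¹ = (g * g⁻¹) * (e * (g * g⁻¹)) := by
            simp only [mul_assoc]
          rw [this, V_mul _ _ _ (idem_mul_inv g), V_mul _ _ _ he]
          simp [hψ]
        rw [← h5 χ h3, ← h5 _ hg, h2]
    · rintro ⟨h1, h2⟩
      rw [hidx'] at h2
      rw [← h2] at hg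
      refine ⟨fun h => ?_, ?_⟩
      · have h3 : χ (α.act g u) = 1 := by rw [act_u]; exact hg
        have : pull χ g u = 0 := by rw [h]; rfl
        exact one_ne_zero (h3.symm.trans this)
      · rw [hidx', hidx]
        refine V_ext _ _ fun e he => ?_
        rw [V_pull _ _ _ he, V_pull _ _ _ he, h2]

end InvAction

end InvKK

namespace InvKK
open InverseMonoid
open scoped CStarAlgebra

/-! ### Cutting down an algebra by a character of the idempotents -/

section Cut

open scoped Classical

variable {G : Type w} [InverseMonoid G] {H : SubInverse G} {B : Type u} [NonUnitalCStarAlgebra B]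
  {C : Type u} [NonUnitalCStarAlgebra C] (β : InvAction H B) (γ : InvAction H C) (χ : H → Prop)

namespace InvAction

/-- The elements on which every idempotent `e` acts as the scalar `χ e`. -/
def IsFixed (b : B) : Prop := ∀ e : H, IsIdempotentElem e → β.act e b = if χ e then b else 0

/-- The projection onto the elements on which the idempotent `g * g⁻¹` acts as `χ (g * g⁻¹)`. -/
noncomputable def cutOne (g : H) : B →⋆ₙₐ[ℂ] B :=
  if χ (g * g⁻¹) then β.act (g * g⁻¹) else
    { toFun := fun b => b - β.act (g * g⁻¹) b
      map_smul' := fun c b => by rw [map_smul, smul_sub]; rfl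
      map_zero' := by simp
      map_add' := fun b c => by rw [map_add]; abel
      map_mul' := fun b c => by
        have h := idem_mul_inv g
        have h1 := act_idem_mul β h b c
        have h2 := central_idem β h b c
        have h3 : β.act (g * g⁻¹) b * β.act (g * g⁻¹) c = β.act (g * g⁻¹) b * c := by
          rw [← map_mul, h1]
        rw [sub_mul, mul_sub, mul_sub, h1, h3, ← h2]
        abel
      map_star' := fun b => by rw [map_star, star_sub] }

theorem cutOne_apply (g : H) (b : B) : cutOne β χ g b =
    if χ (g * g⁻¹) then β.act (g * g⁻¹) b else b - β.act (g * g⁻¹) b := by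
  unfold cutOne
  split_ifs <;> rfl

variable {β χ} in
theorem IsFixed.cutOne_eq {b : B} (hb : IsFixed β χ b) (g : H) : cutOne β χ g b = b := by
  rw [cutOne_apply, hb _ (idem_mul_inv g)]
  split_ifs <;> simp

-- Centrality moves the idempotent from `c` to `b`, where it acts as the scalar selected by
-- `cutOne`.
variable {β χ} in
theorem IsFixed.mul_cutOne {b : B} (hb : IsFixed β χ b) (g : H) (c : B) :
    b * cutOne β χ g c = b * c := by
  have h := idem_mul_inv g
  have h1 : b * β.act (g * g⁻¹) c = if χ (g * g⁻¹) then b * c else 0 := by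
    rw [← central_idem β h, hb _ h]
    split_ifs <;> simp
  rw [cutOne_apply]
  split_ifs with h2
  · rw [h1, if_pos h2]
  · rw [mul_sub, h1, if_neg h2, sub_zero]

/-- The product of the projections `cutOne`, over a list. -/
noncomputable def cutList : List H → (B →⋆ₙₐ[ℂ] B)
  | [] => NonUnitalStarAlgHom.id ℂ B
  | g :: l => (cutOne β χ g).comp (cutList l)

variable {β χ} in
theorem IsFixed.cutList_eq {b : B} (hb : IsFixed β χ b) (l : List H) : cutList β χ l b = b := by
  induction l with
  | nil => rfl
  | cons g l ih =>
    change cutOne β χ g (cutList β χ l b) = b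
    rw [ih, hb.cutOne_eq]

variable {β χ} in
theorem IsFixed.mul_cutList {b : B} (hb : IsFixed β χ b) (l : List H) (c : B) :
    b * cutList β χ l c = b * c := by
  induction l with
  | nil => rfl
  | cons g l ih =>
    change b * cutOne β χ g (cutList β χ l c) = _
    rw [hb.mul_cutOne, ih]

variable {β γ} in
theorem Equivariant.map_cutList {f : B →⋆ₙₐ[ℂ] C} (hf : β.Equivariant γ f) (l : List H) (b : B) :
    f (cutList β χ l b) = cutList γ χ l (f b) := by
  induction l with
  | nil => rfl
  | cons g l ih =>
    change f (cutOne β χ g (cutList β χ l b)) = cutOne γ χ g (cutList γ χ l (f b))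
    rw [← ih, cutOne_apply, cutOne_apply]
    split_ifs
    · exact hf _ _
    · rw [map_sub, hf]

theorem act_cutOne {e : H} (he : IsIdempotentElem e) (g : H) (b : B) :
    β.act e (cutOne β χ g b) = cutOne β χ g (β.act e b) := by
  have h : β.act e (β.act (g * g⁻¹) b) = β.act (g * g⁻¹) (β.act e b) := by
    rw [← act_mul_apply, ← act_mul_apply, idem_comm he (idem_mul_inv g)]
  rw [cutOne_apply, cutOne_apply]
  split_ifs
  · exact h
  · rw [map_sub, h]

/-- The factor belonging to `e` itself makes `e` act as the scalar `χ e`, and `e` commutes with all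
other factors. -/
theorem act_cutList {e : H} (he : IsIdempotentElem e) (l : List H) (hl : e ∈ l) (b : B) :
    β.act e (cutList β χ l b) = if χ e then cutList β χ l b else 0 := by
  induction l with
  | nil => simp at hl
  | cons g l ih =>
    change β.act e (cutOne β χ g (cutList β χ l b)) =
      if χ e then cutOne β χ g (cutList β χ l b) else 0
    rcases List.mem_cons.1 hl with rfl | h
    · rw [cutOne_apply, idem_mul_inv_self he]
      split_ifs
      · rw [act_idem β he]
      · rw [map_sub, act_idem β he, sub_self]
    · rw [act_cutOne β χ he, ih h]
      split_ifs
      · rfl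
      · rw [map_zero]

variable {β γ χ} in
theorem Equivariant.isFixed {f : B →⋆ₙₐ[ℂ] C} (hf : β.Equivariant γ f) {b : B}
    (hb : IsFixed β χ b) : IsFixed γ χ (f b) := fun e he => by
  rw [← hf, hb e he]
  split_ifs <;> simp

/-- Evaluation at `t` is equivariant. -/
noncomputable def pathEval (B : Type u) [NonUnitalCStarAlgebra B] (t : unitInterval) :
    C(unitInterval, B) →⋆ₙₐ[ℂ] B where
  toFun f := f t
  map_smul' _ _ := rfl
  map_zero' := rfl
  map_add' _ _ := rfl
  map_mul' _ _ := rfl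
  map_star' _ := rfl

theorem equivariant_pathEval (t : unitInterval) : β.path.Equivariant β (pathEval B t) :=
  fun _ _ => rfl

variable [Finite H]

/-- The projection of `B` onto the elements on which every idempotent `e` acts as `χ e`. -/
noncomputable def cut : B →⋆ₙₐ[ℂ] B :=
  -- The factor of `g` involves only `g * g⁻¹`, so letting `g` run over all of `H` merely repeats
  -- the conditions for the idempotents.
  cutList β χ (@Finset.univ H (Fintype.ofFinite H)).toList

theorem isFixed_cut (b : B) : IsFixed β χ (cut β χ b) := fun e he =>
  act_cutList β χ he _ (by simp) b

variable {β χ} in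
theorem IsFixed.cut_eq {b : B} (hb : IsFixed β χ b) : cut β χ b = b := hb.cutList_eq _

variable {β χ} in
theorem IsFixed.mul_cut {b : B} (hb : IsFixed β χ b) (c : B) : b * cut β χ c = b * c :=
  hb.mul_cutList _ c

variable {β γ} in
theorem Equivariant.map_cut {f : B →⋆ₙₐ[ℂ] C} (hf : β.Equivariant γ f) (b : B) :
    f (cut β χ b) = cut γ χ (f b) := hf.map_cutList χ _ b

theorem cut_path_apply (f : C(unitInterval, B)) (t : unitInterval) :
    cut β.path χ f t = cut β χ (f t) :=
  (equivariant_pathEval β t).map_cut χ f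

end InvAction

end Cut

/-! ### The coinduced algebra -/

namespace SpectralData

open scoped Classical

section general

variable {G : Type w} [InverseMonoid G] {H : SubInverse G} {A : Type v}
  [NonUnitalCommCStarAlgebra A] {α : InvAction H A} {n : ℕ} (D : SpectralData α n)

theorem val_mv_one (i : Fin n) (g : H) : D.val (D.mv i g) 1 ↔ D.val i (g * g⁻¹) := by
  rw [D.val_mv _ _ _ idem_one, mul_one]

theorem mv_one (i : Fin n) : D.mv i 1 = i := D.ext _ _ fun e he => by
  rw [D.val_mv _ _ _ he, one_mul', idem_inv idem_one, mul_one]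
where
  one_mul' {M : Type w} [Monoid M] (e : M) : 1 * e = e := _root_.one_mul e

theorem mv_mul (i : Fin n) (g h : H) : D.mv i (g * h) = D.mv (D.mv i g) h := D.ext _ _ fun e he => by
  rw [D.val_mv _ _ _ he, D.val_mv _ _ _ he, D.val_mv _ _ _ (idem_conj h he), mul_inv_rev']
  simp only [mul_assoc]

/-- The idempotent `g e g⁻¹` is `l e l⁻¹` cut down by `g g⁻¹` on both sides, and the cut is
invisible to a character which is `1` on `g g⁻¹`. -/
theorem mv_of_isRestriction {i : Fin n} {g l : H} (h : IsRestriction g l)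
    (hi : D.val i (g * g⁻¹)) : D.mv i l = D.mv i g := D.ext _ _ fun e he => by
  have h1 : g * e * g⁻¹ = g * g⁻¹ * (l * e * l⁻¹ * (g * g⁻¹)) := by
    conv_lhs => rw [h, mul_inv_rev', idem_inv (idem_mul_inv g)]
    simp only [mul_assoc]
  rw [D.val_mv _ _ _ he, D.val_mv _ _ _ he, h1, D.val_mul _ _ _ (idem_mul_inv g)
    (idem_mul (idem_conj l he) (idem_mul_inv g)), D.val_mul _ _ _ (idem_conj l he)
    (idem_mul_inv g)]
  simp [hi]

theorem mv_idem {i : Fin n} {e : H} (he : IsIdempotentElem e) (hi : D.val i e) : D.mv i e = i := by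
  rw [← D.mv_of_isRestriction (IsRestriction.idem he) (by rwa [idem_mul_inv_self he]), mv_one]

theorem val_of_isRestriction {i : Fin n} {g l : H} (h : IsRestriction g l)
    (hi : D.val i (g * g⁻¹)) : D.val i (l * l⁻¹) := by
  rw [← h.mul_inv_mul, D.val_mul _ _ _ (idem_mul_inv l) (idem_mul_inv g)] at hi
  exact hi.1

theorem act_p_of_isRestriction {i : Fin n} {g l : H} (h : IsRestriction g l)
    (hi : D.val i (g * g⁻¹)) : α.act l (D.p (D.mv i g)) = D.p i := by
  rw [← D.mv_of_isRestriction h hi]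
  exact D.act_p _ _ (D.val_of_isRestriction h hi)

end general

variable {G : Type w} [InverseMonoid G] {L : SubInverse G} {P : Set G} {A : Type v}
  [NonUnitalCommCStarAlgebra A] {α : InvAction (L.adjoin P) A} {n : ℕ} (D : SpectralData α n)
  {B : Type u} [NonUnitalCStarAlgebra B] (β : InvAction L B)

/-- The restriction of the characters to `L`. -/
def wt (i : Fin n) (q : L) : Prop := D.val i (L.toAdjoin P q)

theorem idem_toAdjoin {q : L} (hq : IsIdempotentElem q) : IsIdempotentElem (L.toAdjoin P q) := by
  rw [IsIdempotentElem, ← map_mul, hq.eq]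

/-- The family of those `(b i)` such that every idempotent `e` of `L` acts on `b i` as the scalar
`val i e`. -/
def coindCarrier : NonUnitalStarSubalgebra ℂ (Fin n → B) where
  carrier := {b | ∀ i, β.IsFixed (D.wt i) (b i)}
  add_mem' {b c} hb hc i e he := by
    rw [Pi.add_apply, map_add, hb i e he, hc i e he]
    split_ifs <;> simp
  zero_mem' i e _ := by simp
  mul_mem' {b c} hb hc i e he := by
    rw [Pi.mul_apply, map_mul, hb i e he, hc i e he]
    split_ifs <;> simp
  smul_mem' c b hb i e he := by
    rw [Pi.smul_apply, map_smul, hb i e he]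
    split_ifs <;> simp
  star_mem' {b} hb i e he := by
    rw [Pi.star_apply, map_star, hb i e he]
    split_ifs <;> simp

theorem isClosed_coindCarrier : IsClosed (D.coindCarrier β : Set (Fin n → B)) := by
  have : (D.coindCarrier β : Set (Fin n → B)) = ⋂ i, ⋂ e : L, ⋂ _ : IsIdempotentElem e,
      {b | β.act e (b i) = if D.wt i e then b i else 0} := by
    ext b
    simp only [Set.mem_iInter]
    rfl
  rw [this]
  refine isClosed_iInter fun i => isClosed_iInter fun e => isClosed_iInter fun _ => ?_
  refine isClosed_eq ((map_continuous (β.act e)).comp (continuous_apply i)) ?_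
  split_ifs
  · exact continuous_apply i
  · exact continuous_const

-- The idempotent `1` acts both as the identity and as the scalar `0`. All points outside of a
-- domain are disposed of in this way.
variable {β} in
theorem eq_zero_of_not_val {i : Fin n} {b : B} (hb : β.IsFixed (D.wt i) b) (hi : ¬ D.val i 1) :
    b = 0 := by
  have := hb 1 idem_one
  rwa [InvAction.act_one_apply, if_neg] at this
  simpa [wt] using hi

-- Write `q l = l (l⁻¹ q l)`. The character at `mv i g` takes on `l⁻¹ q l` the value which the one
-- at `i` takes on `q`, as `g l⁻¹ = g g⁻¹`. Outside of the domain of `g` the element `b` is zero.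
variable {D β} in
theorem isFixed_act {i : Fin n} {g : L.adjoin P} {l : L} (h : IsRestriction g (L.toAdjoin P l))
    {b : B} (hb : β.IsFixed (D.wt (D.mv i g)) b) : β.IsFixed (D.wt i) (β.act l b) := by
  intro q hq
  by_cases hi : D.val i (g * g⁻¹)
  · have h1 : IsIdempotentElem (l⁻¹ * q * l) := by
      simpa only [inverse_inverse] using idem_conj l⁻¹ hq
    have h2 : q * l = l * (l⁻¹ * q * l) := by
      calc q * l = q * (l * l⁻¹) * l := by rw [mul_assoc, mul_inv_mul_self]
        _ = l * (l⁻¹ * q * l) := by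
          rw [idem_comm hq (idem_mul_inv l)]
          simp only [mul_assoc]
    have h3 : D.wt (D.mv i g) (l⁻¹ * q * l) ↔ D.wt i q := by
      unfold wt
      rw [D.val_mv _ _ _ (idem_toAdjoin h1), map_mul, map_mul, SubInverse.toAdjoin_inv]
      have : g * ((L.toAdjoin P l)⁻¹ * L.toAdjoin P q * L.toAdjoin P l) * g⁻¹ =
          g * g⁻¹ * (L.toAdjoin P q * (g * g⁻¹)) := by
        calc _ = g * (L.toAdjoin P l)⁻¹ * (L.toAdjoin P q * (L.toAdjoin P l * g⁻¹)) := by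
              simp only [mul_assoc]
          _ = _ := by rw [h.mul_inv_eq, h.mul_inv_eq']
      rw [this, D.val_mul _ _ _ (idem_mul_inv g) (idem_mul (idem_toAdjoin hq) (idem_mul_inv g)),
        D.val_mul _ _ _ (idem_toAdjoin hq) (idem_mul_inv g)]
      simp [hi]
    rw [← InvAction.act_mul_apply, h2, InvAction.act_mul_apply, hb _ h1]
    simp only [h3]
    split_ifs <;> simp
  · rw [D.eq_zero_of_not_val hb (by rwa [val_mv_one])]
    simp

/-- Well-definedness of the coinduced action, where `E`-unitarity enters. The idempotent `q` on
which `l` and `k` agree has the value `1` at `i`, so it fixes both `l b` and `k b`; hence `l b = q l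
b = q k b = k b`. -/
theorem act_eq_act (hE : (L.adjoin P).IsEUnitary) {i : Fin n} {g : L.adjoin P} {l k : L}
    (hl : IsRestriction g (L.toAdjoin P l)) (hk : IsRestriction g (L.toAdjoin P k))
    {b : B} (hb : β.IsFixed (D.wt (D.mv i g)) b) : β.act l b = β.act k b := by
  by_cases hi : D.val i (g * g⁻¹)
  · obtain ⟨q, hq, h1, h2⟩ := SubInverse.exists_idem_of_isRestriction hE hl hk
    have h3 : D.wt i q := by
      rw [← h2, D.val_mul _ _ _ (idem_mul_inv g) (idem_toAdjoin hq)] at hi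
      exact hi.2
    have h4 := isFixed_act hl hb q hq
    have h5 := isFixed_act hk hb q hq
    rw [if_pos h3] at h4 h5
    rw [← h4, ← h5, ← InvAction.act_mul_apply, ← InvAction.act_mul_apply, h1]
  · rw [D.eq_zero_of_not_val hb (by rwa [val_mv_one])]
    simp

/-- An element of `L` which extends `g`. -/
noncomputable def extend (hP : ∀ p ∈ P, IsIdempotentElem p) (g : L.adjoin P) : L :=
  (SubInverse.exists_isRestriction hP g).choose

theorem isRestriction_extend (hP : ∀ p ∈ P, IsIdempotentElem p) (g : L.adjoin P) :
    IsRestriction g (L.toAdjoin P (extend hP g)) :=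
  (SubInverse.exists_isRestriction hP g).choose_spec

variable (hP : ∀ p ∈ P, IsIdempotentElem p) (hE : (L.adjoin P).IsEUnitary)

/-- The coinduced `L.adjoin P`-algebra: `g` maps `b` to `i ↦ g (b (i · g))`. -/
noncomputable def coind : PowerSubalgebra (L.adjoin P) B n where
  carrier := D.coindCarrier β
  isClosed := D.isClosed_coindCarrier β
  action :=
    letI := D.isClosed_coindCarrier β
    { act :=
        { toFun := fun g =>
            { toFun := fun b => ⟨fun i => β.act (extend hP g) (b.1 (D.mv i g)), fun i =>
                isFixed_act (isRestriction_extend hP g) (b.2 _)⟩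
              map_smul' := fun c b => Subtype.ext (funext fun i => map_smul (β.act _) c _)
              map_zero' := Subtype.ext (funext fun i => map_zero (β.act _))
              map_add' := fun b c => Subtype.ext (funext fun i => map_add (β.act _) _ _)
              map_mul' := fun b c => Subtype.ext (funext fun i => map_mul (β.act _) _ _)
              map_star' := fun b => Subtype.ext (funext fun i => map_star (β.act _) _) }
          map_one' := NonUnitalStarAlgHom.ext fun b => Subtype.ext (funext fun i => by
            change β.act (extend hP 1) (b.1 (D.mv i 1)) = b.1 i
            rw [D.act_eq_act β hE (isRestriction_extend hP 1) (l := extend hP 1) (k := 1)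
              (IsRestriction.refl _) (b.2 _), InvAction.act_one_apply, mv_one])
          -- The product of the chosen extensions of `g` and `h` is another extension of `g * h`.
          map_mul' := fun g h => NonUnitalStarAlgHom.ext fun b => Subtype.ext (funext fun i => by
            change β.act (extend hP (g * h)) (b.1 (D.mv i (g * h))) =
              β.act (extend hP g) (β.act (extend hP h) (b.1 (D.mv (D.mv i g) h)))
            rw [D.act_eq_act β hE (isRestriction_extend hP (g * h)) (k := extend hP g * extend hP h)
              ?_ (b.2 _), InvAction.act_mul_apply, mv_mul]
            rw [map_mul]
            exact (isRestriction_extend hP g).mul (isRestriction_extend hP h)) }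
      act_zero := fun z hz => NonUnitalStarAlgHom.ext fun b => Subtype.ext (funext fun i => by
        change β.act (extend hP z) (b.1 (D.mv i z)) = 0
        rw [D.eq_zero_of_not_val (b.2 _), map_zero]
        rw [val_mv_one]
        have : z * z⁻¹ = z := Subtype.ext (hz.2 _).1
        rw [this]
        exact D.val_zero i z hz)
      central := fun g b c => Subtype.ext (funext fun i => by
        -- An idempotent of `L'` is a restriction of `1`, so it acts on each coordinate as a scalar;
        -- centrality is then evident.
        have h (d : D.coindCarrier β) :
            β.act (extend hP (g * g⁻¹)) (d.1 (D.mv i (g * g⁻¹))) =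
              if D.val i (g * g⁻¹) then d.1 i else 0 := by
          have he := idem_mul_inv g
          split_ifs with hi
          · rw [D.act_eq_act β hE (isRestriction_extend hP _) (k := 1)
              (IsRestriction.idem he) (d.2 _), InvAction.act_one_apply, D.mv_idem he hi]
          · rw [D.eq_zero_of_not_val (d.2 _), map_zero]
            rwa [val_mv_one, idem_mul_inv_self he]
        change β.act (extend hP (g * g⁻¹)) (b.1 (D.mv i (g * g⁻¹))) * c.1 i =
          b.1 i * β.act (extend hP (g * g⁻¹)) (c.1 (D.mv i (g * g⁻¹)))
        rw [h, h]
        split_ifs <;> simp) }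

variable {C : Type u} [NonUnitalCStarAlgebra C] {β} {γ : InvAction L C}

/-- The functoriality of the coinduced algebra. -/
noncomputable def coindMap {f : B →⋆ₙₐ[ℂ] C} (hf : β.Equivariant γ f) :
    (D.coind β hP hE).carrier →⋆ₙₐ[ℂ] (D.coind γ hP hE).carrier where
  toFun b := ⟨fun i => f (b.1 i), fun i => hf.isFixed (b.2 i)⟩
  map_smul' c _ := Subtype.ext (funext fun _ => map_smul f c _)
  map_zero' := Subtype.ext (funext fun _ => map_zero f)
  map_add' _ _ := Subtype.ext (funext fun _ => map_add f _ _)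
  map_mul' _ _ := Subtype.ext (funext fun _ => map_mul f _ _)
  map_star' _ := Subtype.ext (funext fun _ => map_star f _)

theorem coindMap_isLift {f : B →⋆ₙₐ[ℂ] C} (hf : β.Equivariant γ f) :
    (D.coind β hP hE).IsLift (D.coind γ hP hE) f (D.coindMap hP hE hf) :=
  ⟨fun _ _ => rfl, fun _ _ => Subtype.ext (funext fun _ => hf _ _)⟩

variable [Finite L]

variable (β) in
/-- The projection of `B^n` onto the coinduced algebra. -/
noncomputable def coindProj : (Fin n → B) →L[ℂ] (D.coind β hP hE).carrier :=
  ContinuousLinearMap.codRestrict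
    (ContinuousLinearMap.pi fun i =>
      (⟨(β.cut (D.wt i) : B →ₗ[ℂ] B), map_continuous (β.cut (D.wt i))⟩ : B →L[ℂ] B) ∘L
        ContinuousLinearMap.proj i) (D.coind β hP hE).carrier.toSubmodule
    (fun b i => β.isFixed_cut (D.wt i) (b i))

theorem coindProj_apply (b : Fin n → B) (i : Fin n) :
    (D.coindProj β hP hE b : Fin n → B) i = β.cut (D.wt i) (b i) := rfl

/-- Injectivity and orthogonality are coordinatewise. For density, `coindProj` is continuous,
restricts to the identity on the coinduced algebra and is natural for equivariant maps, so it
carries the dense span in each coordinate of `B^n` into the span of the images. -/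
theorem coind_isDirectSum {I : Type t} {E : I → Type u} [∀ i, NonUnitalCStarAlgebra (E i)]
    (δ : ∀ i, InvAction L (E i)) (ι : ∀ i, E i →⋆ₙₐ[ℂ] B) (hι : ∀ i, (δ i).Equivariant β (ι i))
    (h : IsDirectSum ι) : IsDirectSum fun i => D.coindMap hP hE (hι i) := by
  obtain ⟨h1, h2, h3⟩ := h
  refine ⟨fun i b c hbc => ?_, fun i j hij x y => ?_, ?_⟩
  · refine Subtype.ext (funext fun k => h1 i ?_)
    exact congrFun (congrArg Subtype.val hbc) k
  · exact Subtype.ext (funext fun k => h2 i j hij _ _)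
  · set K := Submodule.span ℂ (⋃ i, Set.range (D.coindMap hP hE (hι i))) with hK
    have key (k : Fin n) (b : B) : D.coindProj β hP hE (Pi.single k b) ∈ K.topologicalClosure := by
      let m : B →L[ℂ] (D.coind β hP hE).carrier :=
        D.coindProj β hP hE ∘L ContinuousLinearMap.single ℂ (fun _ : Fin n => B) k
      have h4 : (⊤ : Submodule ℂ B) ≤ K.topologicalClosure.comap m.toLinearMap := by
        rw [← h3]
        refine Submodule.topologicalClosure_minimal _ (Submodule.span_le.2 ?_)
          ((Submodule.isClosed_topologicalClosure _).preimage m.continuous)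
        rintro _ ⟨_, ⟨i, rfl⟩, x, rfl⟩
        refine K.le_topologicalClosure (Submodule.subset_span (Set.mem_iUnion.2
          ⟨i, D.coindProj (δ i) hP hE (Pi.single k x), ?_⟩))
        refine Subtype.ext (funext fun j => ?_)
        change ι i ((δ i).cut (D.wt j) ((Pi.single k x : Fin n → E i) j)) =
          β.cut (D.wt j) ((Pi.single k (ι i x) : Fin n → B) j)
        rw [(hι i).map_cut]
        congr 1
        rcases eq_or_ne j k with rfl | hjk
        · simp
        · simp [hjk]
      exact h4 (Submodule.mem_top (x := b))
    refine eq_top_iff.2 fun b _ => ?_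
    have h5 : D.coindProj β hP hE (b : Fin n → B) = b :=
      Subtype.ext (funext fun i => InvAction.IsFixed.cut_eq (b.2 i))
    rw [← h5, ← Finset.univ_sum_single (b : Fin n → B), map_sum]
    exact sum_mem fun k _ => key k _

end SpectralData

end InvKK

namespace InvKK
open InverseMonoid
open scoped CStarAlgebra

/-! ### Adjointable and compact operators -/

section Adjoint

open MulOpposite

variable {B : Type u} [NonUnitalCStarAlgebra B]
variable {E : Type u} [NormedAddCommGroup E] [NormedSpace ℂ E] [SMul Bᵐᵒᵖ E] [CStarModule Bᵐᵒᵖ E]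
variable {C : Type u} [NonUnitalCStarAlgebra C]
variable {F : Type u} [NormedAddCommGroup F] [NormedSpace ℂ F] [SMul Cᵐᵒᵖ F] [CStarModule Cᵐᵒᵖ F]

variable (B) in
/-- The operators `S` and `S'` are adjoint to each other. -/
def IsAdj (S S' : E →L[ℂ] E) : Prop :=
  ∀ ξ η, inner Bᵐᵒᵖ (S ξ) η = inner Bᵐᵒᵖ ξ (S' η)

theorem eq_of_mul_eq {x y : B} (h : ∀ b, x * b = y * b) : x = y := by
  rw [← sub_eq_zero, ← CStarRing.mul_star_self_eq_zero_iff, sub_mul, h, sub_self]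

theorem smul_mod_eq (b : B) (x : E) : x <• b = smulL B E (op b) x := rfl

theorem inner_smul_unop (x y : E) (b : B) :
    (inner Bᵐᵒᵖ x (y <• b)).unop = (inner Bᵐᵒᵖ x y).unop * b := by
  rw [CStarModule.inner_op_smul_right, unop_mul, unop_op]

theorem inner_swap (x y : E) : (inner Bᵐᵒᵖ y x).unop = star (inner Bᵐᵒᵖ x y).unop := by
  rw [← CStarModule.star_inner x y]
  rfl

namespace IsAdj

variable {S S' T T' : E →L[ℂ] E}

theorem symm (h : IsAdj B S S') : IsAdj B S' S := fun ξ η => by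
  rw [← CStarModule.star_inner, ← h, CStarModule.star_inner]

theorem mul (h : IsAdj B S S') (k : IsAdj B T T') : IsAdj B (S * T) (T' * S') := fun ξ η => by
  change inner Bᵐᵒᵖ (S (T ξ)) η = inner Bᵐᵒᵖ ξ (T' (S' η))
  rw [h, k]

theorem add (h : IsAdj B S S') (k : IsAdj B T T') : IsAdj B (S + T) (S' + T') := fun ξ η => by
  simp [h ξ η, k ξ η]

theorem sub (h : IsAdj B S S') (k : IsAdj B T T') : IsAdj B (S - T) (S' - T') := fun ξ η => by
  simp [h ξ η, k ξ η]

theorem zero : IsAdj B (0 : E →L[ℂ] E) 0 := fun ξ η => by simp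

theorem one : IsAdj B (1 : E →L[ℂ] E) 1 := fun _ _ => rfl

theorem sum {ι : Type*} {s : Finset ι} {S S' : ι → E →L[ℂ] E} (h : ∀ i, IsAdj B (S i) (S' i)) :
    IsAdj B (∑ i ∈ s, S i) (∑ i ∈ s, S' i) := fun ξ η => by
  simp [h _ ξ η]

theorem unique (h : IsAdj B S T) (k : IsAdj B S T') : T = T' :=
  ContinuousLinearMap.ext fun x => mod_ext (B := B) fun z => by rw [← h, ← k]

/-- Operators with an adjoint are automatically linear over the coefficient algebra. -/
theorem map_smul (h : IsAdj B S S') (b : Bᵐᵒᵖ) (x : E) : S (b • x) = b • S x :=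
  mod_ext (B := B) fun z => by
    rw [← h.symm, CStarModule.inner_op_smul_right, CStarModule.inner_op_smul_right, h.symm]

/-- From `‖S' x‖² = ‖⟨S S' x, x⟩‖` and the Cauchy–Schwarz inequality, after division by `‖S' x‖`. -/
theorem norm_le (h : IsAdj B S S') : ‖S'‖ ≤ ‖S‖ := by
  refine ContinuousLinearMap.opNorm_le_bound _ (norm_nonneg _) fun x => ?_
  rcases eq_or_ne ‖S' x‖ 0 with h0 | h0
  · rw [h0]
    positivity
  have h1 : ‖S' x‖ ^ 2 ≤ ‖S‖ * ‖S' x‖ * ‖x‖ := by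
    rw [CStarModule.norm_sq_eq Bᵐᵒᵖ, ← h]
    exact (CStarModule.norm_inner_le E).trans (by gcongr; exact S.le_opNorm _)
  have h2 : 0 < ‖S' x‖ := lt_of_le_of_ne (norm_nonneg _) h0.symm
  nlinarith

end IsAdj

variable (B) in
/-- The elementary compact operator `ζ ↦ ξ ⟨η, ζ⟩`. -/
noncomputable def elemOp (ξ η : E) : E →L[ℂ] E :=
  (smulL B E).flip ξ ∘L CStarModule.innerSL (A := Bᵐᵒᵖ) η

theorem elemOp_apply (ξ η ζ : E) : elemOp B ξ η ζ = inner Bᵐᵒᵖ η ζ • ξ := rfl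

theorem elemOp_mem (ξ η : E) : elemOp B ξ η ∈ compactOperators B E :=
  Submodule.le_topologicalClosure _ (Submodule.subset_span ⟨ξ, η, fun _ => rfl⟩)

theorem isAdj_elemOp (ξ η : E) : IsAdj B (elemOp B ξ η) (elemOp B η ξ) := fun x y => by
  rw [elemOp_apply, elemOp_apply, CStarModule.inner_op_smul_left, CStarModule.inner_op_smul_right,
    CStarModule.star_inner]

/-- The compression of operators along `i : F → E` and `r : E → F`. -/
noncomputable def compression (i : F →L[ℂ] E) (r : E →L[ℂ] F) :
    (E →L[ℂ] E) →L[ℂ] (F →L[ℂ] F) :=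
  ContinuousLinearMap.compL ℂ F E F r ∘L (ContinuousLinearMap.compL ℂ F E E).flip i

theorem compression_apply (i : F →L[ℂ] E) (r : E →L[ℂ] F) (S : E →L[ℂ] E) (x : F) :
    compression i r S x = r (S (i x)) := rfl

theorem map_mem_compactOperators_of_elemOp (f : (E →L[ℂ] E) →L[ℂ] (F →L[ℂ] F))
    (hf : ∀ ξ η : E, f (elemOp B ξ η) ∈ compactOperators C F) {S : E →L[ℂ] E}
    (hS : S ∈ compactOperators B E) : f S ∈ compactOperators C F := by
  refine map_mem_compactOperators f ?_ hS
  rintro S ⟨ξ, η, h⟩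
  have : S = elemOp B ξ η := ContinuousLinearMap.ext fun ζ => h ζ
  rw [this]
  exact hf ξ η

theorem mul_mem_compactOperators {S S' K : E →L[ℂ] E} (h : IsAdj B S S')
    (hK : K ∈ compactOperators B E) : S * K ∈ compactOperators B E := by
  refine map_mem_compactOperators_of_elemOp (ContinuousLinearMap.mul ℂ (E →L[ℂ] E) S)
    (fun ξ η => ?_) hK
  have : ContinuousLinearMap.mul ℂ (E →L[ℂ] E) S (elemOp B ξ η) = elemOp B (S ξ) η :=
    ContinuousLinearMap.ext fun ζ => h.map_smul _ _
  rw [this]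
  exact elemOp_mem _ _

theorem mem_compactOperators_mul {S S' K : E →L[ℂ] E} (h : IsAdj B S S')
    (hK : K ∈ compactOperators B E) : K * S ∈ compactOperators B E := by
  refine map_mem_compactOperators_of_elemOp ((ContinuousLinearMap.mul ℂ (E →L[ℂ] E)).flip S)
    (fun ξ η => ?_) hK
  have : (ContinuousLinearMap.mul ℂ (E →L[ℂ] E)).flip S (elemOp B ξ η) = elemOp B ξ (S' η) :=
    ContinuousLinearMap.ext fun ζ => by
      change inner Bᵐᵒᵖ η (S ζ) • ξ = inner Bᵐᵒᵖ (S' η) ζ • ξ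
      rw [h.symm]
  rw [this]
  exact elemOp_mem _ _

/-- Approximants of `S` in the linear span have compact adjoints, and passing to adjoints does not
increase the distance. -/
theorem adjoint_mem_compactOperators {S S' : E →L[ℂ] E} (h : IsAdj B S S')
    (hS : S ∈ compactOperators B E) : S' ∈ compactOperators B E := by
  have h1 (K : E →L[ℂ] E) (hK : K ∈ Submodule.span ℂ
      {S : E →L[ℂ] E | ∃ ξ η : E, ∀ ζ : E, S ζ = inner Bᵐᵒᵖ η ζ • ξ}) :
      ∃ K' ∈ compactOperators B E, IsAdj B K K' := by
    induction hK using Submodule.span_induction with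
    | mem S hS =>
      obtain ⟨ξ, η, h⟩ := hS
      have : S = elemOp B ξ η := ContinuousLinearMap.ext fun ζ => h ζ
      rw [this]
      exact ⟨_, elemOp_mem _ _, isAdj_elemOp ξ η⟩
    | zero => exact ⟨0, zero_mem _, .zero⟩
    | add S T _ _ hS hT =>
      obtain ⟨S', hS', h⟩ := hS
      obtain ⟨T', hT', k⟩ := hT
      exact ⟨_, add_mem hS' hT', h.add k⟩
    | smul c S _ hS =>
      obtain ⟨S', hS', h⟩ := hS
      refine ⟨star c • S', Submodule.smul_mem _ _ hS', fun ξ η => ?_⟩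
      simp [h ξ η]
  have hc : IsClosed (compactOperators B E : Set (E →L[ℂ] E)) :=
    Submodule.isClosed_topologicalClosure _
  rw [← SetLike.mem_coe, ← hc.closure_eq, Metric.mem_closure_iff]
  intro ε hε
  obtain ⟨K, hK, hSK⟩ := Metric.mem_closure_iff.1 hS ε hε
  obtain ⟨K', hK', hKK'⟩ := h1 K hK
  refine ⟨K', hK', ?_⟩
  rw [dist_eq_norm] at hSK ⊢
  exact ((h.sub hKK').norm_le).trans_lt hSK

/-- Images of generators generate. A dense range suffices, which is what the cone needs; for the
essential part and its complement the map is onto. -/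
theorem countably_generated_of_denseRange (ρ : E →L[ℂ] F) (hρ : DenseRange ρ) {σ : B → C}
    (hσ : ∀ ξ b, ρ (ξ <• b) = ρ ξ <• σ b)
    (h : ∃ S : Set E, S.Countable ∧
      (Submodule.span ℂ {x : E | ∃ ξ ∈ S, ∃ b : B, x = ξ <• b}).topologicalClosure = ⊤) :
    ∃ S : Set F, S.Countable ∧
      (Submodule.span ℂ {x : F | ∃ ξ ∈ S, ∃ b : C, x = ξ <• b}).topologicalClosure = ⊤ := by
  obtain ⟨S, hS, hS'⟩ := h
  refine ⟨ρ '' S, hS.image _, ?_⟩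
  set K := Submodule.span ℂ {x : F | ∃ ξ ∈ ρ '' S, ∃ b : C, x = ξ <• b}
  have h1 : (⊤ : Submodule ℂ E) ≤ K.topologicalClosure.comap ρ.toLinearMap := by
    rw [← hS']
    refine Submodule.topologicalClosure_minimal _ (Submodule.span_le.2 ?_)
      ((Submodule.isClosed_topologicalClosure _).preimage ρ.continuous)
    rintro _ ⟨s, hs, b, rfl⟩
    exact K.le_topologicalClosure (Submodule.subset_span ⟨_, ⟨s, hs, rfl⟩, σ b, hσ s b⟩)
  refine eq_top_iff.2 fun x _ => ?_
  have h2 : closure (Set.range ρ) ⊆ K.topologicalClosure := by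
    refine closure_minimal ?_ (Submodule.isClosed_topologicalClosure _)
    rintro _ ⟨y, rfl⟩
    exact h1 (Submodule.mem_top (x := y))
  exact h2 (hρ x)

/-- The restriction of the module structure to a submodule. -/
@[reducible] noncomputable def subSMul (K : Submodule ℂ E)
    (hK : ∀ (b : Bᵐᵒᵖ), ∀ x ∈ K, b • x ∈ K) : SMul Bᵐᵒᵖ K where
  smul b x := ⟨b • (x : E), hK b x x.2⟩

/-- A submodule of a Hilbert module. -/
@[reducible] noncomputable def subModule (K : Submodule ℂ E)
    (hK : ∀ (b : Bᵐᵒᵖ), ∀ x ∈ K, b • x ∈ K) :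
    letI := subSMul K hK
    CStarModule Bᵐᵒᵖ K :=
  letI := subSMul K hK
  { inner := fun x y => inner Bᵐᵒᵖ (x : E) (y : E)
    inner_add_right := CStarModule.inner_add_right (E := E)
    inner_self_nonneg := CStarModule.inner_self_nonneg (E := E)
    inner_self := (CStarModule.inner_self (E := E)).trans Submodule.coe_eq_zero
    inner_op_smul_right := CStarModule.inner_op_smul_right (E := E)
    inner_smul_right_complex := CStarModule.inner_smul_right_complex (E := E)
    star_inner := fun x y => CStarModule.star_inner (x : E) (y : E)
    norm_eq_sqrt_norm_inner_self := fun x => CStarModule.norm_eq_sqrt_norm_inner_self (x : E) }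

end Adjoint

/-! ### Hilbert modules with an action -/

namespace HilbertMod

open MulOpposite

variable {G : Type w} [InverseMonoid G] {H : SubInverse G} {B : Type u} [NonUnitalCStarAlgebra B]
  {β : InvAction H B} (M : HilbertMod β)

theorem U_mul_apply (g h : H) (x : M.E) : M.U (g * h) x = M.U g (M.U h x) := by
  rw [map_mul]
  rfl

theorem U_one_apply (x : M.E) : M.U 1 x = x := by
  rw [map_one]
  rfl

/-- The axiom `U e y · b = y · e(b)` and centrality give equality after right multiplication by any
`b`. Consequently idempotents act as self-adjoint operators. -/
theorem inner_U_idem {e : H} (he : IsIdempotentElem e) (x y : M.E) :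
    (inner Bᵐᵒᵖ x (M.U e y)).unop = β.act e (inner Bᵐᵒᵖ x y).unop := by
  refine eq_of_mul_eq fun b => ?_
  have h := M.U_compatible e y b
  rw [idem_mul_inv_self he] at h
  rw [← inner_smul_unop, h, inner_smul_unop, β.central_idem he]

theorem isAdj_U_idem {e : H} (he : IsIdempotentElem e) : IsAdj B (M.U e) (M.U e) := fun x y => by
  refine unop_injective ?_
  rw [inner_U_idem M he, inner_swap y, inner_U_idem M he, ← map_star, ← inner_swap]

/-- Applying `g` to `⟨y, U g⁻¹ z⟩` gives `⟨U g y, U (g g⁻¹) z⟩`, and the idempotent is absorbed by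
`U g y`. Hence conjugation by `U g` preserves compactness. -/
theorem U_elemOp (g : H) (x y : M.E) :
    M.U g * elemOp B x y * M.U g⁻¹ = elemOp B (M.U g x) (M.U g y) := by
  refine ContinuousLinearMap.ext fun z => ?_
  have h := M.U_smul g x (inner Bᵐᵒᵖ y (M.U g⁻¹ z)).unop
  rw [op_unop] at h
  refine h.trans ?_
  rw [elemOp_apply, ← M.inner_U, op_unop]
  congr 1
  rw [← U_mul_apply, ← M.isAdj_U_idem (idem_mul_inv g), ← U_mul_apply, mul_inv_mul_self]

theorem U_conj_mem_compactOperators (g : H) {K : M.E →L[ℂ] M.E}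
    (hK : K ∈ compactOperators B M.E) : M.U g * K * M.U g⁻¹ ∈ compactOperators B M.E := by
  refine map_mem_compactOperators_of_elemOp (compression (M.U g⁻¹) (M.U g)) (fun x y => ?_) hK
  change M.U g * elemOp B x y * M.U g⁻¹ ∈ _
  rw [U_elemOp]
  exact elemOp_mem _ _

/-- An invariant closed submodule of a Hilbert module with an action of `H`. -/
noncomputable def sub (K : Submodule ℂ M.E) (hc : IsClosed (K : Set M.E))
    (hsmul : ∀ (b : Bᵐᵒᵖ), ∀ x ∈ K, b • x ∈ K) (hgr : ∀ x ∈ K, M.grading x ∈ K)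
    (hU : ∀ g, ∀ x ∈ K, M.U g x ∈ K)
    (hgen : letI := subSMul K hsmul
      ∃ S : Set K, S.Countable ∧
        (Submodule.span ℂ {x : K | ∃ ξ ∈ S, ∃ b : B, x = ξ <• b}).topologicalClosure = ⊤) :
    HilbertMod β :=
  letI := subSMul K hsmul
  letI := subModule K hsmul
  { E := K
    completeSpace := hc.completeSpace_coe
    countably_generated := hgen
    grading := M.grading.restrict hgr
    grading_sq := fun ξ => Subtype.ext (M.grading_sq ξ)
    inner_grading := fun ξ η => M.inner_grading ξ η
    U :=
      { toFun := fun g => (M.U g).restrict (hU g)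
        map_one' := ContinuousLinearMap.ext fun x => Subtype.ext (M.U_one_apply x)
        map_mul' := fun g h => ContinuousLinearMap.ext fun x => Subtype.ext (M.U_mul_apply g h x) }
    U_zero := fun z hz => ContinuousLinearMap.ext fun x => Subtype.ext (by
      change M.U z x = 0
      rw [M.U_zero z hz]
      rfl)
    U_grading := fun g ξ => Subtype.ext (M.U_grading g ξ)
    inner_U := fun g ξ η => M.inner_U g ξ η
    U_smul := fun g ξ b => Subtype.ext (M.U_smul g ξ b)
    U_compatible := fun g ξ b => Subtype.ext (M.U_compatible g ξ b) }

end HilbertMod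

end InvKK

namespace InvKK
open InverseMonoid
open scoped CStarAlgebra

/-! ### Isomorphisms of cycles -/

namespace Cycle

open MulOpposite

section Iso

variable {G : Type w} [InverseMonoid G] {H : SubInverse G} {A : Type v} [NonUnitalCStarAlgebra A]
  {B : Type u} [NonUnitalCStarAlgebra B] {α : InvAction H A} {β : InvAction H B}

/-- The cycles `c` and `d` are isomorphic. -/
def Iso (c d : Cycle α β) : Prop :=
  ∃ r : c.E →ₗ[ℂ] d.E, Function.Surjective r ∧
    (∀ ξ η, inner Bᵐᵒᵖ (r ξ) (r η) = inner Bᵐᵒᵖ ξ η) ∧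
    (∀ ξ, r (c.grading ξ) = d.grading (r ξ)) ∧
    (∀ (g : H) ξ, r (c.U g ξ) = d.U g (r ξ)) ∧
    (∀ (a : A) ξ, r (c.π a ξ) = d.π a (r ξ)) ∧
    ∀ ξ, r (c.T ξ) = d.T (r ξ)

/-- The compatibility of an evaluation map with the right module structures is automatic. -/
theorem IsEvaluation.of_inner {t : unitInterval} {p : Cycle α β.path} {c : Cycle α β}
    (r : p.E →ₗ[ℂ] c.E) (h1 : Function.Surjective r)
    (h2 : ∀ ξ η, (inner Bᵐᵒᵖ (r ξ) (r η)).unop = (inner C(unitInterval, B)ᵐᵒᵖ ξ η).unop t)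
    (h3 : ∀ ξ, r (p.grading ξ) = c.grading (r ξ)) (h4 : ∀ (g : H) ξ, r (p.U g ξ) = c.U g (r ξ))
    (h5 : ∀ (a : A) ξ, r (p.π a ξ) = c.π a (r ξ)) (h6 : ∀ ξ, r (p.T ξ) = c.T (r ξ)) :
    p.IsEvaluation t c := by
  refine ⟨r, h1, h2, fun ξ f => mod_ext (B := B) fun z => ?_, h3, h4, h5, h6⟩
  obtain ⟨z, rfl⟩ := h1 z
  refine unop_injective ?_
  rw [h2, inner_smul_unop, inner_smul_unop, h2]
  rfl

theorem isEvaluation_constPath (c : Cycle α β) (t : unitInterval) :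
    c.constPath.IsEvaluation t c :=
  ⟨{ toFun := fun f : C(unitInterval, c.E) => f t
     map_add' := fun _ _ => rfl
     map_smul' := fun _ _ => rfl }, fun x => ⟨ContinuousMap.const _ x, rfl⟩,
    fun _ _ => rfl, fun _ _ => rfl, fun _ => rfl, fun _ _ => rfl, fun _ _ => rfl, fun _ => rfl⟩

theorem IsEvaluation.trans {t : unitInterval} {p : Cycle α β.path} {c d : Cycle α β}
    (h : p.IsEvaluation t c) (k : c.Iso d) : p.IsEvaluation t d := by
  obtain ⟨r, h1, h2, h3, h4, h5, h6, h7⟩ := h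
  obtain ⟨s, k1, k2, k3, k4, k5, k6⟩ := k
  refine .of_inner (s ∘ₗ r) (k1.comp h1) (fun ξ η => ?_) (fun ξ => ?_) (fun g ξ => ?_)
    (fun a ξ => ?_) (fun ξ => ?_)
  · rw [LinearMap.comp_apply, LinearMap.comp_apply, k2, h2]
  · simp only [LinearMap.comp_apply, h4, k3]
  · simp only [LinearMap.comp_apply, h5, k4]
  · simp only [LinearMap.comp_apply, h6, k5]
  · simp only [LinearMap.comp_apply, h7, k6]

theorem Iso.homotopic {c d : Cycle α β} (h : c.Iso d) : c.Homotopic d :=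
  ⟨c.constPath, c.isEvaluation_constPath 0, (c.isEvaluation_constPath 1).trans h⟩

/-- The cycle with zero operator and zero left action on a given Hilbert module. -/
noncomputable def zeroOn (α : InvAction H A) (M : HilbertMod β) : Cycle α β where
  toHilbertMod := M
  π := 0
  π_adjoint a ξ η := by simp
  π_grading a ξ := by simp
  π_equivariant g a := by simp
  π_compatible g a ξ := by simp
  T := 0
  Tadj := 0
  T_adjoint ξ η := by simp
  T_odd ξ := by simp
  commutator_compact a := by simp
  sq_compact a := by simp
  selfAdjoint_compact a := by simp
  invariant_compact g a := by simp

end Iso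

/-! ### Changing the operator of a cycle -/

section Operator

variable {G : Type w} [InverseMonoid G] {H : SubInverse G} {A : Type v} [NonUnitalCStarAlgebra A]
  {B : Type u} [NonUnitalCStarAlgebra B] {α : InvAction H A} {β : InvAction H B}
  (c : Cycle α β)

theorem isAdj_π (a : A) : IsAdj B (c.π a) (c.π (star a)) := c.π_adjoint a

theorem isAdj_T : IsAdj B c.T c.Tadj := c.T_adjoint

theorem π_idem {e : H} (he : IsIdempotentElem e) (a : A) : c.π (α.act e a) = c.π a * c.U e := by
  refine ContinuousLinearMap.ext fun x => ?_
  have := c.π_compatible e a x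
  rwa [idem_mul_inv_self he] at this

/-- Take adjoints in `π(e(a*)) = π(a*) U e`, where `U e` is self-adjoint. -/
theorem π_comm_U {e : H} (he : IsIdempotentElem e) (a : A) : c.π a * c.U e = c.U e * c.π a := by
  have h2 := c.isAdj_π (α.act e (star a))
  rw [← map_star, star_star, π_idem c he (star a)] at h2
  have h3 := (c.isAdj_π (star a)).mul (c.isAdj_U_idem he)
  rw [star_star] at h3
  rw [← π_idem c he, h2.unique h3]

theorem U_mul_π (g : H) (a : A) : c.U g * c.π a = c.π (α.act g a) * c.U g := by
  rw [c.π_equivariant, mul_assoc, ← map_mul, mul_assoc, π_comm_U c (idem_inv_mul g),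
    ← mul_assoc, ← map_mul,
    InverseMonoid.mul_inv_mul_cancel]

theorem π_mul_U (g : H) (a : A) : c.π a * c.U g = c.U g * c.π (α.act g⁻¹ a) := by
  rw [U_mul_π, ← α.act_mul_apply, π_idem c (idem_mul_inv g), mul_assoc, ← map_mul,
    mul_inv_mul_self]

/-- The cycle which arises from `c` by a perturbation of the operator. -/
noncomputable def withOperator (T T' : c.E →L[ℂ] c.E) (hT : IsAdj B T T')
    (hodd : ∀ ξ, T (c.grading ξ) = -c.grading (T ξ))
    (hl : ∀ a, (T - c.T) * c.π a ∈ compactOperators B c.E)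
    (hr : ∀ a, c.π a * (T - c.T) ∈ compactOperators B c.E) : Cycle α β where
  toHilbertMod := c.toHilbertMod
  π := c.π
  π_adjoint := c.π_adjoint
  π_grading := c.π_grading
  π_equivariant := c.π_equivariant
  π_compatible := c.π_compatible
  T := T
  Tadj := T'
  T_adjoint := hT
  T_odd := hodd
  commutator_compact a := by
    have : T * c.π a - c.π a * T = (c.T * c.π a - c.π a * c.T) + (T - c.T) * c.π a -
        c.π a * (T - c.T) := by noncomm_ring
    rw [this]
    exact sub_mem (add_mem (c.commutator_compact a) (hl a)) (hr a)
  sq_compact a := by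
    -- The expansion around the old operator is arranged so that each perturbation `T - c.T` stands
    -- next to `c.π a` or next to a compact commutator.
    have : (T * T - 1) * c.π a = (c.T * c.T - 1) * c.π a + T * ((T - c.T) * c.π a) +
        (T - c.T) * (c.T * c.π a - c.π a * c.T) + (T - c.T) * c.π a * c.T := by noncomm_ring
    rw [this]
    exact add_mem (add_mem (add_mem (c.sq_compact a) (mul_mem_compactOperators hT (hl a)))
      (mul_mem_compactOperators (hT.sub c.isAdj_T) (c.commutator_compact a)))
      (mem_compactOperators_mul c.isAdj_T (hl a))
  selfAdjoint_compact a := by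
    -- This is the adjoint of `π(a*) (T - c.T)`, so the two-sided hypothesis on the perturbation is
    -- needed here.
    have h1 : (T' - c.Tadj) * c.π a ∈ compactOperators B c.E := by
      have := ((c.isAdj_π (star a)).mul (hT.sub c.isAdj_T))
      rw [star_star] at this
      exact adjoint_mem_compactOperators this (hr _)
    have : (T - T') * c.π a = (c.T - c.Tadj) * c.π a + (T - c.T) * c.π a -
        (T' - c.Tadj) * c.π a := by noncomm_ring
    rw [this]
    exact sub_mem (add_mem (c.selfAdjoint_compact a) (hl a)) h1
  invariant_compact g a := by
    have he := idem_mul_inv g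
    constructor
    -- Covariance moves `π a` inside the conjugation, where it meets the perturbation as
    -- `π(g⁻¹(a))`; conjugation by `U g` then preserves compactness.
    · have : c.π a * (c.U g * T * c.U g⁻¹ - T * c.U (g * g⁻¹)) =
          c.π a * (c.U g * c.T * c.U g⁻¹ - c.T * c.U (g * g⁻¹)) +
            c.U g * (c.π (α.act g⁻¹ a) * (T - c.T)) * c.U g⁻¹ -
            c.π a * (T - c.T) * c.U (g * g⁻¹) := by
        rw [← mul_assoc (c.U g), ← π_mul_U]
        noncomm_ring
      rw [this]
      exact sub_mem (add_mem (c.invariant_compact g a).1 (c.U_conj_mem_compactOperators g (hr _)))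
        (mem_compactOperators_mul (c.isAdj_U_idem he) (hr a))
    · have h1 : c.U g⁻¹ * c.π a = c.π (α.act g⁻¹ a) * c.U g⁻¹ := c.U_mul_π g⁻¹ a
      have : (c.U g * T * c.U g⁻¹ - T * c.U (g * g⁻¹)) * c.π a =
          (c.U g * c.T * c.U g⁻¹ - c.T * c.U (g * g⁻¹)) * c.π a +
            c.U g * ((T - c.T) * c.π (α.act g⁻¹ a)) * c.U g⁻¹ -
            (T - c.T) * c.π a * c.U (g * g⁻¹) := by
        have h2 : (T - c.T) * c.π (α.act g⁻¹ a) * c.U g⁻¹ = (T - c.T) * c.U g⁻¹ * c.π a := by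
          rw [mul_assoc, mul_assoc, h1]
        rw [mul_assoc (c.U g) (_ * c.π _), h2, mul_assoc (T - c.T) (c.π a), π_comm_U c he]
        noncomm_ring
      rw [this]
      exact sub_mem (add_mem (c.invariant_compact g a).2 (c.U_conj_mem_compactOperators g (hl _)))
        (mem_compactOperators_mul (c.isAdj_U_idem he) (hl a))

end Operator

/-! ### Straight line homotopies -/

section Line

variable {B : Type u} [NonUnitalCStarAlgebra B]
variable {E : Type u} [NormedAddCommGroup E] [NormedSpace ℂ E] [SMul Bᵐᵒᵖ E] [CStarModule Bᵐᵒᵖ E]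

attribute [local instance] pathSMul pathModule

/-- Multiplication with a real function on `C([0,1], E)`. -/
noncomputable def scaleOp (E : Type u) [NormedAddCommGroup E] [NormedSpace ℂ E]
    (φ : C(unitInterval, ℝ)) : C(unitInterval, E) →L[ℂ] C(unitInterval, E) :=
  LinearMap.mkContinuous
    { toFun := fun f => φ • f
      map_add' := fun x y => smul_add _ _ _
      map_smul' := fun c x => by
        ext t
        exact smul_comm (φ t) c (x t) } ‖φ‖
    (fun x => by
      refine (ContinuousMap.norm_le _ (by positivity)).2 fun t => ?_
      simp only [LinearMap.coe_mk, AddHom.coe_mk, ContinuousMap.smul_apply', norm_smul]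
      gcongr
      · exact φ.norm_coe_le_norm t
      · exact x.norm_coe_le_norm t)

theorem isAdj_scaleOp (φ : C(unitInterval, ℝ)) :
    IsAdj C(unitInterval, B) (scaleOp E φ) (scaleOp E φ) := fun f g =>
  unop_injective (ContinuousMap.ext fun t => by
    change (inner Bᵐᵒᵖ (φ t • f t) (g t)).unop = (inner Bᵐᵒᵖ (f t) (φ t • g t)).unop
    rw [CStarModule.inner_smul_left_real, CStarModule.inner_smul_right_real])

theorem scaleOp_mul_constOp (φ : C(unitInterval, ℝ)) (S : E →L[ℂ] E) :
    scaleOp E φ * constOp E S = constOp E S * scaleOp E φ :=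
  ContinuousLinearMap.ext fun f => ContinuousMap.ext fun t => by
    change φ t • S (f t) = S (φ t • f t)
    rw [← Complex.coe_smul, ← Complex.coe_smul, map_smul]

variable {S S' : E →L[ℂ] E}

theorem isAdj_constOp (h : IsAdj B S S') :
    IsAdj C(unitInterval, B) (constOp E S) (constOp E S') := fun f g =>
  unop_injective (ContinuousMap.ext fun t => congrArg unop (h (f t) (g t)))

variable {G : Type w} [InverseMonoid G] {H : SubInverse G} {A : Type v} [NonUnitalCStarAlgebra A]
  {α : InvAction H A} {β : InvAction H B} (c : Cycle α β)

/-- The path `c.T + t (T - c.T)` differs from the constant one by a scaled perturbation, which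
remains compact against the left action over `B[0,1]`. -/
theorem homotopic_withOperator (T T' : c.E →L[ℂ] c.E) (hT : IsAdj B T T')
    (hodd : ∀ ξ, T (c.grading ξ) = -c.grading (T ξ))
    (hl : ∀ a, (T - c.T) * c.π a ∈ compactOperators B c.E)
    (hr : ∀ a, c.π a * (T - c.T) ∈ compactOperators B c.E) :
    c.Homotopic (c.withOperator T T' hT hodd hl hr) := by
  let φ : C(unitInterval, ℝ) := ⟨fun t => t, by fun_prop⟩
  let R : C(unitInterval, c.E) →L[ℂ] C(unitInterval, c.E) :=
    constOp c.E c.T + scaleOp c.E φ * constOp c.E (T - c.T)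
  let R' : C(unitInterval, c.E) →L[ℂ] C(unitInterval, c.E) :=
    constOp c.E c.Tadj + constOp c.E (T' - c.Tadj) * scaleOp c.E φ
  have hR (f : C(unitInterval, c.E)) (t : unitInterval) :
      R f t = c.T (f t) + (t : ℝ) • (T (f t) - c.T (f t)) := rfl
  have h1 : IsAdj C(unitInterval, B) R R' :=
    (isAdj_constOp c.isAdj_T).add
      ((isAdj_scaleOp φ).mul (isAdj_constOp (hT.sub c.isAdj_T)))
  have h2 : R - constOp c.E c.T = scaleOp c.E φ * constOp c.E (T - c.T) := add_sub_cancel_left _ _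
  let q : Cycle α β.path := c.constPath.withOperator R R' h1
    (fun f => ContinuousMap.ext fun t => by
      change C(unitInterval, c.E) at f
      change c.T (c.grading (f t)) + (t : ℝ) • (T (c.grading (f t)) - c.T (c.grading (f t))) =
        -c.grading (c.T (f t) + (t : ℝ) • (T (f t) - c.T (f t)))
      rw [c.T_odd, hodd, ← Complex.coe_smul, ← Complex.coe_smul, map_add, map_smul, map_sub]
      module)
    (fun a => by
      change (R - constOp c.E c.T) * constOp c.E (c.π a) ∈
        compactOperators C(unitInterval, B) C(unitInterval, c.E)
      rw [h2, mul_assoc, ← constOp_mul]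
      exact mul_mem_compactOperators (isAdj_scaleOp φ) (constOp_mem_compactOperators (hl a)))
    (fun a => by
      change constOp c.E (c.π a) * (R - constOp c.E c.T) ∈
        compactOperators C(unitInterval, B) C(unitInterval, c.E)
      rw [h2, ← mul_assoc, ← scaleOp_mul_constOp, mul_assoc, ← constOp_mul]
      exact mul_mem_compactOperators (isAdj_scaleOp φ) (constOp_mem_compactOperators (hr a)))
  refine ⟨q, ⟨{ toFun := fun f : C(unitInterval, c.E) => f 0
                map_add' := fun _ _ => rfl
                map_smul' := fun _ _ => rfl }, fun x => ⟨ContinuousMap.const _ x, rfl⟩,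
    fun _ _ => rfl, fun _ _ => rfl, fun _ => rfl, fun _ _ => rfl, fun _ _ => rfl, fun f => ?_⟩,
    ⟨{ toFun := fun f : C(unitInterval, c.E) => f 1
       map_add' := fun _ _ => rfl
       map_smul' := fun _ _ => rfl }, fun x => ⟨ContinuousMap.const _ x, rfl⟩,
    fun _ _ => rfl, fun _ _ => rfl, fun _ => rfl, fun _ _ => rfl, fun _ _ => rfl, fun f => ?_⟩⟩
  · refine (hR f 0).trans ?_
    rw [Set.Icc.coe_zero, zero_smul, add_zero]
    rfl
  · refine (hR f 1).trans ?_
    rw [Set.Icc.coe_one, one_smul, add_sub_cancel]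
    rfl

end Line

end Cycle

end InvKK

namespace InvKK
open InverseMonoid
open scoped CStarAlgebra

/-! ### Transport of cycles -/

section Resolution

variable {A : Type v} [NonUnitalCommCStarAlgebra A] {n : ℕ} (R : Resolution A n)
  {E : Type u} [NormedAddCommGroup E] [NormedSpace ℂ E]

namespace Resolution

theorem mul_one (a : A) : a * R.one = a := by rw [mul_comm, R.one_mul]

theorem star_one : star R.one = R.one := by
  rw [← R.sum_p, star_sum]
  exact Finset.sum_congr rfl fun i _ => R.p_star i

theorem p_mul (i j : Fin n) : R.p i * R.p j = if i = j then R.p i else 0 := by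
  split_ifs with h
  · rw [h, R.p_mul_self]
  · exact R.p_mul_ne _ _ h

/-- The operator `S` is diagonal with respect to the projections of `R`. -/
def Comm (π : A →ₙₐ[ℂ] (E →L[ℂ] E)) (S : E →L[ℂ] E) : Prop :=
  ∀ i, S * π (R.p i) = π (R.p i) * S

variable {R} {π : A →ₙₐ[ℂ] (E →L[ℂ] E)} {S S' : E →L[ℂ] E}

theorem Comm.mul (h : R.Comm π S) (k : R.Comm π S') : R.Comm π (S * S') := fun i => by
  rw [mul_assoc, k, ← mul_assoc, h, mul_assoc]

theorem Comm.sub (h : R.Comm π S) (k : R.Comm π S') : R.Comm π (S - S') := fun i => by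
  rw [sub_mul, mul_sub, h, k]

theorem comm_one : R.Comm π 1 := fun i => by rw [_root_.one_mul, _root_.mul_one]

theorem comm_π (a : A) : R.Comm π (π a) := fun i => by rw [← map_mul, ← map_mul, mul_comm]

theorem Comm.unit (h : R.Comm π S) : S * π R.one = π R.one * S := by
  rw [← R.sum_p, map_sum, Finset.mul_sum, Finset.sum_mul]
  exact Finset.sum_congr rfl fun i _ => h i

theorem Comm.adj {B : Type u} [NonUnitalCStarAlgebra B] {G : Type w} [InverseMonoid G]
    {H : SubInverse G} {α : InvAction H A} {β : InvAction H B} {c : Cycle α β}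
    {S S' : c.E →L[ℂ] c.E} (h : R.Comm c.π S) (hS : IsAdj B S S') : R.Comm c.π S' := fun i => by
  have hp : IsAdj B (c.π (R.p i)) (c.π (R.p i)) := by
    have := c.isAdj_π (R.p i)
    rwa [R.p_star] at this
  have h1 := hS.mul hp
  rw [h] at h1
  exact ((h1.unique (hp.mul hS))).symm

end Resolution

end Resolution

namespace Cycle

open MulOpposite

section transport

variable {G : Type w} [InverseMonoid G] {H K : SubInverse G} {A : Type v}
  [NonUnitalCommCStarAlgebra A] {n : ℕ}
  {B : Type u} [NonUnitalCStarAlgebra B] {C : Type u} [NonUnitalCStarAlgebra C]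
  {α : InvAction H A} {α' : InvAction K A} {β : InvAction H B} {γ : InvAction K C}

/-- The cycle which arises from `c` by compressing all operators to another Hilbert module. -/
noncomputable def transport (R : Resolution A n) (c : Cycle α β) (hc : R.Comm c.π c.T)
    (M : HilbertMod γ) (i : M.E →L[ℂ] c.E) (r : c.E →L[ℂ] M.E) (hri : ∀ x, r (i x) = x)
    (hir : ∀ S, R.Comm c.π S → ∀ x, i (r (S (i x))) = S (i x))
    (hgr : ∀ x, i (M.grading x) = c.grading (i x)) (hgr' : ∀ x, r (c.grading x) = M.grading (r x))
    (hadj : ∀ S S', R.Comm c.π S → R.Comm c.π S' → IsAdj B S S' →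
      IsAdj C (compression i r S) (compression i r S'))
    (hK : ∀ S ∈ compactOperators B c.E, R.Comm c.π S →
      compression i r S ∈ compactOperators C M.E)
    (hequiv : ∀ g a, compression i r (c.π (α'.act g a)) =
      M.U g * compression i r (c.π a) * M.U g⁻¹)
    (hcompat : ∀ g a x, compression i r (c.π (α'.act (g * g⁻¹) a)) x =
      compression i r (c.π a) (M.U (g * g⁻¹) x))
    (hinv : ∀ g a, compression i r (c.π a) * (M.U g * compression i r c.T * M.U g⁻¹ -
        compression i r c.T * M.U (g * g⁻¹)) ∈ compactOperators C M.E ∧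
      (M.U g * compression i r c.T * M.U g⁻¹ - compression i r c.T * M.U (g * g⁻¹)) *
        compression i r (c.π a) ∈ compactOperators C M.E) : Cycle α' γ :=
  -- On diagonal operators compression is multiplicative by `hir`, so the compactness conditions
  -- reduce to the compression of one compact diagonal operator. Invariance is a separate hypothesis
  -- because the action on `M` need not be the compressed one.
  have hmul (S S' : c.E →L[ℂ] c.E) (h : R.Comm c.π S') :
      compression i r S * compression i r S' = compression i r (S * S') :=
    ContinuousLinearMap.ext fun x => congrArg (fun y => r (S y)) (hir S' h x)
  have hone : compression i r 1 = 1 := ContinuousLinearMap.ext hri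
  have hT' : R.Comm c.π c.Tadj := hc.adj c.isAdj_T
  { toHilbertMod := M
    π :=
      { toFun := fun a => compression i r (c.π a)
        map_smul' := fun z a => by rw [map_smul, map_smul]; rfl
        map_zero' := by rw [map_zero, map_zero]
        map_add' := fun a b => by rw [map_add, map_add]
        map_mul' := fun a b => by rw [map_mul, hmul _ _ (R.comm_π b)] }
    π_adjoint := fun a => hadj _ _ (R.comm_π _) (R.comm_π _) (c.isAdj_π a)
    π_grading := fun a x => by
      change r (c.π a (i (M.grading x))) = M.grading (r (c.π a (i x)))
      rw [hgr, c.π_grading, hgr']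
    π_equivariant := hequiv
    π_compatible := hcompat
    T := compression i r c.T
    Tadj := compression i r c.Tadj
    T_adjoint := hadj _ _ hc hT' c.isAdj_T
    T_odd := fun x => by
      change r (c.T (i (M.grading x))) = -M.grading (r (c.T (i x)))
      rw [hgr, c.T_odd, map_neg, hgr']
    commutator_compact := fun a => by
      change compression i r c.T * compression i r (c.π a) -
        compression i r (c.π a) * compression i r c.T ∈ _
      rw [hmul _ _ (R.comm_π a), hmul _ _ hc, ← map_sub]
      exact hK _ (c.commutator_compact a) ((hc.mul (R.comm_π a)).sub ((R.comm_π a).mul hc))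
    sq_compact := fun a => by
      change (compression i r c.T * compression i r c.T - 1) * compression i r (c.π a) ∈ _
      rw [hmul _ _ hc, ← hone, ← map_sub, hmul _ _ (R.comm_π a)]
      exact hK _ (c.sq_compact a) (((hc.mul hc).sub R.comm_one).mul (R.comm_π a))
    selfAdjoint_compact := fun a => by
      change (compression i r c.T - compression i r c.Tadj) * compression i r (c.π a) ∈ _
      rw [← map_sub, hmul _ _ (R.comm_π a)]
      exact hK _ (c.selfAdjoint_compact a) ((hc.sub hT').mul (R.comm_π a))
    invariant_compact := hinv }

end transport

/-! ### Cutting down to the essential part -/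

section Essential

variable {G : Type w} [InverseMonoid G] {H : SubInverse G} {A : Type v}
  [NonUnitalCommCStarAlgebra A] {n : ℕ}
  {B : Type u} [NonUnitalCStarAlgebra B] {α : InvAction H A} {β : InvAction H B}
  (R : Resolution A n) (c : Cycle α β)

/-- The diagonal part of an operator. -/
noncomputable def diagonal (S : c.E →L[ℂ] c.E) : c.E →L[ℂ] c.E :=
  ∑ i, c.π (R.p i) * S * c.π (R.p i)

theorem comm_diagonal (S : c.E →L[ℂ] c.E) : R.Comm c.π (c.diagonal R S) := fun j => by
  have h1 : c.diagonal R S * c.π (R.p j) = c.π (R.p j) * S * c.π (R.p j) := by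
    rw [diagonal, Finset.sum_mul, Finset.sum_eq_single j]
    · rw [mul_assoc, ← map_mul, R.p_mul_self]
    · intro i _ hij
      rw [mul_assoc, ← map_mul, R.p_mul_ne _ _ hij, map_zero, mul_zero]
    · simp
  have h2 : c.π (R.p j) * c.diagonal R S = c.π (R.p j) * S * c.π (R.p j) := by
    rw [diagonal, Finset.mul_sum, Finset.sum_eq_single j]
    · rw [← mul_assoc, ← mul_assoc, ← map_mul, R.p_mul_self]
    · intro i _ hij
      rw [← mul_assoc, ← mul_assoc, ← map_mul, R.p_mul_ne _ _ hij.symm, map_zero, zero_mul,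
        zero_mul]
    · simp
  rw [h1, h2]

/-- As a consequence the compressed operator vanishes on the complement of the essential part, as
needed for contracting that complement. -/
theorem diagonal_mul_unit (S : c.E →L[ℂ] c.E) :
    c.diagonal R S * c.π R.one = c.diagonal R S := by
  rw [diagonal, Finset.sum_mul]
  exact Finset.sum_congr rfl fun i _ => by rw [mul_assoc, ← map_mul, R.mul_one]

theorem isAdj_p (i : Fin n) : IsAdj B (c.π (R.p i)) (c.π (R.p i)) := by
  have := c.isAdj_π (R.p i)
  rwa [R.p_star] at this

theorem isAdj_unit : IsAdj B (c.π R.one) (c.π R.one) := by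
  have := c.isAdj_π R.one
  rwa [R.star_one] at this

theorem isAdj_diagonal {S S' : c.E →L[ℂ] c.E} (h : IsAdj B S S') :
    IsAdj B (c.diagonal R S) (c.diagonal R S') :=
  .sum fun i => by
    have := ((c.isAdj_p R i).mul h).mul (c.isAdj_p R i)
    rwa [← mul_assoc] at this

theorem diagonal_odd (ξ : c.E) :
    c.diagonal R c.T (c.grading ξ) = -c.grading (c.diagonal R c.T ξ) := by
  simp only [diagonal, sum_apply, mul_apply_eq_comp, map_sum,
    c.π_grading, c.T_odd, map_neg, Finset.sum_neg_distrib]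

/-- Inserting `a = ∑ (p i) a` turns the difference into a sum of commutators of `c.T` with the `p
i`, multiplied by elements of `A`. -/
theorem diagonal_sub_mul_mem (a : A) :
    (c.diagonal R c.T - c.T) * c.π a ∈ compactOperators B c.E := by
  have : (c.diagonal R c.T - c.T) * c.π a =
      -∑ i, (c.T * c.π (R.p i) - c.π (R.p i) * c.T) * c.π (R.p i * a) := by
    have h1 : c.T * c.π a = ∑ i, c.T * c.π (R.p i) * c.π (R.p i * a) := by
      conv_lhs => rw [← R.one_mul a, ← R.sum_p, Finset.sum_mul, map_sum, Finset.mul_sum]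
      refine Finset.sum_congr rfl fun i _ => ?_
      rw [mul_assoc, ← map_mul, ← mul_assoc, R.p_mul_self]
    rw [sub_mul, h1, diagonal, Finset.sum_mul, ← Finset.sum_sub_distrib, ← Finset.sum_neg_distrib]
    refine Finset.sum_congr rfl fun i _ => ?_
    rw [map_mul]
    noncomm_ring
  rw [this]
  exact neg_mem (sum_mem fun i _ =>
    mem_compactOperators_mul (c.isAdj_π _) (c.commutator_compact _))

theorem mul_diagonal_sub_mem (a : A) :
    c.π a * (c.diagonal R c.T - c.T) ∈ compactOperators B c.E := by
  have : c.π a * (c.diagonal R c.T - c.T) =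
      ∑ i, c.π (a * R.p i) * (c.T * c.π (R.p i) - c.π (R.p i) * c.T) := by
    have h1 : c.π a * c.T = ∑ i, c.π (a * R.p i) * (c.π (R.p i) * c.T) := by
      conv_lhs => rw [← R.mul_one a, ← R.sum_p, Finset.mul_sum, map_sum, Finset.sum_mul]
      refine Finset.sum_congr rfl fun i _ => ?_
      rw [← mul_assoc, ← map_mul, mul_assoc, R.p_mul_self]
    rw [mul_sub, h1, diagonal, Finset.mul_sum, ← Finset.sum_sub_distrib]
    refine Finset.sum_congr rfl fun i _ => ?_
    rw [map_mul]
    noncomm_ring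
  rw [this]
  exact sum_mem fun i _ => mul_mem_compactOperators (c.isAdj_π _) (c.commutator_compact _)

/-- The cycle with the diagonal part of the operator. -/
noncomputable def compress : Cycle α β :=
  c.withOperator (c.diagonal R c.T) (c.diagonal R c.Tadj) (c.isAdj_diagonal R c.isAdj_T)
    (c.diagonal_odd R) (c.diagonal_sub_mul_mem R) (c.mul_diagonal_sub_mem R)

theorem homotopic_compress : c.Homotopic (c.compress R) :=
  c.homotopic_withOperator _ _ _ _ _ _

/-- Covariance replaces the unit by `g(1) = g g⁻¹(1)`, and `g g⁻¹` is then absorbed by `U g`. So the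
essential part and its complement are invariant. -/
theorem U_comm_unit (g : H) : c.U g * c.π R.one = c.π R.one * c.U g := by
  rw [U_mul_π, α.act_unit R.one_mul, π_idem c (idem_mul_inv g), mul_assoc, ← map_mul,
    mul_inv_mul_self]

theorem unit_unit (x : c.E) : c.π R.one (c.π R.one x) = c.π R.one x := by
  have : c.π R.one * c.π R.one = c.π R.one := by rw [← map_mul, R.mul_one]
  exact congrArg (fun S => S x) this

/-- The submodule on which the unit of `A` acts as the identity. -/
noncomputable def essSpace : Submodule ℂ c.E := LinearMap.eqLocus (c.π R.one).toLinearMap .id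

theorem mem_essSpace {x : c.E} : x ∈ c.essSpace R ↔ c.π R.one x = x := Iff.rfl

/-- The submodule on which `A` acts as zero. -/
noncomputable def coessSpace : Submodule ℂ c.E := LinearMap.ker (c.π R.one).toLinearMap

theorem mem_coessSpace {x : c.E} : x ∈ c.coessSpace R ↔ c.π R.one x = 0 := Iff.rfl

theorem smul_mem_essSpace (b : Bᵐᵒᵖ) (x : c.E) (hx : x ∈ c.essSpace R) :
    b • x ∈ c.essSpace R := by
  rw [mem_essSpace] at hx ⊢
  rw [(c.isAdj_unit R).map_smul, hx]

theorem smul_mem_coessSpace (b : Bᵐᵒᵖ) (x : c.E) (hx : x ∈ c.coessSpace R) :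
    b • x ∈ c.coessSpace R := by
  rw [mem_coessSpace] at hx ⊢
  rw [(c.isAdj_unit R).map_smul, hx, smul_zero_mod]

/-- The projection onto the essential part. -/
noncomputable def essProj : c.E →L[ℂ] c.essSpace R :=
  (c.π R.one).codRestrict _ fun x => c.unit_unit R x

/-- The projection onto the complement of the essential part. -/
noncomputable def coessProj : c.E →L[ℂ] c.coessSpace R :=
  (1 - c.π R.one).codRestrict _ fun x => by
    rw [mem_coessSpace, sub_apply, map_sub, unit_unit]
    exact sub_self _

/-- The essential part of the Hilbert module of a cycle. -/
noncomputable def essMod : HilbertMod β :=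
  c.toHilbertMod.sub (c.essSpace R) (isClosed_eq (c.π R.one).continuous continuous_id)
    (c.smul_mem_essSpace R)
    (fun x hx => by rw [mem_essSpace] at hx ⊢; rw [c.π_grading, hx])
    (fun g x hx => by
      rw [mem_essSpace] at hx ⊢
      have := congrArg (fun S => S x) (c.U_comm_unit R g)
      exact this.symm.trans (congrArg (c.U g) hx))
    (letI := subSMul _ (c.smul_mem_essSpace R)
    letI := subModule _ (c.smul_mem_essSpace R)
    countably_generated_of_denseRange (c.essProj R)
      (Function.Surjective.denseRange fun x => ⟨x, Subtype.ext x.2⟩) (σ := id)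
      (fun _ _ => Subtype.ext ((c.isAdj_unit R).map_smul _ _)) c.countably_generated)

/-- The complement of the essential part of the Hilbert module of a cycle. -/
noncomputable def coessMod : HilbertMod β :=
  c.toHilbertMod.sub (c.coessSpace R) (isClosed_eq (c.π R.one).continuous continuous_const)
    (c.smul_mem_coessSpace R)
    (fun x hx => by rw [mem_coessSpace] at hx ⊢; rw [c.π_grading, hx, map_zero])
    (fun g x hx => by
      rw [mem_coessSpace] at hx ⊢
      have := congrArg (fun S => S x) (c.U_comm_unit R g)
      exact this.symm.trans ((congrArg (c.U g) hx).trans (map_zero _)))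
    (letI := subSMul _ (c.smul_mem_coessSpace R)
    letI := subModule _ (c.smul_mem_coessSpace R)
    countably_generated_of_denseRange (c.coessProj R)
      (Function.Surjective.denseRange fun x => ⟨x, Subtype.ext (by
        change x.1 - c.π R.one x.1 = x.1
        rw [(c.mem_coessSpace R).1 x.2, sub_zero])⟩) (σ := id)
      (fun _ _ => Subtype.ext ((IsAdj.one.sub (c.isAdj_unit R)).map_smul _ _))
      c.countably_generated)

/-- The inclusion of the essential part. -/
noncomputable def essIncl : (c.essMod R).E →L[ℂ] c.E := (c.essSpace R).subtypeL

/-- The projection onto the essential part. -/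
noncomputable def essRetr : c.E →L[ℂ] (c.essMod R).E := c.essProj R

theorem essIncl_injective : Function.Injective (c.essIncl R) := Subtype.val_injective

theorem unit_essIncl (x : (c.essMod R).E) : c.π R.one (c.essIncl R x) = c.essIncl R x := x.2

theorem essIncl_essRetr (x : c.E) : c.essIncl R (c.essRetr R x) = c.π R.one x := rfl

theorem inner_essIncl (x y : (c.essMod R).E) :
    inner Bᵐᵒᵖ (c.essIncl R x) (c.essIncl R y) = inner Bᵐᵒᵖ x y := rfl

theorem inner_essRetr (x : c.E) (y : (c.essMod R).E) :
    inner Bᵐᵒᵖ (c.essRetr R x) y = inner Bᵐᵒᵖ x (c.essIncl R y) := by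
  rw [← inner_essIncl, essIncl_essRetr, c.isAdj_unit R, unit_essIncl]

theorem inner_essRetr_right (x : (c.essMod R).E) (y : c.E) :
    inner Bᵐᵒᵖ x (c.essRetr R y) = inner Bᵐᵒᵖ (c.essIncl R x) y := by
  rw [← inner_essIncl, essIncl_essRetr, ← c.isAdj_unit R, unit_essIncl]

theorem essIncl_smul (b : Bᵐᵒᵖ) (x : (c.essMod R).E) :
    c.essIncl R (b • x) = b • c.essIncl R x := rfl

theorem essIncl_grading (x : (c.essMod R).E) :
    c.essIncl R ((c.essMod R).grading x) = c.grading (c.essIncl R x) := rfl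

theorem compression_ess_mem {S : c.E →L[ℂ] c.E} (hS : S ∈ compactOperators B c.E) :
    compression (c.essIncl R) (c.essRetr R) S ∈ compactOperators B (c.essMod R).E := by
  refine map_mem_compactOperators_of_elemOp _ (fun x y => ?_) hS
  have : compression (c.essIncl R) (c.essRetr R) (elemOp B x y) =
      elemOp B (c.essRetr R x) (c.essRetr R y) := by
    refine ContinuousLinearMap.ext fun z => c.essIncl_injective R ?_
    rw [compression_apply, elemOp_apply, elemOp_apply, essIncl_essRetr, essIncl_smul,
      inner_essRetr, (c.isAdj_unit R).map_smul, essIncl_essRetr]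
  rw [this]
  exact elemOp_mem _ _

theorem essIncl_compression {S : c.E →L[ℂ] c.E} (hS : S * c.π R.one = c.π R.one * S)
    (x : (c.essMod R).E) :
    c.essIncl R (compression (c.essIncl R) (c.essRetr R) S x) = S (c.essIncl R x) := by
  rw [compression_apply, essIncl_essRetr]
  have := congrArg (fun S => S (c.essIncl R x)) hS
  exact this.symm.trans (congrArg S (c.unit_essIncl R x))

/-- The essential part of a cycle with a diagonal operator. -/
noncomputable def essential (hc : R.Comm c.π c.T) : Cycle α β :=
  have hU (g : H) (S : c.E →L[ℂ] c.E) : (c.essMod R).U g * compression (c.essIncl R) (c.essRetr R) S =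
      compression (c.essIncl R) (c.essRetr R) (c.U g * S) :=
    ContinuousLinearMap.ext fun x => c.essIncl_injective R (by
      change c.U g (c.π R.one _) = c.π R.one (c.U g _)
      exact congrArg (fun T => T (S (c.essIncl R x))) (c.U_comm_unit R g))
  have hU' (g : H) (S : c.E →L[ℂ] c.E) : compression (c.essIncl R) (c.essRetr R) S * (c.essMod R).U g =
      compression (c.essIncl R) (c.essRetr R) (S * c.U g) := rfl
  have hmul (S S' : c.E →L[ℂ] c.E) (hS : S * c.π R.one = c.π R.one * S) :
      compression (c.essIncl R) (c.essRetr R) S * compression (c.essIncl R) (c.essRetr R) S' =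
        compression (c.essIncl R) (c.essRetr R) (S * S') :=
    ContinuousLinearMap.ext fun x => c.essIncl_injective R (by
      change c.π R.one (S (c.π R.one _)) = c.π R.one (S _)
      have := congrArg (fun T => T (S' (c.essIncl R x))) hS
      exact congrArg (c.π R.one) this |>.trans (c.unit_unit R _))
  have hmul' (S S' : c.E →L[ℂ] c.E) (hS : S' * c.π R.one = c.π R.one * S') :
      compression (c.essIncl R) (c.essRetr R) S * compression (c.essIncl R) (c.essRetr R) S' =
        compression (c.essIncl R) (c.essRetr R) (S * S') :=
    ContinuousLinearMap.ext fun x => congrArg (fun y => c.essRetr R (S y))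
      (c.essIncl_compression R hS x)
  c.transport R hc (c.essMod R) (c.essIncl R) (c.essRetr R)
    (fun x => c.essIncl_injective R (c.unit_essIncl R x))
    (fun S hS x => c.essIncl_compression R hS.unit x)
    (c.essIncl_grading R)
    (fun x => c.essIncl_injective R (c.π_grading _ _))
    (fun S S' _ _ h x y => by
      rw [compression_apply, compression_apply, inner_essRetr, h, inner_essRetr_right])
    (fun S hS _ => c.compression_ess_mem R hS)
    (fun g a => by rw [hU, hU', c.π_equivariant])
    (fun g a x => congrArg (c.essRetr R) (c.π_compatible g a (c.essIncl R x)))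
    (fun g a => by
      rw [hU, hU', hU', ← map_sub, hmul _ _ (R.comm_π a).unit, hmul' _ _ (R.comm_π a).unit]
      exact ⟨c.compression_ess_mem R (c.invariant_compact g a).1,
        c.compression_ess_mem R (c.invariant_compact g a).2⟩)

end Essential

end Cycle

end InvKK

namespace InvKK
open InverseMonoid
open scoped CStarAlgebra

/-! ### The cone of a Hilbert module -/

section Cone

open MulOpposite

attribute [local instance] pathSMul pathModule

variable {B : Type u} [NonUnitalCStarAlgebra B]
variable {E : Type u} [NormedAddCommGroup E] [NormedSpace ℂ E] [SMul Bᵐᵒᵖ E] [CStarModule Bᵐᵒᵖ E]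

/-- The paths in `E` which end at `0`. -/
noncomputable def coneSpace (E : Type u) [NormedAddCommGroup E] [NormedSpace ℂ E] :
    Submodule ℂ C(unitInterval, E) where
  carrier := {f | f 1 = 0}
  add_mem' {f g} hf hg := by
    change f 1 + g 1 = 0
    rw [show f 1 = 0 from hf, show g 1 = 0 from hg, add_zero]
  zero_mem' := rfl
  smul_mem' c f hf := by
    change c • f 1 = 0
    rw [show f 1 = 0 from hf, smul_zero]

theorem isClosed_coneSpace : IsClosed (coneSpace E : Set C(unitInterval, E)) :=
  isClosed_eq (ContinuousEvalConst.continuous_eval_const 1) continuous_const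

/-- The function `t ↦ 1 - t`. -/
noncomputable def coneFun : C(unitInterval, ℝ) := ⟨fun t => 1 - t, by fun_prop⟩

/-- Multiplication with `t ↦ 1 - t`, as a map onto a dense subspace of the cone. -/
noncomputable def coneProj (E : Type u) [NormedAddCommGroup E] [NormedSpace ℂ E] :
    C(unitInterval, E) →L[ℂ] coneSpace E :=
  (Cycle.scaleOp E coneFun).codRestrict _ fun f => by
    change (1 - ((1 : unitInterval) : ℝ)) • f 1 = 0
    simp

/-- If `f 1 = 0`, the last term of each Bernstein approximation drops out, and all other terms are
divisible by `1 - t`. -/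
theorem denseRange_coneProj : DenseRange (coneProj E) := by
  intro f
  have h1 := bernsteinApproximation_uniform f.1
  have h2 (n : ℕ) (hn : n ≠ 0) :
      bernsteinApproximation n f.1 ∈ (↑) '' Set.range (coneProj E) := by
    -- The Bernstein polynomial with one factor `1 - t` removed, which is possible because `k < n`.
    let ψ (k : Fin n) : C(unitInterval, ℝ) :=
      ⟨fun t => (n.choose k : ℝ) * (t : ℝ) ^ (k : ℕ) * (1 - (t : ℝ)) ^ (n - k - 1), by fun_prop⟩
    refine ⟨_, ⟨∑ k : Fin n, ψ k • ContinuousMap.const _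
      (f.1 (bernstein.z k.castSucc)), rfl⟩, ContinuousMap.ext fun t => ?_⟩
    have h3 : f.1 1 = 0 := f.2
    rw [bernsteinApproximation.apply, Fin.sum_univ_castSucc, bernstein.z_last hn, h3,
      smul_zero, add_zero]
    change (1 - (t : ℝ)) • (∑ k : Fin n, ψ k • ContinuousMap.const _
      (f.1 (bernstein.z k.castSucc)) : C(unitInterval, E)) t = _
    rw [ContinuousMap.sum_apply, Finset.smul_sum]
    refine Finset.sum_congr rfl fun k _ => ?_
    rw [ContinuousMap.smul_apply', ContinuousMap.const_apply, smul_smul, bernstein_apply]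
    congr 1
    change (1 - (t : ℝ)) * ((n.choose k : ℝ) * (t : ℝ) ^ (k : ℕ) * (1 - (t : ℝ)) ^ (n - k - 1)) = _
    have h4 : n - (k : ℕ) = n - k - 1 + 1 := by omega
    rw [Fin.val_castSucc]
    conv_rhs => rw [h4, pow_succ]
    ring
  rw [closure_subtype]
  refine mem_closure_of_tendsto h1 ?_
  filter_upwards [Filter.eventually_ne_atTop 0] with n hn using h2 n hn

theorem smul_mem_coneSpace (b : C(unitInterval, B)ᵐᵒᵖ) (f : C(unitInterval, E))
    (hf : f ∈ coneSpace E) : b • f ∈ coneSpace E := by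
  change op (b.unop 1) • f 1 = 0
  rw [show f 1 = 0 from hf, smul_zero_mod]

theorem cone_countably_generated (h : ∃ S : Set E, S.Countable ∧
      (Submodule.span ℂ {x : E | ∃ ξ ∈ S, ∃ b : B, x = ξ <• b}).topologicalClosure = ⊤) :
    letI := subSMul (B := C(unitInterval, B)) (coneSpace E) smul_mem_coneSpace
    ∃ S : Set (coneSpace E), S.Countable ∧
      (Submodule.span ℂ {x : coneSpace E |
        ∃ ξ ∈ S, ∃ b : C(unitInterval, B), x = ξ <• b}).topologicalClosure = ⊤ := by
  let := subSMul (B := C(unitInterval, B)) (coneSpace E) smul_mem_coneSpace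
  let := subModule (B := C(unitInterval, B)) (coneSpace E) smul_mem_coneSpace
  have h1 := path_countably_generated h
  have h2 (f : C(unitInterval, E)) (b : C(unitInterval, B)) :
      coneProj E (f <• b) = coneProj E f <• b :=
    Subtype.ext ((Cycle.isAdj_scaleOp (B := B) (E := E) coneFun).map_smul (op b) f)
  exact countably_generated_of_denseRange (B := C(unitInterval, B)) (C := C(unitInterval, B))
    (E := C(unitInterval, E)) (F := coneSpace E) (coneProj E) denseRange_coneProj
    (σ := fun b => b) h2 h1

/-- The cone of a Hilbert module, which connects it to zero. -/
noncomputable def HilbertMod.cone {G : Type w} [InverseMonoid G] {H : SubInverse G}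
    {β : InvAction H B} (N : HilbertMod β) : HilbertMod β.path :=
  N.constPath.sub (coneSpace N.E) isClosed_coneSpace
    (smul_mem_coneSpace (B := B) (E := N.E))
    (fun (f : C(unitInterval, N.E)) (hf : f 1 = 0) =>
      show N.grading (f 1) = 0 by rw [hf, map_zero])
    (fun g (f : C(unitInterval, N.E)) (hf : f 1 = 0) =>
      show N.U g (f 1) = 0 by rw [hf, map_zero])
    (cone_countably_generated N.countably_generated)

namespace HilbertMod

variable {G : Type w} [InverseMonoid G] {H : SubInverse G} {β : InvAction H B} (N : HilbertMod β)

/-- Evaluation of constant paths of Hilbert modules. -/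
noncomputable def pathEval (t : unitInterval) : N.constPath.E →ₗ[ℂ] N.E where
  toFun := fun f : C(unitInterval, N.E) => f t
  map_add' _ _ := rfl
  map_smul' _ _ := rfl

/-- The inclusion of a cone in the constant path. -/
noncomputable def coneIncl : N.cone.E →ₗ[ℂ] N.constPath.E := (coneSpace N.E).subtype

theorem pathEval_surjective (t : unitInterval) : Function.Surjective (N.pathEval t) :=
  fun x => ⟨ContinuousMap.const _ x, rfl⟩

theorem pathEval_coneIncl (f : N.cone.E) : N.pathEval 1 (N.coneIncl f) = 0 := f.2

theorem pathEval_coneIncl_surjective (x : N.E) : ∃ f, N.pathEval 0 (N.coneIncl f) = x := by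
  refine ⟨coneProj N.E (ContinuousMap.const _ x), ?_⟩
  change (1 - ((0 : unitInterval) : ℝ)) • x = x
  simp

theorem inner_pathEval (t : unitInterval) (f g : N.constPath.E) :
    (inner C(unitInterval, B)ᵐᵒᵖ f g).unop t =
      (inner Bᵐᵒᵖ (N.pathEval t f) (N.pathEval t g)).unop := rfl

theorem inner_coneIncl (f g : N.cone.E) :
    inner C(unitInterval, B)ᵐᵒᵖ f g =
      inner C(unitInterval, B)ᵐᵒᵖ (N.coneIncl f) (N.coneIncl g) := rfl

end HilbertMod

end Cone

/-! ### Contraction of the inessential part, and normal cycles. -/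

namespace Cycle

open MulOpposite

variable {G : Type w} [InverseMonoid G] {H : SubInverse G} {A : Type v}
  [NonUnitalCommCStarAlgebra A] {n : ℕ}
  {B : Type u} [NonUnitalCStarAlgebra B] {α : InvAction H A} {β : InvAction H B}
  (R : Resolution A n) (c : Cycle α β)

theorem essential_T_apply (hc : R.Comm c.π c.T) (x : (c.essMod R).E) :
    c.essIncl R ((c.essential R hc).T x) = c.T (c.essIncl R x) :=
  c.essIncl_compression R hc.unit x

theorem essential_π_apply (hc : R.Comm c.π c.T) (a : A) (x : (c.essMod R).E) :
    c.essIncl R ((c.essential R hc).π a x) = c.π a (c.essIncl R x) :=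
  c.essIncl_compression R (R.comm_π a).unit x

/-- The complement of the essential part carries zero left action and, by `hT`, zero operator. Its
cone with zero data, added to the constant path of the essential part, evaluates at `0` to all of
`c` and at `1` to the essential part. -/
theorem homotopic_essential (hc : R.Comm c.π c.T) (hT : c.T * c.π R.one = c.T) :
    c.Homotopic (c.essential R hc) := by
  let M := c.essMod R
  let N := c.coessMod R
  let q : Cycle α β.path := (c.essential R hc).constPath.sum (zeroOn α N.cone)
  let j : N.E →ₗ[ℂ] c.E := (c.coessSpace R).subtype
  have hj (y : N.E) : c.π R.one (j y) = 0 := y.2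
  have horth (x : M.E) (y : N.E) : inner Bᵐᵒᵖ (c.essIncl R x) (j y) = 0 := by
    rw [← unit_essIncl, c.isAdj_unit R, hj, CStarModule.inner_zero_right]
  have horth' (x : M.E) (y : N.E) : inner Bᵐᵒᵖ (j y) (c.essIncl R x) = 0 := by
    rw [← CStarModule.star_inner, horth, star_zero]
  have hπ (a : A) (y : N.E) : c.π a (j y) = 0 := by
    rw [← R.mul_one a, map_mul]
    exact (congrArg (c.π a) (hj y)).trans (map_zero _)
  have hTj (y : N.E) : c.T (j y) = 0 := by
    rw [← hT]
    exact (congrArg c.T (hj y)).trans (map_zero _)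
  let r₀ : M.constPath.E →ₗ[ℂ] c.E := (c.essIncl R).toLinearMap ∘ₗ M.pathEval 0
  let s₀ : N.cone.E →ₗ[ℂ] c.E := j ∘ₗ N.pathEval 0 ∘ₗ N.coneIncl
  let r : q.E →ₗ[ℂ] c.E := (r₀.coprod s₀ : M.constPath.E × N.cone.E →ₗ[ℂ] c.E)
  let s : q.E →ₗ[ℂ] (c.essential R hc).E :=
    (M.pathEval 1 ∘ₗ LinearMap.fst ℂ M.constPath.E N.cone.E :)
  have hr (z : q.E) : r z = c.essIncl R (M.pathEval 0 z.1) + j (N.pathEval 0 (N.coneIncl z.2)) :=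
    rfl
  refine ⟨q, .of_inner r (fun x => ?_) (fun x y => ?_) (fun x => ?_) (fun h x => ?_)
    (fun a x => ?_) (fun x => ?_), .of_inner s (fun x => ?_) (fun x y => ?_) (fun _ => rfl)
    (fun _ _ => rfl) (fun _ _ => rfl) (fun _ => rfl)⟩
  · have h1 : c.π R.one (x - c.π R.one x) = 0 := by
      rw [map_sub, unit_unit, sub_self]
    obtain ⟨f, hf⟩ := M.pathEval_surjective 0 (c.essRetr R x)
    obtain ⟨g, hg⟩ := N.pathEval_coneIncl_surjective ⟨x - c.π R.one x, h1⟩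
    refine ⟨((f, g) : M.constPath.E × N.cone.E), (hr _).trans ?_⟩
    change c.essIncl R (M.pathEval 0 f) + j (N.pathEval 0 (N.coneIncl g)) = x
    rw [hf, hg, essIncl_essRetr]
    exact add_sub_cancel _ _
  · rw [hr, hr, CStarModule.inner_add_left, CStarModule.inner_add_right,
      CStarModule.inner_add_right, horth, horth', add_zero, zero_add]
    rfl
  · exact (map_add c.grading _ _).symm
  · exact (map_add (c.U h) _ _).symm
  · rw [hr, hr, map_add, hπ]
    refine congrArg₂ (· + ·) ?_ (map_zero j)
    exact c.essential_π_apply R hc a _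
  · rw [hr, hr, map_add, hTj]
    refine congrArg₂ (· + ·) ?_ (map_zero j)
    exact c.essential_T_apply R hc _
  · obtain ⟨f, hf⟩ := M.pathEval_surjective 1 x
    exact ⟨(f, 0), hf⟩
  · have h1 (f g : N.cone.E) : (inner C(unitInterval, B)ᵐᵒᵖ f g).unop 1 = 0 := by
      rw [N.inner_coneIncl, N.inner_pathEval, N.pathEval_coneIncl, CStarModule.inner_zero_left]
      rfl
    refine .trans ?_
      (congrArg (fun b => (inner C(unitInterval, B)ᵐᵒᵖ x.1 y.1).unop 1 + b) (h1 x.2 y.2)).symm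
    exact (add_zero _).symm

/-- A cycle is normal if the unit of `A` acts as the identity and the operator is diagonal. -/
structure IsNormal : Prop where
  unit : c.π R.one = 1
  comm : R.Comm c.π c.T

/-- A normal cycle which represents the same class as `c`. -/
noncomputable def normalize : Cycle α β := (c.compress R).essential R (c.comm_diagonal R c.T)

theorem isNormal_normalize : (c.normalize R).IsNormal R where
  unit := ContinuousLinearMap.ext fun x => (c.compress R).essIncl_injective R <|
    ((c.compress R).essential_π_apply R _ _ x).trans x.2
  comm i := ContinuousLinearMap.ext fun x => (c.compress R).essIncl_injective R <| by
    change (c.compress R).essIncl R ((c.normalize R).T ((c.normalize R).π (R.p i) x)) =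
      (c.compress R).essIncl R ((c.normalize R).π (R.p i) ((c.normalize R).T x))
    refine ((c.compress R).essential_T_apply R _ _).trans ?_
    refine .trans ?_ ((c.compress R).essential_π_apply R _ _ _).symm
    have h1 := (c.compress R).essential_T_apply R (c.comm_diagonal R c.T) x
    have h2 := (c.compress R).essential_π_apply R (c.comm_diagonal R c.T) (R.p i) x
    refine (congrArg _ h2).trans (.trans ?_ (congrArg _ h1).symm)
    exact congrArg (fun S => S ((c.compress R).essIncl R x)) (c.comm_diagonal R c.T i)

theorem mk_normalize : (Quot.mk _ (c.normalize R) : KK α β) = Quot.mk _ c :=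
  ((Quot.sound (c.homotopic_compress R)).trans
    (Quot.sound ((c.compress R).homotopic_essential R _ (c.diagonal_mul_unit R c.T)))).symm

/-- The inclusion of the module of the normalized cycle. -/
noncomputable def normIncl : (c.normalize R).E →ₗ[ℂ] c.E := (c.essSpace R).subtype

/-- The projection onto the module of the normalized cycle. -/
noncomputable def normRetr : c.E →ₗ[ℂ] (c.normalize R).E := (c.essProj R).toLinearMap

variable {R c}

theorem normIncl_injective : Function.Injective (c.normIncl R) := Subtype.val_injective

theorem unit_normIncl (x : (c.normalize R).E) : c.π R.one (c.normIncl R x) = c.normIncl R x := x.2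

theorem normIncl_normRetr (x : c.E) : c.normIncl R (c.normRetr R x) = c.π R.one x := rfl

theorem inner_normIncl (x y : (c.normalize R).E) :
    inner Bᵐᵒᵖ (c.normIncl R x) (c.normIncl R y) = inner Bᵐᵒᵖ x y := rfl

theorem normIncl_U (g : H) (x : (c.normalize R).E) :
    c.normIncl R ((c.normalize R).U g x) = c.U g (c.normIncl R x) := rfl

theorem normIncl_grading (x : (c.normalize R).E) :
    c.normIncl R ((c.normalize R).grading x) = c.grading (c.normIncl R x) := rfl

theorem normIncl_T (x : (c.normalize R).E) :
    c.normIncl R ((c.normalize R).T x) = c.diagonal R c.T (c.normIncl R x) :=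
  (c.compress R).essential_T_apply R (c.comm_diagonal R c.T) x

theorem normIncl_π (a : A) (x : (c.normalize R).E) :
    c.normIncl R ((c.normalize R).π a x) = c.π a (c.normIncl R x) :=
  (c.compress R).essential_π_apply R (c.comm_diagonal R c.T) a x

attribute [irreducible] normalize normIncl normRetr

/-- An evaluation map intertwines the left actions and the operators, hence the unit of `A` and the
diagonal parts. Thus homotopies may be normalized. -/
theorem IsEvaluation.normalize {t : unitInterval} {p : Cycle α β.path} (h : p.IsEvaluation t c) :
    (p.normalize R).IsEvaluation t (c.normalize R) := by
  obtain ⟨r, h1, h2, h3, h4, h5, h6, h7⟩ := h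
  have key (x : (p.normalize R).E) : c.normIncl R ((c.normRetr R ∘ₗ r ∘ₗ p.normIncl R) x) =
      r (p.normIncl R x) := by
    rw [LinearMap.comp_apply, LinearMap.comp_apply, normIncl_normRetr, ← h6, unit_normIncl]
  refine .of_inner (c.normRetr R ∘ₗ r ∘ₗ p.normIncl R) ?_ (fun x y => ?_)
    (fun x => normIncl_injective ?_) (fun g x => normIncl_injective ?_)
    (fun a x => normIncl_injective ?_) (fun x => normIncl_injective ?_)
  · intro x
    obtain ⟨y, hy⟩ := h1 (c.normIncl R x)
    refine ⟨p.normRetr R y, normIncl_injective ?_⟩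
    rw [key, normIncl_normRetr, h6, hy, unit_normIncl]
  · rw [← inner_normIncl, key, key, h2, inner_normIncl]
  · rw [key, normIncl_grading, normIncl_grading, key, h4]
  · rw [key, normIncl_U, normIncl_U, key, h5]
  · rw [key, normIncl_π, normIncl_π, key, h6]
  · rw [key, normIncl_T, normIncl_T, key]
    simp only [diagonal, sum_apply, mul_apply_eq_comp, map_sum, h6, h7]

end Cycle

end InvKK

namespace InvKK
open InverseMonoid
open scoped CStarAlgebra

/-! ### Changing the inner product of a Hilbert module -/

section Renorm

open MulOpposite

theorem exists_mul_star_of_nonneg {B : Type u} [NonUnitalCStarAlgebra B] {b : B}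
    (hb : 0 ≤ op b) : ∃ s, b = s * star s := by
  refine ⟨unop (CFC.sqrt (op b)), op_injective ?_⟩
  rw [op_mul, op_star, op_unop, (CFC.sqrt_nonneg (op b)).isSelfAdjoint.star_eq,
    CFC.sqrt_mul_sqrt_self _ hb]

theorem op_mul_star_nonneg {B : Type u} [NonUnitalCStarAlgebra B] (s : B) :
    0 ≤ op (s * star s) := by
  rw [op_mul, op_star]
  exact star_mul_self_nonneg _

theorem op_map_nonneg {B C : Type u} [NonUnitalCStarAlgebra B] [NonUnitalCStarAlgebra C]
    (f : B →⋆ₙₐ[ℂ] C) {b : B} (hb : 0 ≤ op b) : 0 ≤ op (f b) := by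
  obtain ⟨s, rfl⟩ := exists_mul_star_of_nonneg hb
  rw [map_mul, map_star]
  exact op_mul_star_nonneg _

/-- The structure of a Hilbert `C`-module on `E` whose norm is equivalent to the given one. -/
structure Renorm (C : Type u) [NonUnitalCStarAlgebra C] (E : Type u) [NormedAddCommGroup E]
    [NormedSpace ℂ E] where
  inn : E → E → C
  act : E → C → E
  inn_add (x y z : E) : inn x (y + z) = inn x y + inn x z
  inn_smul (t : ℂ) (x y : E) : inn x (t • y) = t • inn x y
  star_inn (x y : E) : star (inn x y) = inn y x
  inn_act (x y : E) (c : C) : inn x (act y c) = inn x y * c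
  nonneg (x : E) : 0 ≤ op (inn x x)
  lower : ∃ k : ℝ, ∀ x, ‖x‖ ^ 2 ≤ k * ‖inn x x‖
  upper : ∃ k : ℝ, ∀ x, ‖inn x x‖ ≤ k * ‖x‖ ^ 2

namespace Renorm

variable {C : Type u} [NonUnitalCStarAlgebra C] {E : Type u} [NormedAddCommGroup E]
  [NormedSpace ℂ E] (D : Renorm C E)

/-- The space `E` with the new structure. -/
def Space (_ : Renorm C E) : Type u := E

namespace Space

instance : SMul Cᵐᵒᵖ D.Space := ⟨fun c x => D.act x c.unop⟩

section

/-- The additive structure of `E`. -/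
@[reducible] def addCommGroup : AddCommGroup D.Space := inferInstanceAs (AddCommGroup E)

attribute [local instance] addCommGroup

/-- The linear structure of `E`. -/
@[reducible] def module : Module ℂ D.Space := inferInstanceAs (Module ℂ E)

/-- The norm which belongs to the new inner product. -/
@[reducible] noncomputable def norm : Norm D.Space := ⟨fun x => √‖op (D.inn x x)‖⟩

attribute [local instance] module norm

variable {D} in
theorem inn_self {x : E} : D.inn x x = 0 ↔ x = 0 := by
  refine ⟨fun h => ?_, ?_⟩
  · obtain ⟨k, hk⟩ := D.lower
    have := hk x
    rw [h, norm_zero, mul_zero] at this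
    exact norm_eq_zero.1 (pow_eq_zero_iff two_ne_zero |>.1 (le_antisymm this (by positivity)))
  · rintro rfl
    simpa using D.inn_smul 0 0 0

/-- The new structure of a Hilbert module. -/
@[reducible] noncomputable def cstarModule : CStarModule Cᵐᵒᵖ D.Space where
  inner x y := op (D.inn x y)
  inner_add_right {x y z} := congrArg op (D.inn_add x y z)
  inner_self_nonneg {x} := D.nonneg x
  inner_self := (op_eq_zero_iff _).trans inn_self
  inner_op_smul_right {c x y} := congrArg op (D.inn_act x y c.unop)
  inner_smul_right_complex {t x y} := congrArg op (D.inn_smul t x y)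
  star_inner x y := congrArg op (D.star_inn x y)
  norm_eq_sqrt_norm_inner_self _ := rfl

attribute [local instance] cstarModule

noncomputable instance : NormedAddCommGroup D.Space :=
  CStarModule.normedAddCommGroup Cᵐᵒᵖ

noncomputable instance : NormedSpace ℂ D.Space :=
  .ofCore (CStarModule.normedSpaceCore Cᵐᵒᵖ)

end

noncomputable instance : CStarModule Cᵐᵒᵖ D.Space := cstarModule D

end Space

theorem exists_norm_le : ∃ k : ℝ, ∀ x : E, ‖x‖ ≤ k * ‖(show D.Space from x)‖ := by
  obtain ⟨k, hk⟩ := D.lower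
  refine ⟨√k, fun x => ?_⟩
  change ‖x‖ ≤ √k * √‖D.inn x x‖
  rw [← Real.sqrt_mul' _ (norm_nonneg _)]
  exact Real.le_sqrt_of_sq_le (hk x)

theorem exists_le_norm : ∃ k : ℝ, ∀ x : E, ‖(show D.Space from x)‖ ≤ k * ‖x‖ := by
  obtain ⟨k, hk⟩ := D.upper
  refine ⟨√k, fun x => ?_⟩
  change √‖D.inn x x‖ ≤ _
  rw [← Real.sqrt_sq (norm_nonneg x), ← Real.sqrt_mul' _ (by positivity)]
  exact Real.sqrt_le_sqrt (hk x)

/-- The identity map, as a linear homeomorphism. -/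
noncomputable def toSpace : E ≃L[ℂ] D.Space where
  toFun x := x
  invFun x := x
  left_inv _ := rfl
  right_inv _ := rfl
  map_add' _ _ := rfl
  map_smul' _ _ := rfl
  continuous_toFun := by
    obtain ⟨k, hk⟩ := D.exists_le_norm
    let f : E →ₗ[ℂ] D.Space := { toFun := fun x => x, map_add' := fun _ _ => rfl,
                                 map_smul' := fun _ _ => rfl }
    exact (f.mkContinuous k hk).continuous
  continuous_invFun := by
    obtain ⟨k, hk⟩ := D.exists_norm_le
    let f : D.Space →ₗ[ℂ] E := { toFun := fun x => x, map_add' := fun _ _ => rfl,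
                                 map_smul' := fun _ _ => rfl }
    exact (f.mkContinuous k hk).continuous

theorem toSpace_act (x : E) (c : C) : D.toSpace (D.act x c) = D.toSpace x <• c := rfl

instance [CompleteSpace E] : CompleteSpace D.Space :=
  (completeSpace_congr (e := D.toSpace.toEquiv) D.toSpace.isUniformEmbedding).1 inferInstance

theorem ext_inn {x y : E} (h : ∀ z, D.inn z x = D.inn z y) : x = y :=
  D.toSpace.injective (mod_ext (B := C) fun z => congrArg op (h z))

/-- The operators on the space with the new structure. -/
noncomputable def conj : (E →L[ℂ] E) →L[ℂ] (D.Space →L[ℂ] D.Space) :=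
  compression D.toSpace.symm.toContinuousLinearMap D.toSpace.toContinuousLinearMap

theorem conj_mul (S T : E →L[ℂ] E) : D.conj (S * T) = D.conj S * D.conj T := rfl

theorem conj_one : D.conj 1 = 1 := rfl

/-- Each old product `ξ b` is a finite sum of new products of the vectors `q i ξ`, so these replace
the generator `ξ`. -/
theorem countably_generated {B : Type u} [NonUnitalCStarAlgebra B] [SMul Bᵐᵒᵖ E] {n : ℕ}
    (q : Fin n → E →L[ℂ] E) (σ : Fin n → B → C)
    (hgen : ∀ (ξ : E) b, ξ <• b = ∑ i, D.act (q i ξ) (σ i b))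
    (h : ∃ S : Set E, S.Countable ∧
      (Submodule.span ℂ {x : E | ∃ ξ ∈ S, ∃ b : B, x = ξ <• b}).topologicalClosure = ⊤) :
    ∃ S : Set D.Space, S.Countable ∧
      (Submodule.span ℂ {x : D.Space | ∃ ξ ∈ S, ∃ c : C, x = ξ <• c}).topologicalClosure = ⊤ := by
  obtain ⟨S, hS, hS'⟩ := h
  refine ⟨⋃ i, (fun x => D.toSpace (q i x)) '' S, Set.countable_iUnion fun i => hS.image _, ?_⟩
  set K := Submodule.span ℂ {x : D.Space |
    ∃ ξ ∈ ⋃ i, (fun x => D.toSpace (q i x)) '' S, ∃ c : C, x = ξ <• c}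
  have h1 : (⊤ : Submodule ℂ E) ≤
      K.topologicalClosure.comap D.toSpace.toContinuousLinearMap.toLinearMap := by
    rw [← hS']
    refine Submodule.topologicalClosure_minimal _ (Submodule.span_le.2 ?_)
      ((Submodule.isClosed_topologicalClosure K).preimage D.toSpace.continuous)
    rintro _ ⟨s, hs, b, rfl⟩
    rw [hgen]
    refine K.le_topologicalClosure ?_
    change D.toSpace (∑ i, D.act (q i s) (σ i b)) ∈ K
    rw [map_sum]
    exact sum_mem fun i _ => Submodule.subset_span
      ⟨_, Set.mem_iUnion.2 ⟨i, s, hs, rfl⟩, σ i b, D.toSpace_act _ _⟩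
  exact eq_top_iff.2 fun x _ => h1 (Submodule.mem_top (x := D.toSpace.symm x))

end Renorm

variable {G : Type w} [InverseMonoid G] {H K : SubInverse G} {B : Type u}
  [NonUnitalCStarAlgebra B] {C : Type u} [NonUnitalCStarAlgebra C] {β : InvAction H B}
  {γ : InvAction K C}

/-- A new inner product and a new action on a given Hilbert module. The compatibility of the action
with the module structure follows from the compatibility with the inner product. -/
noncomputable def HilbertMod.renorm (M : HilbertMod β) (D : Renorm C M.E) {n : ℕ}
    (q : Fin n → M.E →L[ℂ] M.E) (σ : Fin n → B → C)
    (hgen : ∀ (ξ : M.E) b, ξ <• b = ∑ i, D.act (q i ξ) (σ i b))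
    (hgr : ∀ x y, D.inn (M.grading x) (M.grading y) = D.inn x y)
    (V : K →* (M.E →L[ℂ] M.E)) (V_zero : ∀ z : K, IsZeroElement (z : G) → V z = 0)
    (V_grading : ∀ g x, V g (M.grading x) = M.grading (V g x))
    (inn_V : ∀ g x y, D.inn (V g x) (V g y) = γ.act g (D.inn x y))
    (inn_V_idem : ∀ g x y, D.inn x (V (g * g⁻¹) y) = γ.act (g * g⁻¹) (D.inn x y)) :
    HilbertMod γ :=
  -- Since `V g y` is fixed by `V (g g⁻¹)`, that idempotent can be moved to `x`, where it factors as
  -- `V g` after `V g⁻¹`. Semilinearity follows by testing against all vectors.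
  have key (g : K) (x y : M.E) : D.inn x (V g y) = γ.act g (D.inn (V g⁻¹ x) y) := by
    have h1 : V (g * g⁻¹) (V g y) = V g y := by
      change (V (g * g⁻¹) * V g) y = _
      rw [← map_mul, mul_inv_mul_self]
    have h2 : V g (V g⁻¹ x) = V (g * g⁻¹) x := by
      rw [map_mul]
      rfl
    rw [← inn_V, h2, ← D.star_inn (V g y) (V (g * g⁻¹) x), inn_V_idem, ← map_star, D.star_inn, ← inn_V_idem, h1]
  have hsmul (g : K) (x : M.E) (c : C) : V g (D.act x c) = D.act (V g x) (γ.act g c) :=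
    D.ext_inn fun z => by rw [key, D.inn_act, D.inn_act, map_mul, key]
  have hcompat (g : K) (x : M.E) (c : C) :
      D.act (V (g * g⁻¹) x) c = D.act x (γ.act (g * g⁻¹) c) :=
    D.ext_inn fun z => by rw [D.inn_act, D.inn_act, inn_V_idem, γ.central]
  { E := D.Space
    countably_generated := D.countably_generated q σ hgen M.countably_generated
    grading := D.conj M.grading
    grading_sq := M.grading_sq
    inner_grading := fun x y => congrArg op (hgr x y)
    U :=
      { toFun := fun g => D.conj (V g)
        map_one' := by rw [map_one, D.conj_one]
        map_mul' := fun g h => by rw [map_mul, D.conj_mul] }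
    U_zero := fun z hz => by
      change D.conj (V z) = 0
      rw [V_zero z hz, map_zero]
    U_grading := V_grading
    inner_U := inn_V
    U_smul := hsmul
    U_compatible := hcompat }

end Renorm

end InvKK

namespace InvKK
open InverseMonoid
open scoped CStarAlgebra

/-! ### Algebras related like an `L`-algebra and its coinduced algebra -/

section Link

open scoped Classical

variable {G : Type w} [InverseMonoid G] {L : SubInverse G} {P : Set G} {A : Type v}
  [NonUnitalCommCStarAlgebra A] {α : InvAction (L.adjoin P) A} {n : ℕ}
  {B : Type u} [NonUnitalCStarAlgebra B] {C : Type u} [NonUnitalCStarAlgebra C] [Finite L]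

/-- The characteristic properties of the `L.adjoin P`-algebra `C` coinduced from the `L`-algebra
`B`. -/
structure Link (D : SpectralData α n) (β : InvAction L B) (γ : InvAction (L.adjoin P) C) where
  ev : Fin n → C →⋆ₙₐ[ℂ] B
  lift : (Fin n → B) →L[ℂ] C
  ev_lift (b : Fin n → B) (i : Fin n) : ev i (lift b) = β.cut (D.wt i) (b i)
  ev_fixed (c : C) (i : Fin n) : β.IsFixed (D.wt i) (ev i c)
  ev_inj (c d : C) : (∀ i, ev i c = ev i d) → c = d
  ev_act (i : Fin n) (g : L.adjoin P) (l : L) (c : C) : IsRestriction g (L.toAdjoin P l) →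
    ev i (γ.act g c) = β.act l (ev (D.mv i g) c)

namespace Link

variable {D : SpectralData α n} {β : InvAction L B} {γ : InvAction (L.adjoin P) C}
  (Λ : Link D β γ)

theorem ev_lift_of_isFixed {b : Fin n → B} {i : Fin n} (h : β.IsFixed (D.wt i) (b i)) :
    Λ.ev i (Λ.lift b) = b i := by rw [Λ.ev_lift, h.cut_eq]

theorem lift_ev (c : C) : Λ.lift (fun i => Λ.ev i c) = c :=
  Λ.ev_inj _ _ fun i => Λ.ev_lift_of_isFixed (b := fun i => Λ.ev i c) (Λ.ev_fixed c i)

theorem ev_mul_lift (c : C) (b : Fin n → B) (i : Fin n) :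
    Λ.ev i (c * Λ.lift b) = Λ.ev i c * b i := by
  rw [map_mul, ev_lift, (Λ.ev_fixed c i).mul_cut]

theorem ev_eq_zero {i : Fin n} (hi : ¬ D.val i 1) (c : C) : Λ.ev i c = 0 :=
  D.eq_zero_of_not_val (Λ.ev_fixed c i) hi

/-- An idempotent of `L'` extends to `1` in `L`, so no element of `L` moves the coordinate. -/
theorem ev_act_idem (i : Fin n) {e : L.adjoin P} (he : IsIdempotentElem e) (c : C) :
    Λ.ev i (γ.act e c) = if D.val i e then Λ.ev i c else 0 := by
  rw [Λ.ev_act i e 1 c (by rw [map_one]; exact IsRestriction.idem he), InvAction.act_one_apply]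
  split_ifs with h
  · rw [D.mv_idem he h]
  · exact Λ.ev_eq_zero (by rwa [D.val_mv_one, idem_mul_inv_self he]) c

/-- Square roots are chosen coordinatewise; lifting them only cuts them down, and the cut is a
`⋆`-homomorphism. -/
theorem lift_nonneg {b : Fin n → B} (hb : ∀ i, 0 ≤ MulOpposite.op (b i)) :
    0 ≤ MulOpposite.op (Λ.lift b) := by
  choose s hs using fun i => exists_mul_star_of_nonneg (hb i)
  have : Λ.lift b = Λ.lift s * star (Λ.lift s) := Λ.ev_inj _ _ fun i => by
    rw [map_mul, map_star, Λ.ev_lift, Λ.ev_lift, hs, map_mul, map_star]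
  rw [this]
  exact op_mul_star_nonneg _

theorem norm_le (c : C) : ‖c‖ ≤ ‖Λ.lift‖ * ‖fun i => Λ.ev i c‖ := by
  conv_lhs => rw [← Λ.lift_ev c]
  exact Λ.lift.le_opNorm _

theorem norm_ev_le (c : C) (i : Fin n) : ‖Λ.ev i c‖ ≤ ‖c‖ :=
  NonUnitalStarAlgHom.norm_apply_le (Λ.ev i) c

/-- Links between path algebras. -/
noncomputable def path : Link D β.path γ.path where
  ev i :=
    { toFun := fun f => ⟨fun t => Λ.ev i (f t), (map_continuous (Λ.ev i)).comp f.continuous⟩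
      map_smul' := fun z f => ContinuousMap.ext fun t => map_smul (Λ.ev i) z (f t)
      map_zero' := ContinuousMap.ext fun t => map_zero (Λ.ev i)
      map_add' := fun f g => ContinuousMap.ext fun t => map_add (Λ.ev i) (f t) (g t)
      map_mul' := fun f g => ContinuousMap.ext fun t => map_mul (Λ.ev i) (f t) (g t)
      map_star' := fun f => ContinuousMap.ext fun t => map_star (Λ.ev i) (f t) }
  lift := LinearMap.mkContinuous
    { toFun := fun f : Fin n → C(unitInterval, B) =>
        (⟨fun t => Λ.lift fun i => f i t, by fun_prop⟩ : C(unitInterval, C))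
      map_add' := fun f g => ContinuousMap.ext fun t =>
        map_add Λ.lift (fun i => f i t) (fun i => g i t)
      map_smul' := fun z f => ContinuousMap.ext fun t =>
        map_smul Λ.lift z (fun i => f i t) } ‖Λ.lift‖
    (fun f => (ContinuousMap.norm_le _ (by positivity)).2 fun t =>
      (Λ.lift.le_opNorm _).trans (mul_le_mul_of_nonneg_left
        ((pi_norm_le_iff_of_nonneg (norm_nonneg _)).2 fun i =>
          ((f i).norm_coe_le_norm t).trans (norm_le_pi_norm f i)) (norm_nonneg _)))
  ev_lift f i := ContinuousMap.ext fun t => by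
    rw [InvAction.cut_path_apply]
    exact Λ.ev_lift (fun i => f i t) i
  ev_fixed f i e he := ContinuousMap.ext fun t => by
    have := Λ.ev_fixed (f t) i e he
    refine this.trans ?_
    split_ifs <;> rfl
  ev_inj f g h := ContinuousMap.ext fun t => Λ.ev_inj _ _ fun i =>
    congrArg (fun f : C(unitInterval, B) => f t) (h i)
  ev_act i g l f h := ContinuousMap.ext fun t => Λ.ev_act i g l (f t) h

theorem path_ev_apply (f : C(unitInterval, C)) (i : Fin n) (t : unitInterval) :
    Λ.path.ev i f t = Λ.ev i (f t) := rfl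

/-- The coinduced algebra. -/
noncomputable def coind (D : SpectralData α n) (β : InvAction L B)
    (hP : ∀ p ∈ P, IsIdempotentElem p) (hE : (L.adjoin P).IsEUnitary) :
    Link D β (D.coind β hP hE).action where
  ev i := (Pi.evalNonUnitalStarAlgHom ℂ (fun _ : Fin n => B) i).comp
    (NonUnitalStarSubalgebraClass.subtype (D.coind β hP hE).carrier)
  lift := D.coindProj β hP hE
  ev_lift b i := D.coindProj_apply hP hE b i
  ev_fixed c i := c.2 i
  ev_inj _ _ h := Subtype.ext (funext h)
  ev_act _ g _ c h := D.act_eq_act β hE (SpectralData.isRestriction_extend hP g) h (c.2 _)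

end Link

end Link

/-! ### The spectral projections in a normal cycle -/

namespace Cycle

open scoped Classical

open MulOpposite

variable {G : Type w} [InverseMonoid G] {H K : SubInverse G} {A : Type v}
  [NonUnitalCommCStarAlgebra A] {n : ℕ} {α : InvAction H A} {R : Resolution A n}
  {B : Type u} [NonUnitalCStarAlgebra B] {β : InvAction H B} {c : Cycle α β}

theorem p_p_apply (i j : Fin n) (x : c.E) :
    c.π (R.p i) (c.π (R.p j) x) = if i = j then c.π (R.p i) x else 0 := by
  change (c.π (R.p i) * c.π (R.p j)) x = _
  rw [← map_mul, R.p_mul]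
  split_ifs
  · rfl
  · rw [map_zero]
    rfl

theorem IsNormal.sum_p (hc : c.IsNormal R) : ∑ i, c.π (R.p i) = 1 := by
  rw [← map_sum, R.sum_p, hc.unit]

theorem IsNormal.sum_p_apply (hc : c.IsNormal R) (x : c.E) : ∑ i, c.π (R.p i) x = x := by
  have := congrArg (fun S => S x) hc.sum_p
  rw [sum_apply] at this
  exact this

theorem IsNormal.diagonal_eq (hc : c.IsNormal R) {S : c.E →L[ℂ] c.E} (hS : R.Comm c.π S) :
    c.diagonal R S = S := by
  rw [diagonal]
  calc _ = ∑ i, S * c.π (R.p i) := Finset.sum_congr rfl fun i _ => by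
        rw [← hS i, mul_assoc, ← map_mul, R.p_mul_self]
    _ = S := by rw [← Finset.mul_sum, hc.sum_p, mul_one]

theorem Resolution.Comm.apply {S : c.E →L[ℂ] c.E} (hS : R.Comm c.π S) (i : Fin n) (x : c.E) :
    S (c.π (R.p i) x) = c.π (R.p i) (S x) := congrArg (fun S => S x) (hS i)

theorem inner_p_left (i : Fin n) (x y : c.E) :
    inner Bᵐᵒᵖ (c.π (R.p i) x) y = inner Bᵐᵒᵖ x (c.π (R.p i) y) := c.isAdj_p R i x y

theorem inner_p_p (i : Fin n) (x y : c.E) :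
    inner Bᵐᵒᵖ (c.π (R.p i) x) (c.π (R.p i) y) = inner Bᵐᵒᵖ x (c.π (R.p i) y) := by
  rw [inner_p_left, p_p_apply, if_pos rfl]

theorem p_smul (i : Fin n) (x : c.E) (b : B) :
    c.π (R.p i) (x <• b) = c.π (R.p i) x <• b := (c.isAdj_p R i).map_smul (op b) x

theorem IsNormal.sum {d : Cycle α β} (hc : c.IsNormal R) (hd : d.IsNormal R) :
    (c.sum d).IsNormal R where
  unit := by
    change diagOp (c.π R.one) (d.π R.one) = diagOp 1 1
    rw [hc.unit, hd.unit]
  comm i := by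
    change diagOp (c.T * c.π (R.p i)) (d.T * d.π (R.p i)) =
      diagOp (c.π (R.p i) * c.T) (d.π (R.p i) * d.T)
    rw [hc.comm, hd.comm]

theorem IsNormal.constPath (hc : c.IsNormal R) : c.constPath.IsNormal R where
  unit := congrArg (constOp c.E) hc.unit
  comm i := congrArg (constOp c.E) (hc.comm i)

/-- In a normal cycle the essential part is everything and the diagonal part of the operator is the
operator. -/
theorem IsNormal.iso_normalize (hc : c.IsNormal R) : (c.normalize R).Iso c := by
  have h1 : Function.Surjective (c.normIncl R) := fun x => ⟨c.normRetr R x, by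
    rw [normIncl_normRetr, hc.unit]
    rfl⟩
  have h2 (x : (c.normalize R).E) : c.normIncl R ((c.normalize R).T x) = c.T (c.normIncl R x) := by
    rw [normIncl_T, hc.diagonal_eq hc.comm]
  exact ⟨c.normIncl R, h1, inner_normIncl, normIncl_grading, normIncl_U, normIncl_π, h2⟩

variable {D : SpectralData α n}

theorem U_idem_p {e : H} (he : IsIdempotentElem e) (i : Fin n) (x : c.E) :
    c.U e (c.π (D.p i) x) = if D.val i e then c.π (D.p i) x else 0 := by
  change (c.U e * c.π (D.p i)) x = _
  rw [← π_comm_U c he, ← c.π_idem he, α.act_idem_unit D.one_mul he, D.p_val _ _ he]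
  split_ifs
  · rfl
  · rw [map_zero]
    rfl

end Cycle

end InvKK

namespace InvKK
open InverseMonoid
open scoped CStarAlgebra

/-! ### From cycles over the coinduced algebra to cycles over `B` -/

namespace Link

open scoped Classical

open MulOpposite

variable {G : Type w} [InverseMonoid G] {L : SubInverse G} {P : Set G} {A : Type v}
  [NonUnitalCommCStarAlgebra A] {α : InvAction (L.adjoin P) A} {n : ℕ}
  {B : Type u} [NonUnitalCStarAlgebra B] {C : Type u} [NonUnitalCStarAlgebra C] [Finite L]
  {D : SpectralData α n} {β : InvAction L B} {γ : InvAction (L.adjoin P) C}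
  (Λ : Link D β γ) {c : Cycle α γ}

/-- Some idempotent separates the characters `i` and `j`. It acts on the range of `p j` and on the
`i`-th coordinate by different scalars out of `0` and `1`. -/
theorem ev_inner_p_of_ne {i j : Fin n} (hij : i ≠ j) (x y : c.E) :
    Λ.ev i (inner Cᵐᵒᵖ x (c.π (D.p j) y)).unop = 0 := by
  have h1 : ∃ e, IsIdempotentElem e ∧ ¬ (D.val i e ↔ D.val j e) := by
    by_contra! h
    exact hij (D.ext i j h)
  obtain ⟨e, he, h2⟩ := h1
  have h3 := Λ.ev_act_idem i he (inner Cᵐᵒᵖ x (c.π (D.p j) y)).unop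
  rw [← c.inner_U_idem he, Cycle.U_idem_p he] at h3
  by_cases hi : D.val i e <;> by_cases hj : D.val j e
  · exact absurd (iff_of_true hi hj) h2
  · rw [if_neg hj, if_pos hi, CStarModule.inner_zero_right, unop_zero, map_zero] at h3
    exact h3.symm
  · rwa [if_pos hj, if_neg hi] at h3
  · exact absurd (iff_of_false hi hj) h2

theorem ev_inner_p (hc : c.IsNormal D.toResolution) (i : Fin n) (x y : c.E) :
    Λ.ev i (inner Cᵐᵒᵖ x (c.π (D.p i) y)).unop = Λ.ev i (inner Cᵐᵒᵖ x y).unop := by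
  conv_rhs => rw [← hc.sum_p_apply y, CStarModule.inner_sum_right, Finset.unop_sum, map_sum]
  exact (Finset.sum_eq_single i (fun j _ hj => Λ.ev_inner_p_of_ne hj.symm x y) (by simp)).symm

/-- Inner products with the range of `p i` live in the `i`-th coordinate only, so no other
coordinate of `d` is seen. -/
theorem p_smul_eq {i : Fin n} {d d' : C}
    (h : Λ.ev i d = Λ.ev i d') (x : c.E) : c.π (D.p i) x <• d = c.π (D.p i) x <• d' :=
  mod_ext (B := C) fun z => unop_injective <| Λ.ev_inj _ _ fun j => by
    rw [inner_smul_unop, inner_smul_unop, map_mul, map_mul]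
    rcases eq_or_ne j i with rfl | hj
    · rw [h]
    · rw [Λ.ev_inner_p_of_ne hj, zero_mul, zero_mul]

/-- The sum of the evaluations. -/
noncomputable def total (d : C) : B := ∑ i, Λ.ev i d

theorem total_mul_lift (d : C) (b : B) : Λ.total (d * Λ.lift fun _ => b) = Λ.total d * b := by
  rw [total, total, Finset.sum_mul]
  exact Finset.sum_congr rfl fun i _ => Λ.ev_mul_lift d (fun _ => b) i

theorem total_add (d d' : C) : Λ.total (d + d') = Λ.total d + Λ.total d' := by
  simp only [total, map_add, Finset.sum_add_distrib]

theorem ev_inv_act_eq_zero {l : L} {i : Fin n} (hi : ¬ D.wt i (l⁻¹ * l)) (d : C) :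
    β.act l (Λ.ev i d) = 0 := by
  have h := Λ.ev_fixed d i _ (idem_inv_mul l)
  rw [if_neg hi] at h
  rw [← mul_inv_mul_self l, mul_assoc, InvAction.act_mul_apply, h, map_zero]

/-- Coordinates outside of the range or the domain of `l` contribute zero. On the others `i ↦ i · g`
is a bijection with inverse `i ↦ i · g⁻¹`, and it permutes the summands. -/
theorem total_act (l : L) (d : C) : Λ.total (γ.act (L.toAdjoin P l) d) = β.act l (Λ.total d) := by
  set g := L.toAdjoin P l with hg
  have hl : L.toAdjoin P (l⁻¹ * l) = g⁻¹ * g := by rw [map_mul, SubInverse.toAdjoin_inv]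
  have h1 : Λ.total (γ.act g d) = ∑ i, β.act l (Λ.ev (D.mv i g) d) :=
    Finset.sum_congr rfl fun i _ => Λ.ev_act i g l d (IsRestriction.refl _)
  have h2 : ∑ i, β.act l (Λ.ev (D.mv i g) d) =
      ∑ i with D.val i (g * g⁻¹), β.act l (Λ.ev (D.mv i g) d) := by
    rw [Finset.sum_filter]
    refine Finset.sum_congr rfl fun i _ => ?_
    split_ifs with hi
    · rfl
    · rw [Λ.ev_eq_zero (by rwa [D.val_mv_one]), map_zero]
  have h3 : β.act l (Λ.total d) = ∑ i with D.val i (g⁻¹ * g), β.act l (Λ.ev i d) := by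
    rw [total, map_sum, Finset.sum_filter]
    refine Finset.sum_congr rfl fun i _ => ?_
    split_ifs with hi
    · rfl
    · exact Λ.ev_inv_act_eq_zero (by rwa [SpectralData.wt, hl]) d
  rw [h1, h2, h3]
  refine Finset.sum_bij' (fun i _ => D.mv i g) (fun i _ => D.mv i g⁻¹) (fun i hi => ?_)
    (fun i hi => ?_) (fun i hi => ?_) (fun i hi => ?_) (fun i hi => rfl)
  · rw [Finset.mem_filter] at hi ⊢
    refine ⟨Finset.mem_univ _, ?_⟩
    rw [D.val_mv _ _ _ (idem_inv_mul g), ← mul_assoc, mul_inv_mul_self]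
    exact hi.2
  · rw [Finset.mem_filter] at hi ⊢
    refine ⟨Finset.mem_univ _, ?_⟩
    rw [D.val_mv _ _ _ (idem_mul_inv g), inverse_inverse, ← mul_assoc,
      InverseMonoid.inv_mul_self_inv]
    exact hi.2
  · rw [Finset.mem_filter] at hi
    rw [← D.mv_mul, D.mv_idem (idem_mul_inv g) hi.2]
  · rw [Finset.mem_filter] at hi
    rw [← D.mv_mul, D.mv_idem (idem_inv_mul g) hi.2]

theorem norm_total_le (d : C) : ‖Λ.total d‖ ≤ n * ‖d‖ := by
  refine (norm_sum_le _ _).trans ?_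
  refine (Finset.sum_le_sum fun i _ => Λ.norm_ev_le d i).trans ?_
  simp

/-- For positive `d` every coordinate is dominated by the sum. Hence the summed inner product
defines an equivalent norm, and completeness is inherited. -/
theorem norm_le_total {d : C} (hd : 0 ≤ op d) : ‖d‖ ≤ ‖Λ.lift‖ * ‖Λ.total d‖ := by
  refine (Λ.norm_le d).trans (mul_le_mul_of_nonneg_left ?_ (norm_nonneg _))
  refine (pi_norm_le_iff_of_nonneg (norm_nonneg _)).2 fun i => ?_
  have h0 : 0 ≤ op (Λ.ev i d) := op_map_nonneg (Λ.ev i) hd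
  have h1 : op (Λ.ev i d) ≤ op (Λ.total d) := by
    rw [total, Finset.op_sum]
    exact Finset.single_le_sum (f := fun i => op (Λ.ev i d))
      (fun i _ => op_map_nonneg (Λ.ev i) hd) (Finset.mem_univ i)
  exact CStarAlgebra.norm_le_norm_of_nonneg_of_le (A := Bᵐᵒᵖ) h0 h1

/-- The inner product on a Hilbert module over the coinduced algebra, with values in `B`. -/
noncomputable def downRenorm (M : HilbertMod γ) : Renorm B M.E where
  inn x y := Λ.total (inner Cᵐᵒᵖ x y).unop
  act x b := x <• Λ.lift fun _ => b
  inn_add x y z := by rw [CStarModule.inner_add_right, unop_add, total_add]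
  inn_smul t x y := by
    rw [CStarModule.inner_smul_right_complex, unop_smul]
    simp only [total, map_smul, Finset.smul_sum]
  star_inn x y := by
    rw [inner_swap x y, total, total, star_sum]
    simp only [map_star]
  inn_act x y b := by rw [inner_smul_unop, total_mul_lift]
  nonneg x := by
    rw [total, Finset.op_sum]
    exact Finset.sum_nonneg fun i _ =>
      op_map_nonneg (Λ.ev i) (CStarModule.inner_self_nonneg (A := Cᵐᵒᵖ))
  lower := ⟨‖Λ.lift‖, fun x => by
    rw [CStarModule.norm_sq_eq Cᵐᵒᵖ]
    exact Λ.norm_le_total (CStarModule.inner_self_nonneg (A := Cᵐᵒᵖ))⟩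
  upper := ⟨n, fun x => by
    rw [CStarModule.norm_sq_eq Cᵐᵒᵖ]
    exact Λ.norm_total_le _⟩

variable (hc : c.IsNormal D.toResolution)

/-- The Hilbert `B`-module which belongs to a normal cycle over the coinduced algebra. -/
noncomputable def downMod : HilbertMod β :=
  c.renorm (Λ.downRenorm c.toHilbertMod) (fun i => c.π (D.p i)) (fun i d => Λ.ev i d)
    (fun ξ d => by
      conv_lhs => rw [← hc.sum_p_apply ξ, smul_mod_eq, map_sum]
      exact Finset.sum_congr rfl fun i _ => Λ.p_smul_eq
        (Λ.ev_lift_of_isFixed (b := fun _ => Λ.ev i d) (Λ.ev_fixed d i)).symm ξ)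
    (fun x y => congrArg (fun d : Cᵐᵒᵖ => Λ.total d.unop) (c.inner_grading x y))
    (c.U.comp (L.toAdjoin P)) (fun z hz => c.U_zero _ hz) (fun g x => c.U_grading _ x)
    (fun g x y => (congrArg Λ.total (c.inner_U (L.toAdjoin P g) x y)).trans (Λ.total_act g _))
    (fun g x y => (congrArg Λ.total
      (c.inner_U_idem (SpectralData.idem_toAdjoin (idem_mul_inv g)) x y)).trans (Λ.total_act _ _))

/-- The identification of the underlying spaces. -/
noncomputable def downEquiv : c.E ≃L[ℂ] (Λ.downMod hc).E := (Λ.downRenorm c.toHilbertMod).toSpace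

/-- An elementary operator over `C` is a sum over `i` of elementary operators over `B`: the vector
`p i η` makes the summed inner product pick out exactly the `i`-th coordinate, which is all that `p
i ξ` can see. -/
theorem compression_elemOp_mem (ξ η : c.E) :
    compression (Λ.downEquiv hc).symm.toContinuousLinearMap
      (Λ.downEquiv hc).toContinuousLinearMap (elemOp C ξ η) ∈
        compactOperators B (Λ.downMod hc).E := by
  have : compression (Λ.downEquiv hc).symm.toContinuousLinearMap
      (Λ.downEquiv hc).toContinuousLinearMap (elemOp C ξ η) =
      ∑ i, elemOp B (Λ.downEquiv hc (c.π (D.p i) ξ)) (Λ.downEquiv hc (c.π (D.p i) η)) := by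
    refine ContinuousLinearMap.ext fun z => ?_
    obtain ⟨ζ, rfl⟩ := (Λ.downEquiv hc).surjective z
    rw [sum_apply]
    have h1 : elemOp C ξ η ζ =
        ∑ i, c.π (D.p i) ξ <• Λ.lift (fun _ => Λ.total (inner Cᵐᵒᵖ (c.π (D.p i) η) ζ).unop) := by
      have h2 : elemOp C ξ η ζ = ∑ i, c.π (D.p i) ξ <• (inner Cᵐᵒᵖ η ζ).unop := by
        conv_lhs => rw [← hc.sum_p_apply ξ]
        exact map_sum (smulL C c.E (inner Cᵐᵒᵖ η ζ)) _ _
      rw [h2]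
      refine Finset.sum_congr rfl fun i _ => Λ.p_smul_eq ?_ ξ
      have h3 : Λ.total (inner Cᵐᵒᵖ (c.π (D.p i) η) ζ).unop = Λ.ev i (inner Cᵐᵒᵖ η ζ).unop := by
        rw [total, Finset.sum_eq_single i, Cycle.inner_p_left, Λ.ev_inner_p hc]
        · intro j _ hj
          rw [Cycle.inner_p_left, Λ.ev_inner_p_of_ne hj]
        · simp
      rw [h3]
      exact (Λ.ev_lift_of_isFixed (b := fun _ => Λ.ev i (inner Cᵐᵒᵖ η ζ).unop)
        (Λ.ev_fixed _ i)).symm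
    refine (congrArg (Λ.downEquiv hc) h1).trans ?_
    rw [map_sum]
    rfl
  rw [this]
  exact sum_mem fun i _ => elemOp_mem _ _

theorem down_compact {S : c.E →L[ℂ] c.E} (hS : S ∈ compactOperators C c.E) :
    compression (Λ.downEquiv hc).symm.toContinuousLinearMap
      (Λ.downEquiv hc).toContinuousLinearMap S ∈ compactOperators B (Λ.downMod hc).E :=
  map_mem_compactOperators_of_elemOp _ (Λ.compression_elemOp_mem hc) hS

/-- The cycle over `B` which belongs to a normal cycle over the coinduced algebra. -/
noncomputable def down : Cycle (α.restrict (L.subset_adjoin P)) β :=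
  Cycle.transport D.toResolution c hc.comm (Λ.downMod hc)
    (Λ.downEquiv hc).symm.toContinuousLinearMap (Λ.downEquiv hc).toContinuousLinearMap
    (fun _ => rfl) (fun _ _ _ => rfl) (fun _ => rfl) (fun _ => rfl)
    (fun _ _ _ _ h x y => congrArg (fun d : Cᵐᵒᵖ => op (Λ.total d.unop)) (h x y))
    (fun _ hS _ => Λ.down_compact hc hS)
    (fun g a => congrArg (compression (Λ.downEquiv hc).symm.toContinuousLinearMap
      (Λ.downEquiv hc).toContinuousLinearMap) (c.π_equivariant (L.toAdjoin P g) a))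
    (fun g a x => c.π_compatible (L.toAdjoin P g) a x)
    (fun g a => ⟨Λ.down_compact hc (c.invariant_compact (L.toAdjoin P g) a).1,
      Λ.down_compact hc (c.invariant_compact (L.toAdjoin P g) a).2⟩)

end Link

end InvKK

namespace InvKK
open InverseMonoid
open scoped CStarAlgebra

/-! ### From cycles over `B` to cycles over the coinduced algebra -/

section extension

variable {G : Type w} [InverseMonoid G] {L : SubInverse G} {P : Set G} {A : Type v}
  [NonUnitalCommCStarAlgebra A] {α : InvAction (L.adjoin P) A} {n : ℕ}
  {B : Type u} [NonUnitalCStarAlgebra B] {D : SpectralData α n} {β : InvAction L B}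

namespace Cycle

open scoped Classical

open MulOpposite

variable (D) (c : Cycle (α.restrict (L.subset_adjoin P)) β)

/-- The projection onto the range of an element of `L.adjoin P`. -/
noncomputable def rangeProj (g : L.adjoin P) : c.E →L[ℂ] c.E := c.π (α.act (g * g⁻¹) D.one)

variable {D c}

theorem U_mul_π' (l : L) (a : A) :
    c.U l * c.π a = c.π (α.act (L.toAdjoin P l) a) * c.U l := c.U_mul_π l a

theorem π_idem' {q : L} (hq : IsIdempotentElem q) (a : A) :
    c.π (α.act (L.toAdjoin P q) a) = c.π a * c.U q := c.π_idem hq a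

theorem rangeProj_mul_π (g : L.adjoin P) (a : A) :
    c.rangeProj D g * c.π a = c.π (α.act (g * g⁻¹) a) := by
  rw [rangeProj, ← map_mul, α.central_idem (idem_mul_inv g), D.one_mul]

theorem π_mul_rangeProj (g : L.adjoin P) (a : A) :
    c.π a * c.rangeProj D g = c.π (α.act (g * g⁻¹) a) := by
  rw [← rangeProj_mul_π (D := D), rangeProj, ← map_mul, ← map_mul, mul_comm]

theorem rangeProj_self (g : L.adjoin P) :
    c.rangeProj D g * c.rangeProj D g = c.rangeProj D g := by
  refine (rangeProj_mul_π g _).trans ?_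
  rw [α.act_idem (idem_mul_inv g), rangeProj]

theorem rangeProj_p (g : L.adjoin P) (i : Fin n) :
    c.rangeProj D g * c.π (D.p i) = if D.val i (g * g⁻¹) then c.π (D.p i) else 0 := by
  rw [rangeProj_mul_π, α.act_idem_unit D.one_mul (idem_mul_inv g), D.p_val _ _ (idem_mul_inv g)]
  split_ifs
  · rfl
  · rw [map_zero]

theorem p_rangeProj (g : L.adjoin P) (i : Fin n) :
    c.π (D.p i) * c.rangeProj D g = if D.val i (g * g⁻¹) then c.π (D.p i) else 0 := by
  rw [← rangeProj_p, rangeProj_mul_π, π_mul_rangeProj]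

/-- If `i` is outside of the range of `g`, the moved index has value `0` at `1`, and its projection
is zero; so no case distinction is needed. -/
theorem rangeProj_p' (g : L.adjoin P) (i : Fin n) :
    c.rangeProj D g * c.π (D.p i) = c.π (D.p (D.mv i (g * g⁻¹))) := by
  rw [rangeProj_p]
  split_ifs with h
  · rw [D.mv_idem (idem_mul_inv g) h]
  · rw [D.p_eq_zero, map_zero]
    rwa [D.val_mv_one, idem_mul_inv_self (idem_mul_inv g)]

/-- In a normal cycle the range projection is the sum of those `p i` whose character is `1` on `g
g⁻¹`. -/
theorem Resolution.Comm.rangeProj (hc : c.IsNormal D.toResolution) {S : c.E →L[ℂ] c.E}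
    (hS : D.toResolution.Comm c.π S) (g : L.adjoin P) :
    S * c.rangeProj D g = c.rangeProj D g * S := by
  have h : c.rangeProj D g = ∑ i, if D.val i (g * g⁻¹) then c.π (D.p i) else 0 := by
    rw [← mul_one (c.rangeProj D g), ← hc.sum_p, Finset.mul_sum]
    exact Finset.sum_congr rfl fun i _ => rangeProj_p g i
  rw [h, Finset.mul_sum, Finset.sum_mul]
  refine Finset.sum_congr rfl fun i _ => ?_
  split_ifs
  · exact hS i
  · rw [mul_zero, zero_mul]

/-- The analogue for modules of the independence of the extension: `U q` is absorbed by the range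
projection, and `q l = q k`. -/
theorem rangeProj_mul_U_eq (hE : (L.adjoin P).IsEUnitary) {g : L.adjoin P} {l k : L}
    (hl : IsRestriction g (L.toAdjoin P l)) (hk : IsRestriction g (L.toAdjoin P k)) :
    c.rangeProj D g * c.U l = c.rangeProj D g * c.U k := by
  obtain ⟨q, hq, h1, h2⟩ := SubInverse.exists_idem_of_isRestriction hE hl hk
  have h3 : c.rangeProj D g * c.U q = c.rangeProj D g := by
    rw [rangeProj, ← π_idem' hq, ← α.act_mul_apply,
      idem_comm (SpectralData.idem_toAdjoin hq) (idem_mul_inv g), h2]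
  rw [← h3, mul_assoc, mul_assoc, ← map_mul, ← map_mul, h1]

theorem U_mul_rangeProj (l : L) (h : L.adjoin P) :
    c.U l * c.rangeProj D h =
      c.π (α.act (L.toAdjoin P l * (h * h⁻¹)) D.one) * c.U l := by
  rw [rangeProj, U_mul_π', ← α.act_mul_apply]

variable (hP : ∀ p ∈ P, IsIdempotentElem p)

variable (D c) in
/-- The operator by which an element of `L.adjoin P` acts. -/
noncomputable def extOp (g : L.adjoin P) : c.E →L[ℂ] c.E :=
  c.rangeProj D g * c.U (SpectralData.extend hP g)

variable (hE : (L.adjoin P).IsEUnitary)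

include hE in
theorem extOp_eq {g : L.adjoin P} {l : L} (hl : IsRestriction g (L.toAdjoin P l)) :
    c.extOp D hP g = c.rangeProj D g * c.U l :=
  rangeProj_mul_U_eq hE (SpectralData.isRestriction_extend hP g) hl

include hE in
theorem extOp_idem {e : L.adjoin P} (he : IsIdempotentElem e) :
    c.extOp D hP e = c.rangeProj D e := by
  rw [extOp_eq hP hE (l := 1) (by rw [map_one]; exact IsRestriction.idem he), map_one, mul_one]

include hE in
theorem extOp_mul (g h : L.adjoin P) :
    c.extOp D hP (g * h) = c.extOp D hP g * c.extOp D hP h := by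
  have hg := SpectralData.isRestriction_extend hP g
  have hh := SpectralData.isRestriction_extend hP h
  set l := SpectralData.extend hP g
  set k := SpectralData.extend hP h
  have hg' : g * g⁻¹ * L.toAdjoin P l = g := Eq.symm hg
  rw [extOp_eq hP hE hg, extOp_eq hP hE hh, extOp_eq hP hE (l := l * k)
    (by rw [map_mul]; exact hg.mul hh)]
  -- Moving `U l` past the range projection of `h` produces `l(h h⁻¹(1))`, which within the range of
  -- `g` is `g(h h⁻¹(1))`, the range projection of `g h`.
  have h1 : c.rangeProj D g * c.π (α.act (L.toAdjoin P l * (h * h⁻¹)) D.one) =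
      c.rangeProj D (g * h) := by
    rw [rangeProj_mul_π, ← α.act_mul_apply, ← mul_assoc, hg', α.act_unit D.one_mul, rangeProj,
      mul_inv_rev' g (h * h⁻¹), mul_inv_rev' g h, idem_inv (idem_mul_inv h)]
    congr 3
    have := (idem_mul_inv h).eq
    calc g * (h * h⁻¹) * (h * h⁻¹ * g⁻¹) = g * (h * h⁻¹ * (h * h⁻¹)) * g⁻¹ := by
          simp only [mul_assoc]
      _ = g * h * (h⁻¹ * g⁻¹) := by
          rw [this]
          simp only [mul_assoc]
  calc _ = c.rangeProj D g * c.π (α.act (L.toAdjoin P l * (h * h⁻¹)) D.one) * (c.U l * c.U k) := by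
        rw [h1, ← map_mul]
    _ = c.rangeProj D g * (c.U l * c.rangeProj D h) * c.U k := by
        rw [U_mul_rangeProj]
        simp only [mul_assoc]
    _ = _ := by simp only [mul_assoc]

/-- The extension of the action of `L` to `L.adjoin P`. -/
noncomputable def extHom (hc : c.IsNormal D.toResolution) :
    L.adjoin P →* (c.E →L[ℂ] c.E) where
  toFun := c.extOp D hP
  map_one' := by
    rw [extOp_idem hP hE idem_one, rangeProj, idem_mul_inv_self idem_one, α.act_one_apply, hc.unit]
  map_mul' := extOp_mul hP hE

-- On the domain of `i` one has `l(p (i · g)) = p i`, so covariance of `U l` gives the claim;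
-- elsewhere both sides vanish.
variable {hP} in
include hE in
theorem p_mul_extOp {g : L.adjoin P} {l : L} (hl : IsRestriction g (L.toAdjoin P l)) (i : Fin n) :
    c.π (D.p i) * c.extOp D hP g = c.U l * c.π (D.p (D.mv i g)) := by
  rw [extOp_eq hP hE hl, ← mul_assoc, p_rangeProj]
  split_ifs with h
  · rw [U_mul_π', D.act_p_of_isRestriction hl h]
  · rw [D.p_eq_zero, map_zero, zero_mul, mul_zero]
    rwa [D.val_mv_one]

variable {hP} in
include hE in
theorem extOp_mul_p (g : L.adjoin P) (i : Fin n) :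
    c.extOp D hP g * c.π (D.p (D.mv i g)) = c.π (D.p i) * c.extOp D hP g := by
  have hg := SpectralData.isRestriction_extend hP g
  have h1 := p_mul_extOp (c := c) (D := D) (hP := hP) hE hg i
  rw [extOp, mul_assoc, ← h1, ← mul_assoc, rangeProj_mul_π,
    α.act_idem_unit D.one_mul (idem_mul_inv g), map_mul]
  change c.π (D.p i) * c.rangeProj D g * _ = _
  rw [extOp_eq hP hE hg, mul_assoc, ← mul_assoc (c.rangeProj D g) (c.rangeProj D g)]
  rw [rangeProj_self]

theorem extOp_mul_π (g : L.adjoin P) (a : A) :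
    c.extOp D hP g * c.π a = c.π (α.act g a) * c.extOp D hP g := by
  have hg : g * g⁻¹ * L.toAdjoin P (SpectralData.extend hP g) = g :=
    Eq.symm (SpectralData.isRestriction_extend hP g)
  rw [extOp, mul_assoc, U_mul_π', ← mul_assoc, rangeProj_mul_π, ← α.act_mul_apply, hg,
    ← mul_assoc, π_mul_rangeProj, ← α.act_mul_apply, mul_inv_mul_self]

include hE in
theorem π_act_eq (g : L.adjoin P) (a : A) :
    c.π (α.act g a) = c.extOp D hP g * c.π a * c.extOp D hP g⁻¹ := by
  rw [extOp_mul_π, mul_assoc, ← extOp_mul hP hE, extOp_idem hP hE (idem_mul_inv g), rangeProj,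
    idem_mul_inv_self (idem_mul_inv g)]
  change _ = _ * c.rangeProj D g
  rw [π_mul_rangeProj, ← α.act_mul_apply, mul_inv_mul_self]

-- The failure of invariance under `g` in `L'` is the failure under its extension in `L`, multiplied
-- by a range projection. So compactness is inherited from the `L`-cycle.
include hE in
theorem extOp_conj_sub (hc : c.IsNormal D.toResolution) {S : c.E →L[ℂ] c.E}
    (hS : D.toResolution.Comm c.π S) {g : L.adjoin P} {l : L}
    (hl : IsRestriction g (L.toAdjoin P l)) :
    c.extOp D hP g * S * c.extOp D hP g⁻¹ - S * c.extOp D hP (g * g⁻¹) =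
      c.rangeProj D g * (c.U l * S * c.U l⁻¹ - S * c.U (l * l⁻¹)) := by
  have hl' : IsRestriction g⁻¹ (L.toAdjoin P l⁻¹) := by
    rw [SubInverse.toAdjoin_inv]
    exact hl.inv
  have h1 : c.extOp D hP g * c.rangeProj D g⁻¹ = c.rangeProj D g * c.U l := by
    rw [rangeProj, extOp_mul_π, ← α.act_mul_apply, inverse_inverse, ← mul_assoc, mul_inv_mul_self,
      α.act_unit D.one_mul, extOp_eq hP hE hl, ← mul_assoc]
    exact congrArg (· * c.U l) (rangeProj_self g)
  have h2 : c.extOp D hP (g * g⁻¹) = c.rangeProj D g := by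
    rw [extOp_idem hP hE (idem_mul_inv g), rangeProj, idem_mul_inv_self (idem_mul_inv g)]
    rfl
  have h3 : c.rangeProj D g * c.U (l * l⁻¹) = c.rangeProj D g := by
    rw [rangeProj, ← π_idem' (idem_mul_inv l), ← α.act_mul_apply,
      map_mul (L.toAdjoin P), SubInverse.toAdjoin_inv, hl.mul_inv_mul]
  have h4 : c.extOp D hP g * S * c.extOp D hP g⁻¹ = c.rangeProj D g * (c.U l * S * c.U l⁻¹) := by
    rw [extOp_eq hP hE hl', mul_assoc, ← mul_assoc S, Resolution.Comm.rangeProj hc hS,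
      mul_assoc (c.rangeProj D g⁻¹), ← mul_assoc, h1]
    simp only [mul_assoc]
  rw [h4, h2, mul_sub, ← mul_assoc _ S, ← Resolution.Comm.rangeProj hc hS, mul_assoc S, h3]

include hE in
theorem comm_extOp_conj {S : c.E →L[ℂ] c.E} (hS : D.toResolution.Comm c.π S) (g : L.adjoin P) :
    D.toResolution.Comm c.π (c.extOp D hP g * S * c.extOp D hP g⁻¹) := fun i => by
  have h1 : c.extOp D hP g⁻¹ * c.π (D.p i) =
      c.π (D.p (D.mv i g)) * c.extOp D hP g⁻¹ := by
    rw [← extOp_mul_p hE, ← D.mv_mul, ← rangeProj_p', ← mul_assoc]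
    congr 1
    have : c.rangeProj D g = c.extOp D hP (g * g⁻¹) := by
      rw [extOp_idem hP hE (idem_mul_inv g), rangeProj, rangeProj,
        idem_mul_inv_self (idem_mul_inv g)]
    rw [this, ← extOp_mul hP hE, ← mul_assoc, InverseMonoid.inv_mul_self_inv]
  rw [mul_assoc, h1, ← mul_assoc, mul_assoc _ S, hS, ← mul_assoc, extOp_mul_p hE]
  simp only [mul_assoc]

end Cycle

end extension

end InvKK

namespace InvKK
open InverseMonoid
open scoped CStarAlgebra

/-! ### The module and the cycle over the coinduced algebra. -/

namespace Link

open scoped Classical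

open MulOpposite

variable {G : Type w} [InverseMonoid G] {L : SubInverse G} {P : Set G} {A : Type v}
  [NonUnitalCommCStarAlgebra A] {α : InvAction (L.adjoin P) A} {n : ℕ}
  {B : Type u} [NonUnitalCStarAlgebra B] {C : Type u} [NonUnitalCStarAlgebra C] [Finite L]
  {D : SpectralData α n} {β : InvAction L B} {γ : InvAction (L.adjoin P) C}
  (Λ : Link D β γ) {c : Cycle (α.restrict (L.subset_adjoin P)) β}
  (hc : c.IsNormal D.toResolution) (hP : ∀ p ∈ P, IsIdempotentElem p)
  (hE : (L.adjoin P).IsEUnitary)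

/-- Idempotents of `L` act on the range of `p i` as scalars, and they pass out of inner products. So
this inner product is admissible as an `i`-th coordinate. -/
theorem isFixed_inner_p (i : Fin n) (x y : c.E) :
    β.IsFixed (D.wt i) (inner Bᵐᵒᵖ x (c.π (D.p i) y)).unop := fun q hq => by
  have h : c.U q (c.π (D.p i) y) = if D.wt i q then c.π (D.p i) y else 0 := by
    change (c.U q * c.π (D.p i)) y = _
    have h1 := SpectralData.idem_toAdjoin (P := P) hq
    rw [← c.π_comm_U hq, ← Cycle.π_idem' hq, α.act_idem_unit D.one_mul h1, D.p_val _ _ h1]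
    change c.π (if D.wt i q then D.p i else 0) y = _
    split_ifs
    · rfl
    · rw [map_zero]
      rfl
  rw [← c.inner_U_idem hq, h]
  split_ifs
  · rfl
  · rw [CStarModule.inner_zero_right, unop_zero]

/-- The inner product on the module of a normal cycle with values in the coinduced algebra. -/
noncomputable def upInn (c : Cycle (α.restrict (L.subset_adjoin P)) β) (x y : c.E) : C :=
  Λ.lift fun i => (inner Bᵐᵒᵖ x (c.π (D.p i) y)).unop

theorem ev_upInn (i : Fin n) (x y : c.E) :
    Λ.ev i (Λ.upInn c x y) = (inner Bᵐᵒᵖ x (c.π (D.p i) y)).unop :=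
  Λ.ev_lift_of_isFixed (b := fun i => (inner Bᵐᵒᵖ x (c.π (D.p i) y)).unop) (isFixed_inner_p i x y)

/-- The action of the coinduced algebra on the module of a cycle. -/
noncomputable def upAct (c : Cycle (α.restrict (L.subset_adjoin P)) β) (x : c.E) (d : C) : c.E :=
  ∑ i, c.π (D.p i) x <• Λ.ev i d

theorem p_upAct (i : Fin n) (x : c.E) (d : C) :
    c.π (D.p i) (Λ.upAct c x d) = c.π (D.p i) x <• Λ.ev i d := by
  rw [upAct, map_sum, Finset.sum_eq_single i]
  · rw [Cycle.p_smul, Cycle.p_p_apply, if_pos rfl]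
  · intro j _ hj
    rw [Cycle.p_smul, Cycle.p_p_apply, if_neg hj.symm, smul_zero_mod]
  · simp

theorem upAct_p (i : Fin n) (x : c.E) (d : C) :
    Λ.upAct c (c.π (D.p i) x) d = c.π (D.p i) x <• Λ.ev i d := by
  rw [upAct, Finset.sum_eq_single i]
  · rw [Cycle.p_p_apply, if_pos rfl]
  · intro j _ hj
    rw [Cycle.p_p_apply, if_neg hj, smul_zero_mod]
  · simp

include hc in
theorem inner_eq_sum (x y : c.E) : (inner Bᵐᵒᵖ x y).unop = ∑ i, Λ.ev i (Λ.upInn c x y) := by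
  conv_lhs => rw [← hc.sum_p_apply y, CStarModule.inner_sum_right, Finset.unop_sum]
  exact Finset.sum_congr rfl fun i _ => (Λ.ev_upInn i x y).symm

theorem inner_p_nonneg (i : Fin n) (x : c.E) : 0 ≤ inner Bᵐᵒᵖ x (c.π (D.p i) x) := by
  rw [← Cycle.inner_p_p (R := D.toResolution)]
  exact CStarModule.inner_self_nonneg

/-- The inner product on the module of a normal cycle over `B`, with values in the coinduced
algebra. -/
noncomputable def upRenorm : Renorm C c.E where
  inn := Λ.upInn c
  act := Λ.upAct c
  inn_add x y z := Λ.ev_inj _ _ fun i => by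
    rw [map_add, ev_upInn, ev_upInn, ev_upInn, map_add, CStarModule.inner_add_right, unop_add]
  inn_smul t x y := Λ.ev_inj _ _ fun i => by
    rw [map_smul, ev_upInn, ev_upInn, map_smul, CStarModule.inner_smul_right_complex, unop_smul]
  star_inn x y := Λ.ev_inj _ _ fun i => by
    rw [map_star, ev_upInn, ev_upInn, ← inner_swap, Cycle.inner_p_left (R := D.toResolution)]
  inn_act x y d := Λ.ev_inj _ _ fun i => by
    rw [map_mul, ev_upInn, ev_upInn, p_upAct, inner_smul_unop]
  nonneg x := Λ.lift_nonneg fun i => inner_p_nonneg i x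
  lower := ⟨n, fun x => by
    rw [CStarModule.norm_sq_eq Bᵐᵒᵖ, ← MulOpposite.norm_unop, Λ.inner_eq_sum hc]
    refine (norm_sum_le _ _).trans ?_
    refine (Finset.sum_le_sum fun i _ => Λ.norm_ev_le _ i).trans ?_
    simp⟩
  upper := ⟨‖Λ.lift‖ * ∑ i, ‖c.π (D.p i)‖, fun x => by
    refine (Λ.lift.le_opNorm _).trans ?_
    rw [mul_assoc]
    refine mul_le_mul_of_nonneg_left ?_ (norm_nonneg _)
    refine (pi_norm_le_iff_of_nonneg (by positivity)).2 fun i => ?_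
    rw [MulOpposite.norm_unop]
    refine (CStarModule.norm_inner_le c.E).trans ?_
    have h1 : ‖c.π (D.p i)‖ ≤ ∑ i, ‖c.π (D.p i)‖ :=
      Finset.single_le_sum (f := fun i => ‖c.π (D.p i)‖) (fun i _ => norm_nonneg _)
        (Finset.mem_univ i)
    calc ‖x‖ * ‖c.π (D.p i) x‖ ≤ ‖x‖ * (‖c.π (D.p i)‖ * ‖x‖) := by
          gcongr
          exact (c.π (D.p i)).le_opNorm x
      _ ≤ ‖x‖ * ((∑ i, ‖c.π (D.p i)‖) * ‖x‖) := by gcongr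
      _ = _ := by ring⟩

/-- The new inner product contains `p i`, so adjointness survives only for an adjoint which is
diagonal. -/
theorem upInn_comm {S S' : c.E →L[ℂ] c.E} (hS' : D.toResolution.Comm c.π S')
    (h : IsAdj B S S') (x y : c.E) : Λ.upInn c (S x) y = Λ.upInn c x (S' y) :=
  Λ.ev_inj _ _ fun i => by
    rw [ev_upInn, ev_upInn, h, Cycle.Resolution.Comm.apply hS']

theorem inner_p_eq_of_p_eq {i : Fin n} {x x' y y' : c.E}
    (hx : c.π (D.p i) x = x') (hy : c.π (D.p i) y = y') :
    inner Bᵐᵒᵖ x (c.π (D.p i) y) = inner Bᵐᵒᵖ x' y' := by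
  rw [← Cycle.inner_p_p (R := D.toResolution), hx, hy]

-- In the `i`-th coordinate `p i` turns the action of `g` into that of `l` on the range of `p (i ·
-- g)`, exactly as in the coinduced action.
include hE in
theorem upInn_extOp (g : L.adjoin P) (x y : c.E) :
    Λ.upInn c (c.extOp D hP g x) (c.extOp D hP g y) = γ.act g (Λ.upInn c x y) :=
  Λ.ev_inj _ _ fun i => by
    have hg := SpectralData.isRestriction_extend hP g
    have h (x : c.E) : c.π (D.p i) (c.extOp D hP g x) =
        c.U (SpectralData.extend hP g) (c.π (D.p (D.mv i g)) x) :=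
      congrArg (fun S => S x) (Cycle.p_mul_extOp hE hg i)
    rw [Λ.ev_act i g _ _ hg, ev_upInn, ev_upInn, inner_p_eq_of_p_eq (h x) (h y), c.inner_U,
      Cycle.inner_p_p (R := D.toResolution)]

include hE in
theorem upInn_extOp_idem {e : L.adjoin P} (he : IsIdempotentElem e) (x y : c.E) :
    Λ.upInn c x (c.extOp D hP e y) = γ.act e (Λ.upInn c x y) :=
  Λ.ev_inj _ _ fun i => by
    have h : c.π (D.p i) (c.extOp D hP e y) = if D.val i e then c.π (D.p i) y else 0 := by
      rw [Cycle.extOp_idem hP hE he]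
      change (c.π (D.p i) * c.rangeProj D e) y = _
      rw [Cycle.p_rangeProj, idem_mul_inv_self he]
      split_ifs <;> rfl
    rw [Λ.ev_act_idem i he, ev_upInn, ev_upInn, h]
    split_ifs
    · rfl
    · rw [CStarModule.inner_zero_right, unop_zero]

/-- The Hilbert module over the coinduced algebra which belongs to a normal cycle over `B`. -/
noncomputable def upMod : HilbertMod γ :=
  c.renorm (Λ.upRenorm hc) (fun i => c.π (D.p i)) (fun i b => Λ.lift (Pi.single i b))
    (fun ξ b => by
      conv_lhs => rw [← hc.sum_p_apply ξ, smul_mod_eq, map_sum]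
      refine Finset.sum_congr rfl fun i _ => .trans ?_ (Λ.upAct_p i ξ _).symm
      refine mod_ext (B := B) fun z => unop_injective ?_
      rw [← smul_mod_eq, inner_smul_unop, inner_smul_unop, Λ.ev_lift, Pi.single_eq_same,
        (isFixed_inner_p i z ξ).mul_cut])
    (fun x y => Λ.ev_inj _ _ fun i => by
      change Λ.ev i (Λ.upInn c _ _) = Λ.ev i (Λ.upInn c _ _)
      rw [ev_upInn, ev_upInn, c.π_grading, c.inner_grading])
    (Cycle.extHom hP hE hc)
    (fun z hz => by
      change c.extOp D hP z = 0
      have h1 : z * z⁻¹ = z := Subtype.ext (hz.2 _).1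
      rw [Cycle.extOp, Cycle.rangeProj, h1, α.act_zero z hz]
      change c.π 0 * _ = 0
      rw [map_zero, zero_mul])
    (fun g x => by
      change c.π _ (c.U _ (c.grading x)) = c.grading (c.π _ (c.U _ x))
      rw [c.U_grading, c.π_grading])
    (Λ.upInn_extOp hP hE) (fun g => Λ.upInn_extOp_idem hP hE (idem_mul_inv g))

/-- The identification of the underlying spaces. -/
noncomputable def upEquiv : c.E ≃L[ℂ] (Λ.upMod hc hP hE).E := (Λ.upRenorm hc).toSpace

/-- The diagonal part of an operator depends continuously on it. -/
noncomputable def diagonalL (c : Cycle (α.restrict (L.subset_adjoin P)) β) (D : SpectralData α n) :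
    (c.E →L[ℂ] c.E) →L[ℂ] (c.E →L[ℂ] c.E) :=
  ∑ i, compression (c.π (D.p i)) (c.π (D.p i))

theorem diagonalL_apply (S : c.E →L[ℂ] c.E) :
    diagonalL c D S = c.diagonal D.toResolution S := by
  rw [diagonalL, sum_apply]
  rfl

/-- The diagonal part of an elementary operator over `B` is the elementary operator over `C` with
the same two vectors. A diagonal operator equals its diagonal part, which depends continuously on
it. -/
theorem up_compact {S : c.E →L[ℂ] c.E} (hS : S ∈ compactOperators B c.E)
    (hS' : D.toResolution.Comm c.π S) :
    compression (Λ.upEquiv hc hP hE).symm.toContinuousLinearMap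
      (Λ.upEquiv hc hP hE).toContinuousLinearMap S ∈
        compactOperators C (Λ.upMod hc hP hE).E := by
  rw [← hc.diagonal_eq hS', ← diagonalL_apply]
  refine map_mem_compactOperators_of_elemOp
    (compression (Λ.upEquiv hc hP hE).symm.toContinuousLinearMap
      (Λ.upEquiv hc hP hE).toContinuousLinearMap ∘L diagonalL c D) (fun ξ η => ?_) hS
  refine Set.mem_of_eq_of_mem ?_ (elemOp_mem (Λ.upEquiv hc hP hE ξ) (Λ.upEquiv hc hP hE η))
  refine ContinuousLinearMap.ext fun z => ?_
  obtain ⟨ζ, rfl⟩ := (Λ.upEquiv hc hP hE).surjective z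
  change Λ.upEquiv hc hP hE (diagonalL c D (elemOp B ξ η) ζ) =
    Λ.upEquiv hc hP hE (Λ.upAct c ξ (Λ.upInn c η ζ))
  rw [diagonalL_apply, Cycle.diagonal, sum_apply, upAct]
  congr 1
  refine Finset.sum_congr rfl fun i _ => ?_
  rw [ev_upInn, op_unop]
  exact (c.isAdj_p D.toResolution i).map_smul _ _

include hc hE in
theorem comm_conj_sub (g : L.adjoin P) : D.toResolution.Comm c.π
    (c.extOp D hP g * c.T * c.extOp D hP g⁻¹ - c.T * c.extOp D hP (g * g⁻¹)) := by
  refine (Cycle.comm_extOp_conj hP hE hc.comm g).sub (hc.comm.mul ?_)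
  rw [Cycle.extOp_idem hP hE (idem_mul_inv g)]
  exact Resolution.comm_π _

/-- The cycle over the coinduced algebra which belongs to a normal cycle over `B`. -/
noncomputable def up : Cycle α γ :=
  Cycle.transport D.toResolution c hc.comm (Λ.upMod hc hP hE)
    (Λ.upEquiv hc hP hE).symm.toContinuousLinearMap (Λ.upEquiv hc hP hE).toContinuousLinearMap
    (fun _ => rfl) (fun _ _ _ => rfl) (fun _ => rfl) (fun _ => rfl)
    (fun _ _ _ h' h x y => congrArg op (Λ.upInn_comm h' h x y))
    (fun _ hS hS' => Λ.up_compact hc hP hE hS hS')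
    (fun g a => congrArg (compression (Λ.upEquiv hc hP hE).symm.toContinuousLinearMap
      (Λ.upEquiv hc hP hE).toContinuousLinearMap) (Cycle.π_act_eq hP hE g a))
    (fun g a x => by
      change Λ.upEquiv hc hP hE (c.π (α.act (g * g⁻¹) a) ((Λ.upEquiv hc hP hE).symm x)) =
        Λ.upEquiv hc hP hE ((c.π a * c.extOp D hP (g * g⁻¹)) ((Λ.upEquiv hc hP hE).symm x))
      rw [Cycle.extOp_idem hP hE (idem_mul_inv g), Cycle.π_mul_rangeProj,
        idem_mul_inv_self (idem_mul_inv g)])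
    (fun g a => by
      have h := Cycle.extOp_conj_sub hP hE hc hc.comm (SpectralData.isRestriction_extend hP g)
      -- On the left, `π a` and the range projection combine into the action of `a · g g⁻¹(1)`. On
      -- the right, the range projection is an outer adjointable factor.
      have h1 := c.invariant_compact (SpectralData.extend hP g) (a * α.act (g * g⁻¹) D.one)
      have h2 := c.invariant_compact (SpectralData.extend hP g) a
      have h3 := comm_conj_sub hc hP hE g
      constructor
      · refine Λ.up_compact hc hP hE (S := c.π a * (c.extOp D hP g * c.T * c.extOp D hP g⁻¹ -
          c.T * c.extOp D hP (g * g⁻¹))) ?_ ((Resolution.comm_π a).mul h3)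
        rw [h, ← mul_assoc]
        rw [map_mul] at h1
        exact h1.1
      · refine Λ.up_compact hc hP hE (S := (c.extOp D hP g * c.T * c.extOp D hP g⁻¹ -
          c.T * c.extOp D hP (g * g⁻¹)) * c.π a) ?_ (h3.mul (Resolution.comm_π a))
        rw [h, mul_assoc]
        exact mul_mem_compactOperators (c.isAdj_π _) h2.2)

end Link

end InvKK

namespace InvKK
open InverseMonoid
open scoped CStarAlgebra

/-! ### The isomorphism of `KK`-groups -/

namespace Link

open MulOpposite

variable {G : Type w} [InverseMonoid G] {L : SubInverse G} {P : Set G} {A : Type v}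
  [NonUnitalCommCStarAlgebra A] {α : InvAction (L.adjoin P) A} {n : ℕ}
  {B : Type u} [NonUnitalCStarAlgebra B] {C : Type u} [NonUnitalCStarAlgebra C] [Finite L]
  {D : SpectralData α n} {β : InvAction L B} {γ : InvAction (L.adjoin P) C}
  (Λ : Link D β γ) (hP : ∀ p ∈ P, IsIdempotentElem p) (hE : (L.adjoin P).IsEUnitary)

section down

variable {c d : Cycle α γ} (hc : c.IsNormal D.toResolution) (hd : d.IsNormal D.toResolution)

/-- The same evaluation map works, because summing coordinates commutes with evaluating at `t`. -/
theorem down_isEvaluation {t : unitInterval} {p : Cycle α γ.path}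
    (hp : p.IsNormal D.toResolution) (h : p.IsEvaluation t c) :
    (Λ.path.down hp).IsEvaluation t (Λ.down hc) := by
  obtain ⟨r, h1, h2, -, h4, h5, h6, h7⟩ := h
  refine .of_inner ((Λ.downEquiv hc).toLinearMap ∘ₗ r ∘ₗ (Λ.path.downEquiv hp).symm.toLinearMap)
    ?_ (fun x y => ?_) (fun x => congrArg (Λ.downEquiv hc) (h4 _))
    (fun g x => congrArg (Λ.downEquiv hc) (h5 _ _))
    (fun a x => congrArg (Λ.downEquiv hc) (h6 _ _)) (fun x => congrArg (Λ.downEquiv hc) (h7 _))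
  · exact (Λ.downEquiv hc).surjective.comp (h1.comp (Λ.path.downEquiv hp).symm.surjective)
  · obtain ⟨x, rfl⟩ := (Λ.path.downEquiv hp).surjective x
    obtain ⟨y, rfl⟩ := (Λ.path.downEquiv hp).surjective y
    change Λ.total (inner Cᵐᵒᵖ (r x) (r y)).unop = Λ.path.total (inner C(unitInterval, C)ᵐᵒᵖ x y).unop t
    rw [h2, total, total, ContinuousMap.sum_apply]
    rfl

include hc hd in
theorem down_homotopic {p : Cycle α γ.path} (hp : p.IsNormal D.toResolution)
    (h : p.IsEvaluation 0 c) (h' : p.IsEvaluation 1 d) :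
    (Λ.down hc).Homotopic (Λ.down hd) :=
  ⟨Λ.path.down hp, Λ.down_isEvaluation hc hp h, Λ.down_isEvaluation hd hp h'⟩

include hc hd in
theorem down_homotopic_of_iso (h : c.Iso d) : (Λ.down hc).Homotopic (Λ.down hd) :=
  Λ.down_homotopic hc hd hc.constPath (c.isEvaluation_constPath 0)
    ((c.isEvaluation_constPath 1).trans h)

theorem down_sum : ((Λ.down hc).sum (Λ.down hd)).Iso (Λ.down (hc.sum hd)) := by
  let r : (Λ.down hc).E × (Λ.down hd).E →ₗ[ℂ] c.E × d.E :=
    (Λ.downEquiv hc).symm.toLinearMap.prodMap (Λ.downEquiv hd).symm.toLinearMap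
  let s : (c.sum d).E ≃L[ℂ] (Λ.down (hc.sum hd)).E := Λ.downEquiv (hc.sum hd)
  refine ⟨s.toLinearMap ∘ₗ r, fun x => ?_, fun x y => ?_, fun x => rfl, fun g x => rfl,
    fun a x => rfl, fun x => rfl⟩
  · obtain ⟨x, rfl⟩ := s.surjective x
    exact ⟨(Λ.downEquiv hc x.1, Λ.downEquiv hd x.2), rfl⟩
  · refine unop_injective ?_
    change Λ.total ((inner Cᵐᵒᵖ (r x).1 (r y).1).unop + (inner Cᵐᵒᵖ (r x).2 (r y).2).unop) = _
    rw [total_add]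
    rfl

theorem isNormal_down : (Λ.down hc).IsNormal D.toResolution where
  unit := by
    change compression _ _ (c.π D.one) = 1
    rw [hc.unit]
    rfl
  comm i := congrArg (compression (Λ.downEquiv hc).symm.toContinuousLinearMap
    (Λ.downEquiv hc).toContinuousLinearMap) (hc.comm i)

end down

section up

variable {c d : Cycle (α.restrict (L.subset_adjoin P)) β} (hc : c.IsNormal D.toResolution)
  (hd : d.IsNormal D.toResolution)

theorem up_isEvaluation {t : unitInterval} {p : Cycle (α.restrict (L.subset_adjoin P)) β.path}
    (hp : p.IsNormal D.toResolution) (h : p.IsEvaluation t c) :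
    (Λ.path.up hp hP hE).IsEvaluation t (Λ.up hc hP hE) := by
  obtain ⟨r, h1, h2, -, h4, h5, h6, h7⟩ := h
  refine .of_inner ((Λ.upEquiv hc hP hE).toLinearMap ∘ₗ r ∘ₗ
      (Λ.path.upEquiv hp hP hE).symm.toLinearMap)
    ?_ (fun x y => ?_) (fun x => congrArg (Λ.upEquiv hc hP hE) (h4 _))
    (fun g x => congrArg (Λ.upEquiv hc hP hE) ?_)
    (fun a x => congrArg (Λ.upEquiv hc hP hE) (h6 _ _))
    (fun x => congrArg (Λ.upEquiv hc hP hE) (h7 _))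
  · exact (Λ.upEquiv hc hP hE).surjective.comp
      (h1.comp (Λ.path.upEquiv hp hP hE).symm.surjective)
  · obtain ⟨x, rfl⟩ := (Λ.path.upEquiv hp hP hE).surjective x
    obtain ⟨y, rfl⟩ := (Λ.path.upEquiv hp hP hE).surjective y
    change Λ.upInn c (r x) (r y) = Λ.path.upInn p x y t
    refine Λ.ev_inj _ _ fun i => ?_
    rw [ev_upInn, ← h6, h2, ← path_ev_apply, ev_upInn]
  -- The extended action is built from `π` and `U`, both of which `r` intertwines.
  · exact (h6 _ _).trans (congrArg (c.π _) (h5 _ _))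

include hc hd in
theorem up_homotopic {p : Cycle (α.restrict (L.subset_adjoin P)) β.path}
    (hp : p.IsNormal D.toResolution) (h : p.IsEvaluation 0 c) (h' : p.IsEvaluation 1 d) :
    (Λ.up hc hP hE).Homotopic (Λ.up hd hP hE) :=
  ⟨Λ.path.up hp hP hE, Λ.up_isEvaluation hP hE hc hp h, Λ.up_isEvaluation hP hE hd hp h'⟩

include hc hd in
theorem up_homotopic_of_iso (h : c.Iso d) : (Λ.up hc hP hE).Homotopic (Λ.up hd hP hE) :=
  Λ.up_homotopic hP hE hc hd hc.constPath (c.isEvaluation_constPath 0)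
    ((c.isEvaluation_constPath 1).trans h)

theorem isNormal_up : (Λ.up hc hP hE).IsNormal D.toResolution where
  unit := by
    change compression _ _ (c.π D.one) = 1
    rw [hc.unit]
    rfl
  comm i := congrArg (compression (Λ.upEquiv hc hP hE).symm.toContinuousLinearMap
    (Λ.upEquiv hc hP hE).toContinuousLinearMap) (hc.comm i)

/-- Summing the coordinates `⟨x, p i y⟩` gives back `⟨x, y⟩` as the `p i` sum to `1`. For `l` in `L`
the range projection is `U (l l⁻¹)`, so the extended action restricts to `U l`. -/
theorem iso_down_up : c.Iso (Λ.down (Λ.isNormal_up hP hE hc)) := by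
  let s : (Λ.up hc hP hE).E ≃L[ℂ] (Λ.down (Λ.isNormal_up hP hE hc)).E :=
    Λ.downEquiv (Λ.isNormal_up hP hE hc)
  refine ⟨s.toLinearMap ∘ₗ (Λ.upEquiv hc hP hE).toLinearMap, ?_, fun x y => ?_, fun x => rfl,
    fun g x => ?_, fun a x => rfl, fun x => rfl⟩
  · exact s.surjective.comp (Λ.upEquiv hc hP hE).surjective
  · exact unop_injective (Λ.inner_eq_sum hc x y).symm
  · change s (Λ.upEquiv hc hP hE (c.U g x)) = s (Λ.upEquiv hc hP hE
      (c.extOp D hP (L.toAdjoin P g) x))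
    rw [Cycle.extOp_eq hP hE (IsRestriction.refl _), Cycle.rangeProj, ← SubInverse.toAdjoin_inv,
      ← map_mul (L.toAdjoin P), Cycle.π_idem' (idem_mul_inv g), hc.unit, one_mul, ← map_mul,
      mul_inv_mul_self]

end up

/-- The sum of the coordinates of `⟨x, p i y⟩` is the `i`-th coordinate of `⟨x, y⟩`. The original
action has the form `U g = U (g g⁻¹) U l` forced upon the extension. -/
theorem iso_up_down {c : Cycle α γ} (hc : c.IsNormal D.toResolution) :
    c.Iso (Λ.up (Λ.isNormal_down hc) hP hE) := by
  let s : (Λ.down hc).E ≃L[ℂ] (Λ.up (Λ.isNormal_down hc) hP hE).E :=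
    Λ.upEquiv (Λ.isNormal_down hc) hP hE
  refine ⟨s.toLinearMap ∘ₗ (Λ.downEquiv hc).toLinearMap, ?_, fun x y => ?_, fun x => rfl,
    fun g x => ?_, fun a x => rfl, fun x => rfl⟩
  · exact s.surjective.comp (Λ.downEquiv hc).surjective
  · refine unop_injective (Λ.ev_inj _ _ fun i => ?_)
    refine (Λ.ev_upInn (c := Λ.down hc) i (Λ.downEquiv hc x) (Λ.downEquiv hc y)).trans ?_
    change Λ.total (inner Cᵐᵒᵖ x (c.π (D.p i) y)).unop = Λ.ev i (inner Cᵐᵒᵖ x y).unop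
    rw [total, Finset.sum_eq_single i, Λ.ev_inner_p hc]
    · intro j _ hj
      exact Λ.ev_inner_p_of_ne hj x y
    · simp
  · have h : c.U g x =
        c.π (α.act (g * g⁻¹) D.one) (c.U (L.toAdjoin P (SpectralData.extend hP g)) x) := by
      rw [c.π_idem (idem_mul_inv g), hc.unit, one_mul, ← c.U_mul_apply,
        ← SpectralData.isRestriction_extend hP g]
    exact congrArg (fun z => s (Λ.downEquiv hc z)) h

/-- The map from `KK` over `C` to `KK` over `B`. -/
noncomputable def downKK : KK α γ → KK (α.restrict (L.subset_adjoin P)) β :=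
  Quot.map (fun c => Λ.down (c.isNormal_normalize D.toResolution)) fun _ _ ⟨p, h, h'⟩ =>
    Λ.down_homotopic _ _ (p.isNormal_normalize D.toResolution) h.normalize h'.normalize

/-- The map from `KK` over `B` to `KK` over `C`. -/
noncomputable def upKK : KK (α.restrict (L.subset_adjoin P)) β → KK α γ :=
  Quot.map (fun c => Λ.up (c.isNormal_normalize D.toResolution) hP hE) fun _ _ ⟨p, h, h'⟩ =>
    Λ.up_homotopic hP hE _ _ (p.isNormal_normalize D.toResolution) h.normalize h'.normalize

/-- Any normal representative computes the map, since normalizing a normal cycle changes it only by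
an isomorphism. -/
theorem downKK_mk {c : Cycle α γ} (hc : c.IsNormal D.toResolution) :
    Λ.downKK (Quot.mk _ c) = Quot.mk _ (Λ.down hc) :=
  Quot.sound (Λ.down_homotopic_of_iso _ hc hc.iso_normalize)

theorem upKK_mk {c : Cycle (α.restrict (L.subset_adjoin P)) β} (hc : c.IsNormal D.toResolution) :
    Λ.upKK hP hE (Quot.mk _ c) = Quot.mk _ (Λ.up hc hP hE) :=
  Quot.sound (Λ.up_homotopic_of_iso hP hE _ hc hc.iso_normalize)

/-- The isomorphism of `KK`-groups. -/
noncomputable def kkEquiv : KK α γ ≃+ KK (α.restrict (L.subset_adjoin P)) β where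
  toFun := Λ.downKK
  invFun := Λ.upKK hP hE
  left_inv x := by
    induction x using Quot.inductionOn with
    | h c =>
      have hc := c.isNormal_normalize D.toResolution
      rw [← c.mk_normalize D.toResolution, Λ.downKK_mk hc, Λ.upKK_mk hP hE (Λ.isNormal_down hc)]
      exact (Quot.sound (Λ.iso_up_down hP hE hc).homotopic).symm
  right_inv x := by
    induction x using Quot.inductionOn with
    | h c =>
      have hc := c.isNormal_normalize D.toResolution
      rw [← c.mk_normalize D.toResolution, Λ.upKK_mk hP hE hc, Λ.downKK_mk (Λ.isNormal_up hP hE hc)]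
      exact (Quot.sound (Λ.iso_down_up hP hE hc).homotopic).symm
  map_add' x y := by
    induction x using Quot.inductionOn with
    | h c =>
      induction y using Quot.inductionOn with
      | h d =>
        have hc := c.isNormal_normalize D.toResolution
        have hd := d.isNormal_normalize D.toResolution
        -- Sums of normal cycles are normal, so the class of the sum is computed without a further
        -- normalization.
        rw [← c.mk_normalize D.toResolution, ← d.mk_normalize D.toResolution, Λ.downKK_mk hc,
          Λ.downKK_mk hd]
        exact (Λ.downKK_mk (hc.sum hd)).trans
          (Quot.sound (Λ.down_sum hc hd).homotopic).symm

end Link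

end InvKK

/-! ### The main theorem, with the coinduced algebra as `B'`. -/

theorem mainTheorem9 {G : Type w} [InvKK.InverseMonoid G] [Countable G]
    (L : InvKK.SubInverse G) (hL : (L : Set G).Finite)
    (P : Set G) (hP : ∀ p ∈ P, IsIdempotentElem p)
    (hE : (L.adjoin P).IsEUnitary)
    {A : Type v} [NonUnitalCommCStarAlgebra A] [FiniteDimensional ℂ A]
    (α : InvKK.InvAction (L.adjoin P) A) :
    ∃ n : ℕ, 1 ≤ n ∧
      ∃ F : ∀ (B : Type u) [NonUnitalCStarAlgebra B],
          InvKK.InvAction L B → InvKK.PowerSubalgebra (L.adjoin P) B n,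
        -- `KK^L(Res A, B) ≅ KK^{L'}(A, B')`
        (∀ (B : Type u) [NonUnitalCStarAlgebra B] (β : InvKK.InvAction L B),
          Nonempty (InvKK.KK (α.restrict (L.subset_adjoin P)) β ≃+ InvKK.KK α (F B β).action)) ∧
        -- `B ↦ B'` is functorial, compatibly with the inclusions `B' ⊆ B^n`
        (∀ (B C : Type u) [NonUnitalCStarAlgebra B] [NonUnitalCStarAlgebra C]
          (β : InvKK.InvAction L B) (γ : InvKK.InvAction L C) (f : B →⋆ₙₐ[ℂ] C),
          β.Equivariant γ f →
            ∃ f' : (F B β).carrier →⋆ₙₐ[ℂ] (F C γ).carrier, (F B β).IsLift (F C γ) f f') ∧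
        -- `B ↦ B'` commutes with all direct sums
        (∀ (I : Type t) (D : I → Type u) [∀ i, NonUnitalCStarAlgebra (D i)]
          (δ : ∀ i, InvKK.InvAction L (D i))
          (B : Type u) [NonUnitalCStarAlgebra B] (β : InvKK.InvAction L B)
          (ι : ∀ i, D i →⋆ₙₐ[ℂ] B),
          (∀ i, (δ i).Equivariant β (ι i)) → InvKK.IsDirectSum ι →
            ∃ ι' : ∀ i, (F (D i) (δ i)).carrier →⋆ₙₐ[ℂ] (F B β).carrier,
              (∀ i, (F (D i) (δ i)).IsLift (F B β) (ι i) (ι' i)) ∧ InvKK.IsDirectSum ι') := by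
  classical
  have : Finite L := hL
  obtain ⟨n, hn, ⟨D⟩⟩ := α.exists_spectralData
  refine ⟨n, hn, fun B _ β => D.coind β hP hE, fun B _ β => ?_, fun B C _ _ β γ f hf => ?_,
    fun I E _ δ B _ β ι hι h => ?_⟩
  · exact ⟨((InvKK.Link.coind D β hP hE).kkEquiv hP hE).symm⟩
  · exact ⟨D.coindMap hP hE hf, D.coindMap_isLift hP hE hf⟩
  · exact ⟨fun i => D.coindMap hP hE (hι i), fun i => D.coindMap_isLift hP hE (hι i),
      D.coind_isDirectSum hP hE δ ι hι h⟩
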